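/- **Conventions.** Smooth means $C^\infty$. Let $X$ be a smooth manifold of dimension $n$, possibly with boundary. A map from a subset $A$ of a manifold to a manifold is smooth if it extends to a smooth map on an open neighborhood of $A$; a diffeomorphism between subsets is a smooth bijection with smooth inverse. Let $\Delta^k=\{x\in\mathbb R^{k+1}\mid x_i\ge 0,\ \sum_{i=0}^k x_i=1\}$ with vertices $e_0,\dots,e_k$. For $\emptyset\neq A\subset\{0,\dots,k\}$ put $\mu_A(x)=\sum_{i\notin A}x_i$; the open face given by $A$ is $\{x\in\Delta^k\mid \mu_A(x)=0,\ x_i>0\text{ for } i\in A\}$. A *stratified subset* $Z$ of $X$ is a locally finite collection of disjoint smooth submanifolds (strata) without boundary, contained in the interior of $X$, with closed union, such that $S\cap\mathrm{Cl}\,T\ne\emptyset$ implies $S\subset\mathrm{Cl}\,T$ for strata $S,T$. Write $T\prec S$ if $T\ne S$ and $T\subset \mathrm{Cl}\,S$. A *parameterization* of a stratum $S$ is a diffeomorphism $h\colon\Delta^k\to\mathrm{Cl}\,S$, $k=\dim S$, mapping every open face of $\Delta^k$ onto a stratum of $Z$. $Z$ is *simplicial* if every stratum has a parameterization. For $T\prec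 S$, let $A_{Th}=\{i\mid h(e_i)\in \mathrm{Cl}\,T\}$ be the set of vertices of the face $h^{-1}(\mathrm{Cl}\,T)$. A smooth function $\rho\colon U\to[0,\infty)$ on an open neighborhood $U$ of a submanifold $N$ is *distancelike around $N$* if it vanishes on $N$ and its Hessian at each point of $N$ has rank equal to the codimension of $N$. *Tubular data* for $Z$ consist, for every stratum $S$, of a distancelike function $\rho_S\colon U_S\to[0,\infty)$ around $S$, a smooth retraction $\pi_S\colon U_S\to S$, a smooth function $\gamma_S\colon S\to(0,\infty)$, and a diffeomorphism $\nu_S$ from $U_S$ onto $V_S=\{(x,y)\in S\times\mathbb R^{n-\dim S}\mid |y|^2<\gamma_S(x)\}$ with $\nu_S(x)=(x,0)$ for $x\in S$, such that 1. $U_S\cap U_T=\pi_S^{-1}(S\cap U_T)$ if $T\prec S$; 2. $\pi_T\pi_S=\pi_T$ and $\rho_T\pi_S=\rho_T$ on $U_S\cap U_T$ if $T\prec S$; 3. if $U_S\cap U_T\neq\emptyset$ then $S\prec T$, $T\prec S$ or $S=T$; 4. if $T_1\prec\cdots\prec T_\ell\prec S$ with $\ell\ge 1$, then $(\rho_{T_1},\dots,\rho_{T_\ell},\pi_{T_1})\colon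 S\cap U_{T_1}\cap\cdots\cap U_{T_\ell}\to(0,\infty)^\ell\times T_1$ is a submersion; 5. $\nu_S\pi_S\nu_S^{-1}(x,y)=(x,0)$ and $\rho_S\nu_S^{-1}(x,y)=|y|^2$ on $V_S$. Preimages under $\rho_T$ are subsets of $U_T$. Let real numbers $\tau_S$ and $\tau_{S,i}$ ($\dim S\le i\le\dim Z$, where $\dim Z$ is the largest dimension of a stratum) be given for every stratum $S$, and put $$K_S=S-\bigcup_{T\prec S}\rho_T^{-1}([0,\tau_{T,\dim T})).$$ Suppose that $0<\tau_{S,\dim S}<\tau_{S,\dim S+1}<\cdots<\tau_{S,\dim Z}<\tau_S$ for every stratum $S$, and that $(x,y)\in\nu_S(U_S)$ whenever $x\in K_S$, $y\in\mathbb R^{n-\dim S}$ and $|y|^2\le\tau_S$. **Lemma.** Let $Z$ be a simplicial stratified subset of $X$ with tubular data and parameters $\tau_S,\tau_{S,i}$ as above, and let $S$ be a stratum of $Z$ of dimension $k$. Then there is a parameterization $h\colon\Delta^k\to \mathrm{Cl}\,S$ of $S$ such that for every $T\prec S$ and $t\in[\tau_{T,\dim T},\tau_T]$ there is an $s$ with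 $h^{-1}(K_S\cap\rho_T^{-1}(t))\subset\mu_{A_{Th}}^{-1}(s)$. In fact, there are $\delta_T>0$ for $T\prec S$ such that, with $$\Delta'=\Delta^k-\bigcup_{T\prec S}\mu_{A_{Th}}^{-1}([0,\delta_T\tau_{T,\dim T})),$$ we have $h^{-1}(K_S)=\Delta'$, and for every $T\prec S$ and $t\in[\tau_{T,\dim T},\tau_T]$, $$h^{-1}(K_S\cap\rho_T^{-1}(t))=\Delta'\cap\mu_{A_{Th}}^{-1}(t\delta_T).$$ In particular only finitely many $T$ satisfy $T\prec S$, and $h^{-1}(K_S)=\{x\in\Delta^k\mid \mu_{A_{Th}}(x)\ge\delta_T\tau_{T,\dim T}\text{ for all }T\prec S\}$ is a polyhedron cut out by finitely many half-spaces. -/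

import Mathlib

open Set Topology Manifold
open scoped ContDiff

noncomputable section

namespace SimplicialStrat

/-! ### Smooth maps between subsets of manifolds -/

section SmoothSubsets

variable {E : Type*} [NormedAddCommGroup E] [NormedSpace ℝ E]
  {H : Type*} [TopologicalSpace H] (I : ModelWithCorners ℝ E H)
  {M : Type*} [TopologicalSpace M] [ChartedSpace H M]
  {E' : Type*} [NormedAddCommGroup E'] [NormedSpace ℝ E']
  {H' : Type*} [TopologicalSpace H'] (J : ModelWithCorners ℝ E' H')
  {N : Type*} [TopologicalSpace N] [ChartedSpace H' N]

/-- A map defined on a subset `A` of a manifold is smooth if it extends to a smooth map on an open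
neighbourhood of `A`. Only the values of `f` on `A` matter. -/
def SmoothOnSubset (f : M → N) (A : Set M) : Prop :=
  ∃ W : Set M, IsOpen W ∧ A ⊆ W ∧ ∃ F : M → N, ContMDiffOn I J ∞ F W ∧ EqOn F f A

/-- `f` restricts to a diffeomorphism from the subset `A` of `M` onto the subset `B` of `N`:
a smooth bijection with smooth inverse. -/
def IsDiffeoOn (f : M → N) (A : Set M) (B : Set N) : Prop :=
  BijOn f A B ∧ SmoothOnSubset I J f A ∧
    ∃ g : N → M, SmoothOnSubset J I g B ∧ ∀ x ∈ A, g (f x) = x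

/-- `S` is a (boundaryless, embedded) smooth submanifold of dimension `k`: around each of its
points there are smooth coordinates in which `S` is a linear subspace of dimension `k`. -/
def IsSubmanifold (k : ℕ) (S : Set M) : Prop :=
  ∀ x ∈ S, ∃ φ : OpenPartialHomeomorph M E, x ∈ φ.source ∧
    ContMDiffOn I 𝓘(ℝ, E) ∞ φ φ.source ∧ ContMDiffOn 𝓘(ℝ, E) I ∞ φ.symm φ.target ∧
    ∃ L : Submodule ℝ E, Module.finrank ℝ L = k ∧ φ.source ∩ S = φ.source ∩ φ ⁻¹' (L : Set E)

/-- The tangent space of a submanifold `S` at `x ∈ S`, as a subset of the tangent space of the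
ambient manifold: velocities at time `0` of smooth curves in `S` which are at `x` at time `0`. -/
def tangentSet (S : Set M) (x : M) : Set (TangentSpace I x) :=
  {v | ∃ c : ℝ → M, c 0 = x ∧ (∀ᶠ t in 𝓝 (0 : ℝ), c t ∈ S) ∧ ContMDiffAt 𝓘(ℝ, ℝ) I ∞ c 0 ∧
    mfderiv 𝓘(ℝ, ℝ) I c 0 (1 : ℝ) = v}

/-- The Hessian at `x` (in the preferred chart at `x`) of a real function on a manifold, as a linear
map `E → E*`. Its rank is independent of the chart when `x` is a critical point. -/
def hessian (ρ : M → ℝ) (x : M) : E →L[ℝ] E →L[ℝ] ℝ :=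
  fderiv ℝ (fderiv ℝ (ρ ∘ (extChartAt I x).symm)) (extChartAt I x x)

/-- `ρ : U → [0,∞)` is distancelike around the `k`-dimensional submanifold `S`: it is a smooth
function on an open neighbourhood `U` of `S`, vanishes on `S`, and its Hessian at each
point of `S` has rank equal to the codimension of `S`. -/
structure IsDistancelike (k : ℕ) (S U : Set M) (ρ : M → ℝ) : Prop where
  isOpen : IsOpen U
  subset : S ⊆ U
  smooth : ContMDiffOn I 𝓘(ℝ, ℝ) ∞ ρ U
  nonneg : ∀ x ∈ U, 0 ≤ ρ x
  zero : ∀ x ∈ S, ρ x = 0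
  rank : ∀ x ∈ S, Module.finrank ℝ (LinearMap.range (hessian I ρ x).toLinearMap) + k =
    Module.finrank ℝ E

end SmoothSubsets

/-! ### The standard simplex `{x ∈ ℝ^{k+1} | x_i ≥ 0, ∑ x_i = 1}` is `stdSimplex ℝ (Fin (k + 1))` -/

/-- The open face of the standard simplex spanned by the vertices in `A`. -/
def openFace {k : ℕ} (A : Finset (Fin (k + 1))) : Set (Fin (k + 1) → ℝ) :=
  {x | x ∈ stdSimplex ℝ (Fin (k + 1)) ∧ (∀ i ∈ A, 0 < x i) ∧ ∀ i ∉ A, x i = 0}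

/-- The linear function `μ_A(x) = ∑_{i ∉ A} x_i`. -/
def mu {k : ℕ} (A : Finset (Fin (k + 1))) (x : Fin (k + 1) → ℝ) : ℝ :=
  ∑ i ∈ Aᶜ, x i

/-! ### Stratified subsets -/

section Strat

variable {E : Type*} [NormedAddCommGroup E] [NormedSpace ℝ E]
  {H : Type*} [TopologicalSpace H] (I : ModelWithCorners ℝ E H)
  (X : Type*) [TopologicalSpace X] [ChartedSpace H X]

/-- A stratified subset of `X`, as a family of strata. -/
structure StratifiedSubset (ι : Type*) where
  /-- the strata -/
  stratum : ι → Set X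
  /-- the dimensions of the strata -/
  dim : ι → ℕ
  isSubmanifold : ∀ i, IsSubmanifold I (dim i) (stratum i)
  subset_interior : ∀ i, stratum i ⊆ I.interior X
  disjoint : ∀ i j, i ≠ j → Disjoint (stratum i) (stratum j)
  frontier : ∀ i j, (stratum i ∩ closure (stratum j)).Nonempty → stratum i ⊆ closure (stratum j)
  locallyFinite : LocallyFinite stratum
  isClosed_iUnion : IsClosed (⋃ i, stratum i)

variable {I X} {ι : Type*}

namespace StratifiedSubset

/-- `T ≺ S`: the stratum `T` is different from `S` and contained in the closure of `S`. -/
def Prec (Z : StratifiedSubset I X ι) (T S : ι) : Prop :=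
  T ≠ S ∧ Z.stratum T ⊆ closure (Z.stratum S)

/-- The dimension of `Z`, i.e. the largest dimension of a stratum. -/
def dimZ (Z : StratifiedSubset I X ι) : ℕ := sSup (range Z.dim)

/-- `h : Δ^k → Cl S`, `k = dim S`, is a parameterization of the stratum `S`: a diffeomorphism which
maps each open face of `Δ^k` onto a stratum. -/
def IsParameterization (Z : StratifiedSubset I X ι) (S : ι)
    (h : (Fin (Z.dim S + 1) → ℝ) → X) : Prop :=
  IsDiffeoOn 𝓘(ℝ, Fin (Z.dim S + 1) → ℝ) I h (stdSimplex ℝ (Fin (Z.dim S + 1)))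
      (closure (Z.stratum S)) ∧
    ∀ A : Finset (Fin (Z.dim S + 1)), A.Nonempty → ∃ T : ι, h '' openFace A = Z.stratum T

/-- A stratified subset is simplicial if each stratum has a parameterization. -/
def IsSimplicial (Z : StratifiedSubset I X ι) : Prop :=
  ∀ S, ∃ h, Z.IsParameterization S h

open Classical in
/-- `A_{T,h}`: the vertices of the face `h⁻¹(Cl T)` of the simplex. -/
def faceVertices (Z : StratifiedSubset I X ι) (T : ι) {k : ℕ} (h : (Fin (k + 1) → ℝ) → X) :
    Finset (Fin (k + 1)) :=
  Finset.univ.filter fun i => h (Pi.single i 1) ∈ closure (Z.stratum T)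

end StratifiedSubset

/-- Tubular data for a stratified subset. The functions `ρ i`, `π i`, `ν i` matter only
on the neighbourhood `U i`, and `γ i` only on the stratum. -/
structure TubularData (Z : StratifiedSubset I X ι) where
  /-- the open neighbourhoods of the strata -/
  U : ι → Set X
  /-- the distancelike functions -/
  ρ : ι → X → ℝ
  /-- the retractions -/
  π : ι → X → X
  /-- the trivializations, with values in `S × ℝ^{dim X - dim S}` -/
  ν : (S : ι) → X → X × EuclideanSpace ℝ (Fin (Module.finrank ℝ E - Z.dim S))
  /-- the squared radii of the images of the trivializations -/
  γ : ι → X → ℝ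
  distancelike : ∀ S, IsDistancelike I (Z.dim S) (Z.stratum S) (U S) (ρ S)
  π_smooth : ∀ S, ContMDiffOn I I ∞ (π S) (U S)
  π_mapsTo : ∀ S, MapsTo (π S) (U S) (Z.stratum S)
  π_retraction : ∀ S, ∀ x ∈ Z.stratum S, π S x = x
  γ_smooth : ∀ S, SmoothOnSubset I 𝓘(ℝ, ℝ) (γ S) (Z.stratum S)
  γ_pos : ∀ S, ∀ x ∈ Z.stratum S, 0 < γ S x
  /-- `ν_S` is a diffeomorphism from `U_S` onto `V_S = {(x,y) | x ∈ S, |y|² < γ_S(x)}` -/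
  ν_diffeo : ∀ S, IsDiffeoOn I
    (I.prod 𝓘(ℝ, EuclideanSpace ℝ (Fin (Module.finrank ℝ E - Z.dim S)))) (ν S) (U S)
    {p | p.1 ∈ Z.stratum S ∧ ‖p.2‖ ^ 2 < γ S p.1}
  /-- `ν_S` restricts to the identification of `S` with `S × 0` -/
  ν_stratum : ∀ S, ∀ x ∈ Z.stratum S, ν S x = (x, 0)
  /-- `ν_S π_S ν_S⁻¹ (x,y) = (x,0)` -/
  ν_π : ∀ S, ∀ z ∈ U S, ν S (π S z) = ((ν S z).1, 0)
  /-- `ρ_S ν_S⁻¹ (x,y) = |y|²` -/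
  ρ_ν : ∀ S, ∀ z ∈ U S, ρ S z = ‖(ν S z).2‖ ^ 2
  inter_eq : ∀ T S, Z.Prec T S → U S ∩ U T = {x | x ∈ U S ∧ π S x ∈ Z.stratum S ∩ U T}
  π_π : ∀ T S, Z.Prec T S → ∀ x ∈ U S ∩ U T, π T (π S x) = π T x
  ρ_π : ∀ T S, Z.Prec T S → ∀ x ∈ U S ∩ U T, ρ T (π S x) = ρ T x
  comparable : ∀ S T, (U S ∩ U T).Nonempty → Z.Prec S T ∨ Z.Prec T S ∨ S = T
  /-- For `T_0 ≺ ⋯ ≺ T_ℓ ≺ S`, the map `(ρ_{T_0}, …, ρ_{T_ℓ}, π_{T_0})` from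
  `S ∩ U_{T_0} ∩ ⋯ ∩ U_{T_ℓ}` to `(0,∞)^{ℓ+1} × T_0` is a submersion: its differential maps the
  tangent space of `S` onto the tangent space of the target. -/
  submersion : ∀ (ℓ : ℕ) (T : Fin (ℓ + 1) → ι) (S : ι),
    (∀ i j, i < j → Z.Prec (T i) (T j)) → (∀ i, Z.Prec (T i) S) →
    ∀ z ∈ Z.stratum S, (∀ i, z ∈ U (T i)) →
      (∀ i, 0 < ρ (T i) z) ∧
      ∀ a : Fin (ℓ + 1) → ℝ, ∀ w ∈ tangentSet I (Z.stratum (T 0)) (π (T 0) z),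
        ∃ v ∈ tangentSet I (Z.stratum S) z,
          (∀ i, mfderiv I 𝓘(ℝ, ℝ) (ρ (T i)) z v = a i) ∧ mfderiv I I (π (T 0)) z v = w

namespace TubularData

variable {Z : StratifiedSubset I X ι} (D : TubularData Z)

/-- For numbers `τ'_{T,i}`, the set
`K_S = S - ⋃_{T ≺ S} ρ_T⁻¹([0, τ'_{T, dim T}))`, where `ρ_T⁻¹` of a set is a subset of `U_T`. -/
def core (τ' : ι → ℕ → ℝ) (S : ι) : Set X :=
  Z.stratum S \ ⋃ T ∈ {T | Z.Prec T S}, {x | x ∈ D.U T ∧ D.ρ T x ∈ Ico 0 (τ' T (Z.dim T))}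

/-- Admissibility of the parameters `τ_S` and `τ'_{S,i}` (for `dim S ≤ i ≤ dim Z`). -/
structure Admissible (τ : ι → ℝ) (τ' : ι → ℕ → ℝ) : Prop where
  pos : ∀ S, 0 < τ' S (Z.dim S)
  lt_succ : ∀ S i, Z.dim S ≤ i → i < Z.dimZ → τ' S i < τ' S (i + 1)
  lt : ∀ S, τ' S Z.dimZ < τ S
  /-- if `x ∈ K_S` and `|y|² ≤ τ_S` then `(x,y) ∈ ν_S(U_S)` -/
  disc : ∀ S, ∀ x ∈ D.core τ' S,
    ∀ y : EuclideanSpace ℝ (Fin (Module.finrank ℝ E - Z.dim S)),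
      ‖y‖ ^ 2 ≤ τ S → (x, y) ∈ D.ν S '' D.U S

end TubularData

end Strat

end SimplicialStrat

end

/-! Start from any parameterization and precompose it, one proper face `A` at a time and smaller
faces first, with a diffeomorphism of the ambient vector space that preserves every open face of the
simplex. After the step for `A`, the pulled back distance from the stratum `T A` equals `μ_A / δ_A`
on a range of values containing the required one, at points not too close to the proper subfaces of
`A` (`IsStraight`).

For one step, let `g₀` be the pulled back distance. A function `g₁` is built which agrees with `g₀`
close to the face and far from it, and is `μ_A / d` in between (`exists_profile`,
`exists_straightening`); a cutoff makes it return to `g₀` near the proper subfaces of `A`. On the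
simplex, `g₀` and `g₁` differ only in a compact set `N`. At each point of `N` there is a direction,
tangent to the faces, along which both functions increase. Then `exists_isotopy` moves one function
to the other by sliding points along such directions in small balls, where the sliding is solved by
the intermediate value and inverse function theorems.

The directions have two sources. In general the submersion condition for chains of strata yields a
vector increasing the distance from `T A` while fixing the distances from smaller strata
(`exists_tangent_direction`). Close to the face, where `μ_A` must increase as well, the radial
direction works: the distance is the squared norm of a normal coordinate `f`, and `f` is there
comparable with its derivative in the radial direction (`eventually_radial_pos`).

Earlier work survives. For `C ⊂ A` the directions keep `μ_C` fixed where it is at most a bound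
`b_C`, so the diffeomorphism preserves `min (μ_C, b_C)`. For `C` incomparable with `A`, the tubes of
`T A` and `T C` are disjoint and the diffeomorphism is supported in the former. Compactness of the
tubes over the truncated faces follows from the disc condition, which gives `τ_T < γ_T` on the core
of `T` (`lt_γ`). A little room is lost at each step, so the lower thresholds are kept strictly below
`τ_{T, dim T}` and the upper ones strictly above `τ_T`. -/

noncomputable section

namespace SimplicialStrat

/-! ### Monotone smooth functions of one variable -/

/-- A smooth monotone function with prescribed affine germs at both ends. -/
theorem exists_smooth_glue {x₁ x₂ y₁ y₂ p q : ℝ} (hx : x₁ < x₂) (hy : y₁ < y₂)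
    (hp : 0 ≤ p) (hq : 0 ≤ q) :
    ∃ φ φ' : ℝ → ℝ, ContDiff ℝ ∞ φ ∧ (∀ x, HasDerivAt φ (φ' x) x) ∧ (∀ x, 0 ≤ φ' x) ∧
      (∀ x ∈ Ioo x₁ x₂, 0 < φ' x) ∧
      (∀ x ≤ x₁, φ x = y₁ + p * (x - x₁) ∧ φ' x = p) ∧
      (∀ x, x₂ ≤ x → φ x = y₂ + q * (x - x₂) ∧ φ' x = q) := by
  -- The slopes `p` and `q` are faded out over a width `η`. They then contribute at most `(p + q) *
  -- η` to the rise, which leaves a positive amount for the bump `ψ₃`.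
  obtain ⟨η, hη0, hηx, hηy⟩ : ∃ η : ℝ, 0 < η ∧ η ≤ x₂ - x₁ ∧ (p + q) * η < y₂ - y₁ := by
    refine ⟨min (x₂ - x₁) ((y₂ - y₁) / (p + q + 1)), ?_, min_le_left _ _, ?_⟩
    · exact lt_min (by linarith) (div_pos (by linarith) (by linarith))
    · have h1 : min (x₂ - x₁) ((y₂ - y₁) / (p + q + 1)) ≤ (y₂ - y₁) / (p + q + 1) :=
        min_le_right _ _
      have h2 : (y₂ - y₁) / (p + q + 1) * (p + q + 1) = y₂ - y₁ := by
        field_simp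
      have h3 : 0 < (y₂ - y₁) / (p + q + 1) := div_pos (by linarith) (by linarith)
      nlinarith
  let S := Real.smoothTransition
  let ψ₁ : ℝ → ℝ := fun x => p * S ((x₁ + η - x) / η)
  let ψ₂ : ℝ → ℝ := fun x => q * S ((x - x₂ + η) / η)
  let ψ₃ : ℝ → ℝ := fun x => S (x - x₁) * S (x₂ - x)
  have hS : ContDiff ℝ ∞ S := Real.smoothTransition.contDiff
  have d₁ : ContDiff ℝ ∞ ψ₁ := contDiff_const.mul (hS.comp (by fun_prop))
  have d₂ : ContDiff ℝ ∞ ψ₂ := contDiff_const.mul (hS.comp (by fun_prop))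
  have d₃ : ContDiff ℝ ∞ ψ₃ := (hS.comp (by fun_prop)).mul (hS.comp (by fun_prop))
  have hSn : ∀ x, 0 ≤ S x := Real.smoothTransition.nonneg
  have hS1 : ∀ x, S x ≤ 1 := Real.smoothTransition.le_one
  have n₁ : ∀ x, 0 ≤ ψ₁ x := fun x => mul_nonneg hp (hSn _)
  have n₂ : ∀ x, 0 ≤ ψ₂ x := fun x => mul_nonneg hq (hSn _)
  have n₃ : ∀ x, 0 ≤ ψ₃ x := fun x => mul_nonneg (hSn _) (hSn _)
  have pos₃ : ∀ x ∈ Ioo x₁ x₂, 0 < ψ₃ x := fun x hx =>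
    mul_pos (Real.smoothTransition.pos_of_pos (by linarith [hx.1]))
      (Real.smoothTransition.pos_of_pos (by linarith [hx.2]))
  have ii : ∀ {f : ℝ → ℝ} (_ : ContDiff ℝ ∞ f) (a b : ℝ),
      IntervalIntegrable f MeasureTheory.volume a b := fun hf a b =>
    hf.continuous.intervalIntegrable a b
  have I₁ : ∫ x in x₁..x₂, ψ₁ x ≤ p * η := by
    rw [← intervalIntegral.integral_add_adjacent_intervals (ii d₁ x₁ (x₁ + η)) (ii d₁ _ x₂)]
    have h1 : ∫ x in x₁..(x₁ + η), ψ₁ x ≤ p * η := by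
      have := intervalIntegral.integral_mono_on (by linarith) (ii d₁ x₁ (x₁ + η))
        (ii (contDiff_const (c := p)) _ _)
        (fun x _ => show ψ₁ x ≤ p from mul_le_of_le_one_right hp (hS1 _))
      simpa [mul_comm] using this
    have h2 : ∫ x in (x₁ + η)..x₂, ψ₁ x = 0 := by
      rw [intervalIntegral.integral_congr (g := fun _ => (0 : ℝ))]
      · simp
      · intro x hx
        rw [uIcc_of_le (by linarith)] at hx
        have : S ((x₁ + η - x) / η) = 0 := Real.smoothTransition.zero_of_nonpos
          (div_nonpos_of_nonpos_of_nonneg (by linarith [hx.1]) hη0.le)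
        simp [ψ₁, this]
    linarith
  have I₂ : ∫ x in x₁..x₂, ψ₂ x ≤ q * η := by
    rw [← intervalIntegral.integral_add_adjacent_intervals (ii d₂ x₁ (x₂ - η)) (ii d₂ _ x₂)]
    have h1 : ∫ x in (x₂ - η)..x₂, ψ₂ x ≤ q * η := by
      have := intervalIntegral.integral_mono_on (by linarith) (ii d₂ (x₂ - η) x₂)
        (ii (contDiff_const (c := q)) _ _)
        (fun x _ => show ψ₂ x ≤ q from mul_le_of_le_one_right hq (hS1 _))
      simpa [mul_comm] using this
    have h2 : ∫ x in x₁..(x₂ - η), ψ₂ x = 0 := by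
      rw [intervalIntegral.integral_congr (g := fun _ => (0 : ℝ))]
      · simp
      · intro x hx
        rw [uIcc_of_le (by linarith)] at hx
        have : S ((x - x₂ + η) / η) = 0 := Real.smoothTransition.zero_of_nonpos
          (div_nonpos_of_nonpos_of_nonneg (by linarith [hx.2]) hη0.le)
        simp [ψ₂, this]
    linarith
  have I₃ : 0 < ∫ x in x₁..x₂, ψ₃ x :=
    intervalIntegral.intervalIntegral_pos_of_pos_on (ii d₃ _ _) pos₃ hx
  -- The weight that makes the derivative integrate to exactly `y₂ - y₁`.
  let c : ℝ := (y₂ - y₁ - (∫ x in x₁..x₂, ψ₁ x) - ∫ x in x₁..x₂, ψ₂ x) / ∫ x in x₁..x₂, ψ₃ x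
  have hc : 0 < c := div_pos (by linarith) I₃
  let ψ : ℝ → ℝ := fun x => ψ₁ x + ψ₂ x + c * ψ₃ x
  have dψ : ContDiff ℝ ∞ ψ := (d₁.add d₂).add (contDiff_const.mul d₃)
  have total : ∫ x in x₁..x₂, ψ x = y₂ - y₁ := by
    have e : ∫ x in x₁..x₂, ψ x
        = (∫ x in x₁..x₂, ψ₁ x) + (∫ x in x₁..x₂, ψ₂ x) + c * ∫ x in x₁..x₂, ψ₃ x := by
      rw [← intervalIntegral.integral_const_mul, ← intervalIntegral.integral_add (ii d₁ _ _)
        (ii d₂ _ _), ← intervalIntegral.integral_add ((ii d₁ _ _).add (ii d₂ _ _))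
        (ii (contDiff_const.mul d₃) _ _)]
    rw [e, div_mul_cancel₀ _ I₃.ne']
    ring
  have low : ∀ x ≤ x₁, ψ x = p := by
    intro x hx'
    have a1 : S ((x₁ + η - x) / η) = 1 := Real.smoothTransition.one_of_one_le
      ((one_le_div hη0).2 (by linarith))
    have a2 : S ((x - x₂ + η) / η) = 0 := Real.smoothTransition.zero_of_nonpos
          (div_nonpos_of_nonpos_of_nonneg (by linarith) hη0.le)
    have a3 : S (x - x₁) = 0 := Real.smoothTransition.zero_of_nonpos (by linarith)
    simp [ψ, ψ₁, ψ₂, ψ₃, a1, a2, a3]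
  have high : ∀ x, x₂ ≤ x → ψ x = q := by
    intro x hx'
    have a1 : S ((x₁ + η - x) / η) = 0 := Real.smoothTransition.zero_of_nonpos
          (div_nonpos_of_nonpos_of_nonneg (by linarith) hη0.le)
    have a2 : S ((x - x₂ + η) / η) = 1 := Real.smoothTransition.one_of_one_le
      ((one_le_div hη0).2 (by linarith))
    have a3 : S (x₂ - x) = 0 := Real.smoothTransition.zero_of_nonpos (by linarith)
    simp [ψ, ψ₁, ψ₂, ψ₃, a1, a2, a3]
  let φ : ℝ → ℝ := fun x => y₁ + ∫ t in x₁..x, ψ t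
  have hφ : ∀ x, HasDerivAt φ (ψ x) x := fun x =>
    (intervalIntegral.integral_hasDerivAt_right (ii dψ _ _)
      (dψ.continuous.stronglyMeasurableAtFilter _ _) dψ.continuous.continuousAt).const_add _
  refine ⟨φ, ψ, ?_, hφ, fun x => ?_, fun x hx' => ?_, fun x hx' => ⟨?_, low x hx'⟩,
    fun x hx' => ⟨?_, high x hx'⟩⟩
  · rw [contDiff_infty_iff_deriv]
    refine ⟨fun x => (hφ x).differentiableAt, ?_⟩
    rwa [show deriv φ = ψ from funext fun x => (hφ x).deriv]
  · exact add_nonneg (add_nonneg (n₁ x) (n₂ x)) (mul_nonneg hc.le (n₃ x))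
  · exact add_pos_of_nonneg_of_pos (add_nonneg (n₁ x) (n₂ x)) (mul_pos hc (pos₃ x hx'))
  · have : ∫ t in x₁..x, ψ t = ∫ t in x₁..x, p :=
      intervalIntegral.integral_congr fun t ht => by
        rw [uIcc_of_ge hx'] at ht
        exact low t ht.2
    simp only [φ, this, intervalIntegral.integral_const, smul_eq_mul]
    ring
  · have : ∫ t in x₂..x, ψ t = ∫ t in x₂..x, q :=
      intervalIntegral.integral_congr fun t ht => by
        rw [uIcc_of_le hx'] at ht
        exact high t ht.1
    have e := intervalIntegral.integral_add_adjacent_intervals (ii dψ x₁ x₂) (ii dψ x₂ x)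
    simp only [φ, ← e, this, total, intervalIntegral.integral_const, smul_eq_mul]
    ring

/-- The pair of monotone functions used to interpolate between a function near the ends of its
range and a linear function in the middle. -/
theorem exists_profile {e₀₀ e₀ e₂ θ a b m₀₀ m₁ δ : ℝ} (he : e₀₀ < e₀) (he₂ : e₀ < e₂)
    (hea : e₀₀ < a) (hab : a < b) (hbθ : b < θ) (heθ : e₂ < θ) (hδ : 0 < δ)
    (hm₀ : m₀₀ < δ * a) (hm₁ : δ * b < m₁) :
    ∃ (α β α' β' : ℝ → ℝ) (c₀ c₁ : ℝ), ContDiff ℝ ∞ α ∧ ContDiff ℝ ∞ β ∧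
      (∀ u, HasDerivAt α (α' u) u) ∧ (∀ u, HasDerivAt β (β' u) u) ∧
      (∀ u, 0 ≤ α' u) ∧ (∀ u, 0 ≤ β' u) ∧
      (∀ u ≤ e₀₀, α u = u) ∧ (∀ u < e₀, 0 < α' u) ∧ (∀ u, e₂ < u → 0 < α' u) ∧
      (∀ u ≤ m₀₀, β u = 0 ∧ β' u = 0) ∧ (∀ u ∈ Ioo m₀₀ m₁, 0 < β' u) ∧
      (∀ u, θ ≤ u → α u = u - c₁) ∧ (∀ u, m₁ ≤ u → β u = c₁ ∧ β' u = 0) ∧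
      (∀ u ≤ e₂, α u ≤ c₀) ∧ (∀ u, e₀ ≤ u → c₀ ≤ α u) ∧
      (∀ u ∈ Icc (δ * a) (δ * b), β u = u / δ - c₀) ∧
      (∀ u < δ * a, β u < a - c₀) ∧ (∀ u, δ * b < u → b - c₀ < β u) := by
  have hab' : δ * a < δ * b := mul_lt_mul_of_pos_left hab hδ
  -- `c₀` is the value of `α` on its plateau `[e₀, e₂]`, and `c₁` the final value of `β`. Any choice
  -- with `e₀₀ < c₀ < a` and `b - c₀ < c₁ < θ - c₀` would do: these inequalities say that the four
  -- pieces below rise.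
  let c₀ := (e₀₀ + a) / 2
  let c₁ := (b + θ) / 2 - c₀
  have hc₀ : c₀ = (e₀₀ + a) / 2 := rfl
  have hc₁ : c₁ = (b + θ) / 2 - c₀ := rfl
  obtain ⟨φ₁, ψ₁, s₁, d₁, n₁, p₁, l₁, r₁⟩ := exists_smooth_glue he
    (show e₀₀ < c₀ by linarith) zero_le_one le_rfl
  obtain ⟨φ₂, ψ₂, s₂, d₂, n₂, p₂, l₂, r₂⟩ := exists_smooth_glue heθ
    (show c₀ < θ - c₁ by linarith) le_rfl zero_le_one
  obtain ⟨φ₃, ψ₃, s₃, d₃, n₃, p₃, l₃, r₃⟩ := exists_smooth_glue hm₀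
    (show 0 < a - c₀ by linarith) le_rfl (inv_nonneg.2 hδ.le)
  obtain ⟨φ₄, ψ₄, s₄, d₄, n₄, p₄, l₄, r₄⟩ := exists_smooth_glue hm₁
    (show b - c₀ < c₁ by linarith) (inv_nonneg.2 hδ.le) le_rfl
  have mono : ∀ {φ ψ : ℝ → ℝ}, (∀ x, HasDerivAt φ (ψ x) x) → (∀ x, 0 ≤ ψ x) → Monotone φ :=
    fun hd hn => monotone_of_deriv_nonneg (fun x => (hd x).differentiableAt)
      fun x => by rw [(hd x).deriv]; exact hn x
  have strict : ∀ {φ ψ : ℝ → ℝ} {x y : ℝ}, (∀ x, HasDerivAt φ (ψ x) x) →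
      (∀ t ∈ Ioo x y, 0 < ψ t) → x < y → φ x < φ y := fun {φ ψ x y} hd hn hxy => by
    have := strictMonoOn_of_deriv_pos (convex_Icc x y) (f := φ)
      (fun t _ => (hd t).continuousAt.continuousWithinAt) (fun t ht => by
        rw [interior_Icc] at ht; rw [(hd t).deriv]; exact hn t ht)
    exact this (left_mem_Icc.2 hxy.le) (right_mem_Icc.2 hxy.le) hxy
  have lin₃ : ∀ u, δ * a ≤ u → φ₃ u = u / δ - c₀ := fun u hu => by
    rw [(r₃ u hu).1]; field_simp; ring
  have lin₄ : ∀ u ≤ δ * b, φ₄ u = u / δ - c₀ := fun u hu => by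
    rw [(l₄ u hu).1]; field_simp; ring
  -- Two pieces are joined by adding them and subtracting the affine function they share: `φ₁` and
  -- `φ₂` are both `c₀` on `[e₀, e₂]`, while `φ₃` and `φ₄` are both `u / δ - c₀` on `[δ * a, δ *
  -- b]`.
  refine ⟨fun u => φ₁ u + φ₂ u - c₀, fun u => φ₃ u + φ₄ u - (u / δ - c₀),
    fun u => ψ₁ u + ψ₂ u, fun u => ψ₃ u + ψ₄ u - 1 / δ, c₀, c₁, by fun_prop,
    by fun_prop, fun u => ((d₁ u).add (d₂ u)).sub_const _, fun u =>
      ((d₃ u).add (d₄ u)).sub (((hasDerivAt_id u).div_const δ).sub_const c₀),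
    fun u => add_nonneg (n₁ u) (n₂ u), fun u => ?_, fun u hu => ?_, fun u hu => ?_,
    fun u hu => ?_, fun u hu => ?_, fun u hu => ?_, fun u hu => ?_, fun u hu => ?_,
    fun u hu => ?_, fun u hu => ?_, fun u hu => ?_, fun u hu => ?_, fun u hu => ?_⟩
  · rcases le_total u (δ * a) with h | h
    · have := (l₄ u (h.trans hab'.le)).2
      have := n₃ u
      simp only [one_div]; linarith
    · have := (r₃ u h).2
      have := n₄ u
      simp only [one_div]; linarith
  · have h1 := (l₁ u hu).1
    have h2 := (l₂ u (by linarith)).1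
    simp only [h1, h2]; ring
  · refine add_pos_of_pos_of_nonneg ?_ (n₂ u)
    rcases le_or_gt u e₀₀ with h | h
    · rw [(l₁ u h).2]; exact one_pos
    · exact p₁ u ⟨h, hu⟩
  · refine add_pos_of_nonneg_of_pos (n₁ u) ?_
    rcases le_or_gt θ u with h | h
    · rw [(r₂ u h).2]; exact one_pos
    · exact p₂ u ⟨hu, h⟩
  · have h1 := (l₃ u hu).1
    have h2 := lin₄ u (by linarith)
    refine ⟨by simp only [h1, h2]; ring, ?_⟩
    simp only [(l₃ u hu).2, (l₄ u (by linarith)).2, one_div]; ring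
  · rcases lt_or_ge u (δ * a) with h | h
    · have := (l₄ u (h.trans hab').le).2
      have := p₃ u ⟨hu.1, h⟩
      simp only [one_div]; linarith
    · have e := (r₃ u h).2
      rcases le_or_gt u (δ * b) with h' | h'
      · have := (l₄ u h').2
        have := inv_pos.2 hδ
        simp only [one_div]; linarith
      · have := p₄ u ⟨h', hu.2⟩
        simp only [one_div]; linarith
  · have h1 := (r₁ u (by linarith)).1
    have h2 := (r₂ u hu).1
    simp only [h1, h2]; ring
  · have h1 := lin₃ u (by linarith)
    have h2 := (r₄ u hu).1
    refine ⟨by simp only [h1, h2]; ring, ?_⟩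
    simp only [(r₃ u (by linarith)).2, (r₄ u hu).2, one_div]; ring
  · have h1 := mono d₁ n₁ (le_max_left u e₀)
    have h2 := (l₂ u hu).1
    have h3 := (r₁ (max u e₀) (le_max_right _ _)).1
    simp only [h2]; linarith
  · have h1 := mono d₂ n₂ (min_le_left u e₂)
    have h2 := (r₁ u hu).1
    have h3 := (l₂ (min u e₂) (min_le_right _ _)).1
    simp only [h2]; linarith
  · have h1 := lin₃ u hu.1
    have h2 := lin₄ u hu.2
    simp only [h1, h2]; ring
  · have h2 := lin₄ u (by linarith)
    have h1 : φ₃ u < φ₃ (δ * a) := by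
      rcases le_or_gt u m₀₀ with h | h
      · refine lt_of_le_of_lt (mono d₃ n₃ h) (strict d₃ p₃ hm₀)
      · exact strict d₃ (fun t ht => p₃ t ⟨h.trans ht.1, ht.2⟩) hu
    have h3 := lin₃ (δ * a) le_rfl
    rw [mul_div_cancel_left₀ _ hδ.ne'] at h3
    simp only [h2]; linarith
  · have h2 := lin₃ u (by linarith)
    have h1 : φ₄ (δ * b) < φ₄ u := by
      rcases le_or_gt m₁ u with h | h
      · refine lt_of_lt_of_le (strict d₄ p₄ hm₁) (mono d₄ n₄ h)
      · exact strict d₄ (fun t ht => p₄ t ⟨ht.1, ht.2.trans h⟩) hu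
    have h3 := lin₄ (δ * b) le_rfl
    rw [mul_div_cancel_left₀ _ hδ.ne'] at h3
    simp only [h2]; linarith

/-! ### Diffeomorphisms moving points along lines -/

section Lines

variable {E : Type*} [NormedAddCommGroup E] [NormedSpace ℝ E]

theorem strictMonoOn_line {W : Set E} (hW : IsOpen W) (hWc : Convex ℝ W) {v : E} {g : E → ℝ}
    (hg : ContDiffOn ℝ ∞ g W) (hd : ∀ x ∈ W, 0 < fderiv ℝ g x v) (x : E) :
    StrictMonoOn (fun t : ℝ => g (x + t • v)) {t | x + t • v ∈ W} := by
  have hder : ∀ t : ℝ, x + t • v ∈ W →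
      HasDerivAt (fun t : ℝ => g (x + t • v)) (fderiv ℝ g (x + t • v) v) t := fun t ht => by
    have h1 : HasDerivAt (fun t : ℝ => x + t • v) v t := by
      simpa using ((hasDerivAt_id t).smul_const v).const_add x
    have h2 := ((hg.contDiffAt (hW.mem_nhds ht)).differentiableAt (by simp)).hasFDerivAt
    exact h2.comp_hasDerivAt t h1
  have hconv : Convex ℝ {t : ℝ | x + t • v ∈ W} := by
    intro s hs t ht a b ha hb hab
    have e : x + (a • s + b • t) • v = a • (x + s • v) + b • (x + t • v) := by
      have : x = (a + b) • x := by rw [hab, one_smul]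
      nth_rewrite 1 [this]
      simp only [smul_eq_mul]
      module
    rw [mem_ofPred_eq, e]
    exact hWc hs ht ha hb hab
  refine strictMonoOn_of_deriv_pos hconv
    (fun t ht => (hder t ht).continuousAt.continuousWithinAt) fun t ht => ?_
  have ht := interior_subset ht
  rw [(hder t ht).deriv]
  exact hd _ ht

theorem eq_of_line {W : Set E} (hW : IsOpen W) (hWc : Convex ℝ W) {v : E} {g : E → ℝ}
    (hg : ContDiffOn ℝ ∞ g W) (hd : ∀ x ∈ W, 0 < fderiv ℝ g x v) {x : E} {s : ℝ} (hx : x ∈ W)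
    (hy : x + s • v ∈ W) (h : g (x + s • v) = g x) : s = 0 :=
  (strictMonoOn_line hW hWc hg hd x).injOn (show x + s • v ∈ W from hy)
    (show x + (0 : ℝ) • v ∈ W by simpa) (by simpa using h)

/-- The line through a point of `K` leaves `K` on both sides before it leaves `W`. At two such exit
points `g` and `g'` agree, so by monotonicity of `g'` the values of `g` there enclose `g' x`, and
the intermediate value theorem applies. -/
theorem exists_line_match {W K : Set E} (hW : IsOpen W) (hWc : Convex ℝ W) (hK : IsCompact K)
    (hKW : K ⊆ W) {v : E} {g g' : E → ℝ} (hg : ContDiffOn ℝ ∞ g W) (hg' : ContDiffOn ℝ ∞ g' W)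
    (hd : ∀ x ∈ W, 0 < fderiv ℝ g x v) (hd' : ∀ x ∈ W, 0 < fderiv ℝ g' x v)
    (heq : ∀ x ∈ W \ K, g x = g' x) {x : E} (hx : x ∈ W) :
    ∃ s : ℝ, x + s • v ∈ W ∧ g (x + s • v) = g' x := by
  by_cases hxK : x ∈ K
  swap
  · exact ⟨0, by simpa, by simpa using heq x ⟨hx, hxK⟩⟩
  have hv : v ≠ 0 := fun h => by simpa [h] using hd x hx
  have hcont : Continuous fun t : ℝ => x + t • v := by fun_prop
  let KI : Set ℝ := {t | x + t • v ∈ K}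
  have hKI : IsCompact KI := by
    refine Metric.isCompact_of_isClosed_isBounded (hK.isClosed.preimage hcont) ?_
    obtain ⟨R, hR⟩ := hK.isBounded.exists_norm_le
    refine isBounded_iff_forall_norm_le.2 ⟨(R + ‖x‖) / ‖v‖, fun t ht => ?_⟩
    rw [le_div_iff₀ (norm_pos_iff.2 hv), ← norm_smul]
    calc ‖t • v‖ = ‖(x + t • v) - x‖ := by simp
      _ ≤ ‖x + t • v‖ + ‖x‖ := norm_sub_le _ _
      _ ≤ R + ‖x‖ := by gcongr; exact hR _ ht
  have h0 : (0 : ℝ) ∈ KI := by simpa [KI]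
  have hIo : IsOpen {t : ℝ | x + t • v ∈ W} := hW.preimage hcont
  -- The last parameter at which the line meets `K` belongs to the open set `W`; a slightly larger
  -- one is still in `W` but no longer in `K`.
  obtain ⟨b, hb0, hbW, hbK⟩ : ∃ b : ℝ, 0 < b ∧ x + b • v ∈ W ∧ x + b • v ∉ K := by
    obtain ⟨T, hT, hTm⟩ := hKI.exists_isGreatest ⟨0, h0⟩
    have hTW : ∀ᶠ t in 𝓝[>] T, x + t • v ∈ W :=
      nhdsWithin_le_nhds (hIo.mem_nhds (hKW hT))
    obtain ⟨b, hb, hTb⟩ := (hTW.and self_mem_nhdsWithin).exists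
    exact ⟨b, lt_of_le_of_lt (hTm h0) hTb, hb, fun h => absurd (hTm h) (not_le.2 hTb)⟩
  obtain ⟨a, ha0, haW, haK⟩ : ∃ a : ℝ, a < 0 ∧ x + a • v ∈ W ∧ x + a • v ∉ K := by
    obtain ⟨T, hT, hTm⟩ := hKI.exists_isLeast ⟨0, h0⟩
    have hTW : ∀ᶠ t in 𝓝[<] T, x + t • v ∈ W :=
      nhdsWithin_le_nhds (hIo.mem_nhds (hKW hT))
    obtain ⟨b, hb, hTb⟩ := (hTW.and self_mem_nhdsWithin).exists
    exact ⟨b, lt_of_lt_of_le hTb (hTm h0), hb, fun h => absurd (hTm h) (not_le.2 hTb)⟩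
  have m' := strictMonoOn_line hW hWc hg' hd' x
  have hx0 : (0 : ℝ) ∈ {t : ℝ | x + t • v ∈ W} := by simpa
  have ha := m' (show a ∈ {t : ℝ | x + t • v ∈ W} from haW) hx0 ha0
  have hb := m' hx0 (show b ∈ {t : ℝ | x + t • v ∈ W} from hbW) hb0
  simp only [zero_smul, add_zero] at ha hb
  rw [← heq _ ⟨haW, haK⟩] at ha
  rw [← heq _ ⟨hbW, hbK⟩] at hb
  have hsub : ∀ t ∈ Icc a b, x + t • v ∈ W := fun t ht => by
    have h1 := hWc.segment_subset haW hbW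
    apply h1
    rw [segment_eq_image]
    refine ⟨(t - a) / (b - a), ⟨div_nonneg (by linarith [ht.1]) (by linarith),
      (div_le_one (by linarith)).2 (by linarith [ht.2])⟩, ?_⟩
    have hba : b - a ≠ 0 := by linarith
    have e : (1 - (t - a) / (b - a)) * a + (t - a) / (b - a) * b = t := by
      field_simp; ring
    simp only [smul_add, smul_smul]
    rw [add_add_add_comm, ← add_smul, ← add_smul, e]
    simp
  have hc : ContinuousOn (fun t : ℝ => g (x + t • v)) (Icc a b) :=
    hg.continuousOn.comp hcont.continuousOn hsub
  obtain ⟨s, hs, hs'⟩ := intermediate_value_Icc (by linarith) hc ⟨ha.le, hb.le⟩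
  exact ⟨s, hsub s hs, hs'⟩

variable [FiniteDimensional ℝ E]

/-- The sliding distance is unique because `g` is strictly monotone along lines. It depends smoothly
on the point by the inverse function theorem, since the derivative of `g` along `v` does not vanish.
-/
theorem exists_smooth_line_match {W K : Set E} (hW : IsOpen W) (hWc : Convex ℝ W)
    (hK : IsCompact K)
    (hKW : K ⊆ W) {v : E} {g g' : E → ℝ} (hg : ContDiffOn ℝ ∞ g W) (hg' : ContDiffOn ℝ ∞ g' W)
    (hd : ∀ x ∈ W, 0 < fderiv ℝ g x v) (hd' : ∀ x ∈ W, 0 < fderiv ℝ g' x v)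
    (heq : ∀ x ∈ W \ K, g x = g' x) :
    ∃ Φ : E → E, ContDiff ℝ ∞ Φ ∧ (∀ x ∉ K, Φ x = x) ∧
      ∀ x ∈ W, ∃ s : ℝ, Φ x = x + s • v ∧ Φ x ∈ W ∧ g (Φ x) = g' x := by
  classical
  choose! s hs hs' using fun x (hx : x ∈ W) =>
    exists_line_match hW hWc hK hKW hg hg' hd hd' heq hx
  let Φ : E → E := fun x => if x ∈ W then x + s x • v else x
  have hΦ : ∀ x ∈ W, Φ x = x + s x • v := fun x hx => if_pos hx
  have hΦK : ∀ x ∉ K, Φ x = x := fun x hx => by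
    by_cases hxW : x ∈ W
    · have := eq_of_line hW hWc hg hd hxW (hs x hxW) ((hs' x hxW).trans (heq x ⟨hxW, hx⟩).symm)
      rw [hΦ x hxW, this]; simp
    · exact if_neg hxW
  refine ⟨Φ, contDiff_iff_contDiffAt.2 fun x => ?_, hΦK, fun x hx =>
    ⟨s x, hΦ x hx, by rw [hΦ x hx]; exact hs x hx, by rw [hΦ x hx]; exact hs' x hx⟩⟩
  by_cases hx : x ∈ K
  swap
  · refine contDiffAt_id.congr_of_eventuallyEq ?_
    filter_upwards [hK.isClosed.isOpen_compl.mem_nhds hx] with y hy using hΦK y hy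
  have hxW := hKW hx
  set y := Φ x with hy
  have hyW : y ∈ W := by rw [hy, hΦ x hxW]; exact hs x hxW
  have hgy : g y = g' x := by rw [hy, hΦ x hxW]; exact hs' x hxW
  let dg := fderiv ℝ g y
  have hdv : 0 < dg v := hd y hyW
  let ℓ : E →L[ℝ] ℝ := (dg v)⁻¹ • dg
  have hℓ : ℓ v = 1 := by simp [ℓ, hdv.ne']
  -- `G` keeps the class modulo `v` and replaces the coordinate `ℓ` by `g`. It is injective on `W`
  -- with invertible derivative at `y`, and `G ∘ Φ = G'` on `W`, so that `Φ = G⁻¹ ∘ G'` near `x`.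
  let G : E → E := fun z => z + (g z - ℓ z) • v
  let G' : E → E := fun z => z + (g' z - ℓ z) • v
  have hGy : ContDiffAt ℝ ∞ G y := contDiffAt_id.add
    (((hg.contDiffAt (hW.mem_nhds hyW)).sub ℓ.contDiff.contDiffAt).smul contDiffAt_const)
  have hGx : ContDiffAt ℝ ∞ G' x := contDiffAt_id.add
    (((hg'.contDiffAt (hW.mem_nhds hxW)).sub ℓ.contDiff.contDiffAt).smul contDiffAt_const)
  have hGG : ∀ z ∈ W, G (Φ z) = G' z := fun z hz => by
    simp only [G, G', hΦ z hz, hs' z hz, map_add, map_smul, hℓ, smul_eq_mul, mul_one]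
    module
  have hinj : ∀ z ∈ W, ∀ w ∈ W, G z = G w → z = w := by
    intro z hz w hw h
    have h1 : ℓ (G z) = ℓ (G w) := by rw [h]
    have h2 : g z = g w := by simpa [G, hℓ] using h1
    have h3 : z = w + (ℓ z - ℓ w) • v := by
      have h' : z + (g z - ℓ z) • v = w + (g w - ℓ w) • v := h
      rw [h2] at h'
      calc z = w + (g w - ℓ w) • v - (g w - ℓ z) • v := eq_sub_of_add_eq h'
        _ = w + (ℓ z - ℓ w) • v := by module
    have h4 := eq_of_line hW hWc hg hd (x := w) (s := ℓ z - ℓ w) hw (by rwa [← h3])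
      (by rw [← h3, h2])
    rw [h3, h4]; simp
  let A : E →L[ℝ] E := ContinuousLinearMap.id ℝ E + (dg - ℓ).smulRight v
  have hA : HasFDerivAt G A y := (hasFDerivAt_id y).add
    ((((hg.contDiffAt (hW.mem_nhds hyW)).differentiableAt (by simp)).hasFDerivAt.sub
      ℓ.hasFDerivAt).smul_const v)
  have hAinj : Function.Injective A := by
    rw [injective_iff_map_eq_zero]
    intro w hw
    have h1 : w + (dg w - ℓ w) • v = 0 := by simpa [A] using hw
    have h2 : dg w = 0 := by simpa [hℓ] using congrArg ℓ h1
    have h3 : ℓ w = 0 := by simp [ℓ, h2]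
    simpa [h2, h3] using h1
  let Ae : E ≃L[ℝ] E := (LinearEquiv.ofInjectiveEndo (A : E →ₗ[ℝ] E) hAinj).toContinuousLinearEquiv
  have hAe : HasFDerivAt G (Ae : E →L[ℝ] E) y := by
    convert hA using 1
    ext w
    rfl
  let R := hGy.toOpenPartialHomeomorph G hAe (by simp)
  have hyR : y ∈ R.source := hGy.mem_toOpenPartialHomeomorph_source hAe (by simp)
  have hRsm : ContDiffAt ℝ ∞ R.symm (G y) := hGy.to_localInverse hAe (by simp)
  have hGyx : G y = G' x := hGG x hxW
  have hcomp : ContDiffAt ℝ ∞ (R.symm ∘ G') x := by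
    refine ContDiffAt.comp x ?_ hGx
    rw [← hGyx]; exact hRsm
  refine hcomp.congr_of_eventuallyEq ?_
  have hsymm : R.symm (G' x) = y := by
    rw [← hGyx]; exact R.left_inv hyR
  have e1 : ∀ᶠ z in 𝓝 x, G' z ∈ R.target :=
    hGx.continuousAt.eventually_mem (by
      rw [← hGyx]; exact R.open_target.mem_nhds (R.map_source hyR))
  have e2 : ∀ᶠ z in 𝓝 x, R.symm (G' z) ∈ W :=
    hcomp.continuousAt.eventually_mem (by
      simp only [Function.comp_apply, hsymm]; exact hW.mem_nhds hyW)
  filter_upwards [e1, e2, hW.mem_nhds hxW] with z h1 h2 h3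
  refine hinj _ ?_ _ h2 ?_
  · rw [hΦ z h3]; exact hs z h3
  · rw [hGG z h3]
    exact (R.right_inv h1).symm

/-- The hypotheses are symmetric in `g` and `g'`. The two sliding maps are mutually inverse because
a point of a line is determined by its value of `g`, or of `g'`. -/
theorem exists_diffeo_line_match {W K : Set E} (hW : IsOpen W) (hWc : Convex ℝ W)
    (hK : IsCompact K)
    (hKW : K ⊆ W) {v : E} {g g' : E → ℝ} (hg : ContDiffOn ℝ ∞ g W) (hg' : ContDiffOn ℝ ∞ g' W)
    (hd : ∀ x ∈ W, 0 < fderiv ℝ g x v) (hd' : ∀ x ∈ W, 0 < fderiv ℝ g' x v)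
    (heq : ∀ x ∈ W \ K, g x = g' x) :
    ∃ Φ : E ≃ E, ContDiff ℝ ∞ Φ ∧ ContDiff ℝ ∞ Φ.symm ∧ (∀ x ∉ K, Φ x = x) ∧
      ∀ x ∈ W, ∃ s : ℝ, Φ x = x + s • v ∧ Φ x ∈ W ∧ g (Φ x) = g' x := by
  obtain ⟨Φ, hΦs, hΦK, hΦ⟩ := exists_smooth_line_match hW hWc hK hKW hg hg' hd hd' heq
  obtain ⟨Ψ, hΨs, hΨK, hΨ⟩ := exists_smooth_line_match hW hWc hK hKW hg' hg hd' hd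
    fun x hx => (heq x hx).symm
  have inv : ∀ {Φ Ψ : E → E} {g g' : E → ℝ}, ContDiffOn ℝ ∞ g' W →
      (∀ x ∈ W, 0 < fderiv ℝ g' x v) → (∀ x ∉ K, Φ x = x) →
      (∀ x ∈ W, ∃ s : ℝ, Φ x = x + s • v ∧ Φ x ∈ W ∧ g (Φ x) = g' x) → (∀ x ∉ K, Ψ x = x) →
      (∀ x ∈ W, ∃ s : ℝ, Ψ x = x + s • v ∧ Ψ x ∈ W ∧ g' (Ψ x) = g x) →
      ∀ x, Ψ (Φ x) = x := by
    intro Φ Ψ g g' hg' hd' hΦK hΦ hΨK hΨ x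
    by_cases hx : x ∈ W
    · obtain ⟨s, hs, hsW, hsg⟩ := hΦ x hx
      obtain ⟨t, ht, htW, htg⟩ := hΨ _ hsW
      have e : Ψ (Φ x) = x + (s + t) • v := by rw [ht, hs]; module
      have := eq_of_line hW hWc hg' hd' hx (s := s + t) (by rwa [← e]) (by rw [← e, htg, hsg])
      rw [e, this]; simp
    · have hxK : x ∉ K := fun h => hx (hKW h)
      rw [hΦK x hxK, hΨK x hxK]
  exact ⟨⟨Φ, Ψ, inv hg' hd' hΦK hΦ hΨK hΨ, inv hg hd hΨK hΨ hΦK hΦ⟩, hΦs, hΨs, hΦK, hΦ⟩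

end Lines

/-! ### Moving one function to another by diffeomorphisms preserving an invariant -/

section Isotopy

variable {E : Type*} [NormedAddCommGroup E] [NormedSpace ℝ E] {Y : Type*}

/-- A diffeomorphism of a vector space which is the identity outside `O` and leaves the function
`inv` unchanged. -/
structure IsInvDiffeo (inv : E → Y) (O : Set E) (Φ : E ≃ E) : Prop where
  smooth : ContDiff ℝ ∞ Φ
  smooth_symm : ContDiff ℝ ∞ Φ.symm
  inv_eq : ∀ x, inv (Φ x) = inv x
  fix : ∀ x ∉ O, Φ x = x

theorem IsInvDiffeo.mem {inv : E → Y} {O : Set E} {Φ : E ≃ E} (h : IsInvDiffeo inv O Φ) {x : E}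
    (hx : x ∈ O) : Φ x ∈ O := by
  by_contra hn
  have := Φ.injective (h.fix _ hn)
  rw [this] at hn
  exact hn hx

theorem IsInvDiffeo.refl (inv : E → Y) (O : Set E) : IsInvDiffeo inv O (Equiv.refl E) :=
  ⟨contDiff_id, contDiff_id, fun _ => rfl, fun _ _ => rfl⟩

theorem IsInvDiffeo.trans {inv : E → Y} {O : Set E} {Φ Ψ : E ≃ E} (h : IsInvDiffeo inv O Φ)
    (h' : IsInvDiffeo inv O Ψ) : IsInvDiffeo inv O (Φ.trans Ψ) where
  smooth := h'.smooth.comp h.smooth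
  smooth_symm := h.smooth_symm.comp h'.smooth_symm
  inv_eq x := (h'.inv_eq _).trans (h.inv_eq x)
  fix x hx := by simp [h.fix x hx, h'.fix x hx]

/-- The function `g` can be moved to `g'` on the set `Q` by a diffeomorphism as above. -/
def Movable (inv : E → Y) (O Q : Set E) (g g' : E → ℝ) : Prop :=
  ∃ Φ : E ≃ E, IsInvDiffeo inv O Φ ∧ ∀ x ∈ Q ∩ O, g (Φ x) = g' x

theorem Movable.refl {inv : E → Y} {O Q : Set E} {g g' : E → ℝ} (h : ∀ x ∈ Q ∩ O, g x = g' x) :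
    Movable inv O Q g g' := ⟨_, IsInvDiffeo.refl inv O, h⟩

theorem Movable.trans {inv : E → Y} {O Q : Set E} (hQ : ∀ x y, inv x = inv y → x ∈ Q → y ∈ Q)
    {g g' g'' : E → ℝ} (h : Movable inv O Q g g') (h' : Movable inv O Q g' g'') :
    Movable inv O Q g g'' := by
  obtain ⟨Φ, hΦ, e⟩ := h
  obtain ⟨Ψ, hΨ, e'⟩ := h'
  exact ⟨_, hΨ.trans hΦ, fun x hx => (e _ ⟨hQ _ _ (hΨ.inv_eq x).symm hx.1, hΨ.mem hx.2⟩).trans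
    (e' x hx)⟩

/-- The first two terms form an interpolation between positive derivatives in the application. The
last one carries the factor `1 / M` and is negligible for large `M`. -/
theorem fderiv_interpolation {g₀ g₁ c : E → ℝ} {y : E} (h₀ : DifferentiableAt ℝ g₀ y)
    (h₁ : DifferentiableAt ℝ g₁ y) (hc : DifferentiableAt ℝ c y) (m M : ℝ) (v : E) :
    fderiv ℝ (fun x => g₀ x + (m + c x) / M * (g₁ x - g₀ x)) y v =
      (1 - (m + c y) / M) * fderiv ℝ g₀ y v + (m + c y) / M * fderiv ℝ g₁ y v +
        (g₁ y - g₀ y) * fderiv ℝ c y v / M := by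
  have ec : HasFDerivAt (fun x => (m + c x) * M⁻¹) (M⁻¹ • fderiv ℝ c y) y :=
    (hc.hasFDerivAt.const_add m).mul_const M⁻¹
  have ed : HasFDerivAt (fun x => g₁ x - g₀ x) (fderiv ℝ g₁ y - fderiv ℝ g₀ y) y :=
    h₁.hasFDerivAt.sub h₀.hasFDerivAt
  have e0 : HasFDerivAt g₀ (fderiv ℝ g₀ y) y := h₀.hasFDerivAt
  have e := e0.add (ec.mul ed)
  have e' : fderiv ℝ (fun x => g₀ x + (m + c x) * M⁻¹ * (g₁ x - g₀ x)) y = _ := e.fderiv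
  simp only [div_eq_mul_inv]
  rw [e']
  simp only [add_apply, smul_apply, smul_eq_mul,
    sub_apply]
  ring

variable [FiniteDimensional ℝ E]

/-- Two functions which agree away from a compact set, and which locally increase along a common
direction preserving `inv`, differ by a diffeomorphism preserving `inv`. -/
theorem exists_isotopy (inv : E → Y) {Q O N : Set E}
    (hQ : ∀ x y, inv x = inv y → x ∈ Q → y ∈ Q) (hO : IsOpen O) (hN : IsCompact N) (hNO : N ⊆ O)
    {g₀ g₁ : E → ℝ} (h₀ : ContDiffOn ℝ ∞ g₀ O) (h₁ : ContDiffOn ℝ ∞ g₁ O)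
    (heq : ∀ x ∈ Q ∩ O, x ∉ N → g₀ x = g₁ x)
    (hdir : ∀ x ∈ N, ∃ v, 0 < fderiv ℝ g₀ x v ∧ 0 < fderiv ℝ g₁ x v ∧
      ∃ W ∈ 𝓝 x, ∀ y ∈ W, ∀ s : ℝ, y + s • v ∈ W → inv (y + s • v) = inv y) :
    Movable inv O Q g₀ g₁ := by
  classical
  choose! v hv₀ hv₁ W hW hWinv using hdir
  have dcont : ∀ {g : E → ℝ} (_ : ContDiffOn ℝ ∞ g O) (w : E),
      ContinuousOn (fun y => fderiv ℝ g y w) O := fun hg w =>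
    (hg.continuousOn_fderiv_of_isOpen hO (by simp)).clm_apply continuousOn_const
  have hr : ∀ x ∈ N, ∃ r > 0, ∀ y ∈ Metric.closedBall x r, y ∈ O ∧ y ∈ W x ∧
      0 < fderiv ℝ g₀ y (v x) ∧ 0 < fderiv ℝ g₁ y (v x) := by
    intro x hx
    have hOx := hO.mem_nhds (hNO hx)
    have : ∀ᶠ y in 𝓝 x, y ∈ O ∧ y ∈ W x ∧ 0 < fderiv ℝ g₀ y (v x) ∧ 0 < fderiv ℝ g₁ y (v x) := by
      filter_upwards [hOx, hW x hx,
        ((dcont h₀ (v x)).continuousAt hOx).eventually (lt_mem_nhds (hv₀ x hx)),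
        ((dcont h₁ (v x)).continuousAt hOx).eventually (lt_mem_nhds (hv₁ x hx))] with y a b c d
      exact ⟨a, b, c, d⟩
    obtain ⟨r, hr, h⟩ := Metric.nhds_basis_closedBall.eventually_iff.1 this
    exact ⟨r, hr, fun y hy => h hy⟩
  choose! r hr0 hrB using hr
  obtain ⟨t, htN, ht⟩ := hN.elim_nhds_subcover (fun x => Metric.ball x (r x / 3))
    fun x hx => Metric.ball_mem_nhds x (by linarith [hr0 x hx])
  have hχ : ∀ x, ∃ χ : E → ℝ, ContDiff ℝ ∞ χ ∧ (∀ y, 0 ≤ χ y) ∧ (∀ y, χ y ≤ 1) ∧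
      (x ∈ N → (∀ y ∈ Metric.ball x (r x / 3), χ y = 1) ∧
        ∀ y ∉ Metric.closedBall x (r x / 2), χ y = 0) := by
    intro x
    by_cases hx : x ∈ N
    · let b : ContDiffBump x := ⟨r x / 3, r x / 2, by linarith [hr0 x hx], by linarith [hr0 x hx]⟩
      refine ⟨b, b.contDiff, fun y => b.nonneg, fun y => b.le_one, fun _ => ⟨fun y hy =>
        b.one_of_mem_closedBall (Metric.ball_subset_closedBall hy), fun y hy =>
        b.zero_of_le_dist ?_⟩⟩
      exact (not_le.1 fun h => hy (Metric.mem_closedBall.2 h)).le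
    · exact ⟨fun _ => 0, contDiff_const, fun _ => le_rfl, fun _ => zero_le_one,
        fun h => absurd h hx⟩
  choose χ χs χ0 χ1 χN using hχ
  -- The cutoff `c s` is `0` for empty `s` and `1` on `N` for `s = t`. Adding a centre `a` to `s`
  -- changes it only inside the ball of radius `r a / 2`, where a single direction `v a` is
  -- available.
  let c : Finset E → E → ℝ := fun s y => 1 - ∏ x ∈ s, (1 - χ x y)
  have cs : ∀ s, ContDiff ℝ ∞ (c s) := fun s => contDiff_const.sub
    (contDiff_prod fun i _ => contDiff_const.sub (χs i))
  have p0 : ∀ (s : Finset E) y, 0 ≤ ∏ x ∈ s, (1 - χ x y) := fun s y =>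
    Finset.prod_nonneg fun i _ => sub_nonneg.2 (χ1 i y)
  have p1 : ∀ (s : Finset E) y, ∏ x ∈ s, (1 - χ x y) ≤ 1 := fun s y =>
    Finset.prod_le_one (fun i _ => sub_nonneg.2 (χ1 i y)) fun i _ => by linarith [χ0 i y]
  -- `M` is the number of rounds. Since there are finitely many centres and cutoffs, one `M` makes
  -- the error term of `fderiv_interpolation` smaller than both derivatives on all the closed balls.
  have bound : ∀ᶠ M : ℕ in Filter.atTop, ∀ a ∈ t, ∀ s ∈ t.powerset,
      ∀ y ∈ Metric.closedBall a (r a), |(g₁ y - g₀ y) * fderiv ℝ (c s) y (v a)| <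
        M * min (fderiv ℝ g₀ y (v a)) (fderiv ℝ g₁ y (v a)) := by
    rw [Filter.eventually_all_finset]
    intro a ha
    rw [Filter.eventually_all_finset]
    intro s _
    have haN := htN a ha
    have hB : IsCompact (Metric.closedBall a (r a)) := isCompact_closedBall a _
    have hBO : Metric.closedBall a (r a) ⊆ O := fun y hy => (hrB a haN y hy).1
    have cont1 : ContinuousOn (fun y => (g₁ y - g₀ y) * fderiv ℝ (c s) y (v a))
        (Metric.closedBall a (r a)) :=
      ((h₁.continuousOn.sub h₀.continuousOn).mono hBO).mul
        (((cs s).continuous_fderiv (by simp)).clm_apply continuous_const).continuousOn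
    have cont2 : ContinuousOn (fun y => min (fderiv ℝ g₀ y (v a)) (fderiv ℝ g₁ y (v a)))
        (Metric.closedBall a (r a)) := ((dcont h₀ _).mono hBO).inf ((dcont h₁ _).mono hBO)
    obtain ⟨C, hC⟩ := hB.exists_bound_of_continuousOn cont1
    obtain ⟨z, hz, hzm⟩ := hB.exists_isMinOn
      ⟨a, Metric.mem_closedBall_self (hr0 a haN).le⟩ cont2
    set η := min (fderiv ℝ g₀ z (v a)) (fderiv ℝ g₁ z (v a)) with hη
    have hη0 : 0 < η := lt_min (hrB a haN z hz).2.2.1 (hrB a haN z hz).2.2.2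
    filter_upwards [(tendsto_natCast_atTop_atTop (R := ℝ)).eventually
      (Filter.eventually_gt_atTop (C / η))] with M hM y hy
    have h1 : C < M * η := (div_lt_iff₀ hη0).1 hM
    have h2 : η ≤ min (fderiv ℝ g₀ y (v a)) (fderiv ℝ g₁ y (v a)) := hzm hy
    have h3 := hC y hy
    rw [Real.norm_eq_abs] at h3
    have h4 : (M : ℝ) * η ≤ M * min (fderiv ℝ g₀ y (v a)) (fderiv ℝ g₁ y (v a)) := by gcongr
    linarith
  obtain ⟨M, hM, hM0⟩ := (bound.and (Filter.eventually_gt_atTop 0)).exists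
  have hM0' : (0 : ℝ) < M := by exact_mod_cast hM0
  let G : ℝ → (E → ℝ) → E → ℝ := fun m c x => g₀ x + (m + c x) / M * (g₁ x - g₀ x)
  have Gs : ∀ m s, ContDiffOn ℝ ∞ (G m (c s)) O := fun m s =>
    h₀.add (((contDiff_const.add (cs s)).contDiffOn.div_const _).mul (h₁.sub h₀))
  have Gd : ∀ m < M, ∀ s ⊆ t, ∀ a ∈ t, ∀ y ∈ Metric.closedBall a (r a),
      0 < fderiv ℝ (G m (c s)) y (v a) := by
    intro m hm s hs a ha y hy
    have hb := hM a ha s (Finset.mem_powerset.2 hs) y hy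
    obtain ⟨hyO, -, d0, d1⟩ := hrB a (htN a ha) y hy
    have D : ∀ {g : E → ℝ}, ContDiffOn ℝ ∞ g O → DifferentiableAt ℝ g y := fun hg =>
      (hg.contDiffAt (hO.mem_nhds hyO)).differentiableAt (by simp)
    rw [fderiv_interpolation (D h₀) (D h₁) ((cs s).differentiable (by simp) y)]
    set d₀ := fderiv ℝ g₀ y (v a)
    set d₁ := fderiv ℝ g₁ y (v a)
    set e := (g₁ y - g₀ y) * fderiv ℝ (c s) y (v a)
    have hm' : (m : ℝ) + 1 ≤ M := by exact_mod_cast hm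
    have q0 : 0 ≤ ((m : ℝ) + c s y) / M :=
      div_nonneg (add_nonneg (Nat.cast_nonneg _) (sub_nonneg.2 (p1 s y))) hM0'.le
    have q1 : ((m : ℝ) + c s y) / M ≤ 1 := by
      rw [div_le_one hM0']
      have : c s y ≤ 1 := sub_le_self _ (p0 s y)
      linarith
    have hmin : min d₀ d₁ ≤ (1 - ((m : ℝ) + c s y) / M) * d₀ + ((m : ℝ) + c s y) / M * d₁ := by
      have a1 := min_le_left d₀ d₁
      have a2 := min_le_right d₀ d₁
      nlinarith
    have he : -(min d₀ d₁) < e / M := by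
      rw [lt_div_iff₀ hM0']
      have := (abs_lt.1 hb).1
      linarith
    linarith
  -- One round raises the coefficient of `g₁ - g₀` by `c t / M`. The centres are added one by one,
  -- so each move takes place in one ball along one direction.
  have stage : ∀ m < M, ∀ s ⊆ t, Movable inv O Q (G m (fun _ => 0)) (G m (c s)) := by
    intro m hm s
    induction s using Finset.induction_on with
    | empty => exact fun _ => Movable.refl fun x _ => by simp [G, c]
    | insert a s has ih =>
      intro hs
      have ha : a ∈ t := hs (Finset.mem_insert_self _ _)
      have hs' : s ⊆ t := (Finset.subset_insert _ _).trans hs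
      have haN := htN a ha
      have hra := hr0 a haN
      refine (ih hs').trans hQ ?_
      have hBO : Metric.ball a (r a) ⊆ O := fun y hy =>
        (hrB a haN y (Metric.ball_subset_closedBall hy)).1
      have hKW : Metric.closedBall a (r a / 2) ⊆ Metric.ball a (r a) :=
        Metric.closedBall_subset_ball (by linarith)
      obtain ⟨Φ, hΦ, hΦ', hK, hl⟩ := exists_diffeo_line_match (W := Metric.ball a (r a))
        (K := Metric.closedBall a (r a / 2)) Metric.isOpen_ball (convex_ball _ _)
        (isCompact_closedBall _ _) hKW
        ((Gs m s).mono hBO) ((Gs m (insert a s)).mono hBO)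
        (fun y hy => Gd m hm s hs' a ha y (Metric.ball_subset_closedBall hy))
        (fun y hy => Gd m hm _ hs a ha y (Metric.ball_subset_closedBall hy))
        (fun y hy => by
          simp only [G, c, Finset.prod_insert has, (χN a haN).2 y hy.2, sub_zero, one_mul])
      refine ⟨Φ, ⟨hΦ, hΦ', fun x => ?_, fun x hx => hK x fun h => hx (hBO (hKW h))⟩, fun x hx => ?_⟩
      · by_cases hx : x ∈ Metric.ball a (r a)
        · obtain ⟨u, hu, huW, -⟩ := hl x hx
          rw [hu] at huW ⊢
          exact hWinv a haN x (hrB a haN x (Metric.ball_subset_closedBall hx)).2.1 u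
            (hrB a haN _ (Metric.ball_subset_closedBall huW)).2.1
        · rw [hK x fun h => hx (hKW h)]
      · by_cases hxB : x ∈ Metric.ball a (r a)
        · obtain ⟨u, -, -, hu⟩ := hl x hxB
          exact hu
        · have hxK : x ∉ Metric.closedBall a (r a / 2) := fun h => hxB (hKW h)
          rw [hK x hxK]
          simp only [G, c, Finset.prod_insert has, (χN a haN).2 x hxK, sub_zero, one_mul]
  have main : ∀ m ≤ M, Movable inv O Q g₀ (G m (fun _ => 0)) := by
    intro m
    induction m with
    | zero => exact fun _ => Movable.refl fun x _ => by simp [G]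
    | succ m ih =>
      intro hm
      refine ((ih (by omega)).trans hQ (stage m (by omega) t subset_rfl)).trans hQ
        (Movable.refl fun x hx => ?_)
      -- At the end of the round the coefficient is `(m + 1) / M` on `N`, because `c t = 1` there.
      -- Off `N` its value is irrelevant, as `g₀ = g₁`.
      by_cases hxN : x ∈ N
      · have hx' := ht hxN
        simp only [mem_iUnion] at hx'
        obtain ⟨a, ha, hxa⟩ := hx'
        have : ∏ i ∈ t, (1 - χ i x) = 0 := Finset.prod_eq_zero ha (by
          rw [(χN a (htN a ha)).1 x hxa, sub_self])
        simp [G, c, this]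
      · simp [G, heq x hx hxN]
  refine (main M le_rfl).trans hQ (Movable.refl fun x _ => ?_)
  simp [G, hM0'.ne']

end Isotopy

/-! ### Faces of the standard simplex -/

section Simplex

variable {n : ℕ} {A B C : Finset (Fin (n + 1))} {x y : Fin (n + 1) → ℝ}

theorem mu_nonneg (hx : x ∈ stdSimplex ℝ (Fin (n + 1))) : 0 ≤ mu A x :=
  Finset.sum_nonneg fun i _ => hx.1 i

theorem continuous_mu : Continuous (mu A) := continuous_finsetSum _ fun i _ => continuous_apply i

theorem mu_eq_zero_iff (hx : x ∈ stdSimplex ℝ (Fin (n + 1))) : mu A x = 0 ↔ ∀ i ∉ A, x i = 0 := by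
  rw [mu, Finset.sum_eq_zero_iff_of_nonneg fun i _ => hx.1 i]
  simp

theorem openFace_subset : openFace A ⊆ stdSimplex ℝ (Fin (n + 1)) := fun _ hx => hx.1

theorem exists_mem_openFace (hx : x ∈ stdSimplex ℝ (Fin (n + 1))) :
    ∃ A : Finset (Fin (n + 1)), A.Nonempty ∧ x ∈ openFace A := by
  classical
  refine ⟨Finset.univ.filter fun i => 0 < x i, ?_, hx, fun i hi => (Finset.mem_filter.1 hi).2,
    fun i hi => ?_⟩
  · by_contra h
    rw [Finset.not_nonempty_iff_eq_empty, Finset.filter_eq_empty_iff] at h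
    have : ∑ i, x i ≤ 0 := Finset.sum_nonpos fun i hi => not_lt.1 (h hi)
    linarith [hx.2]
  · exact le_antisymm (not_lt.1 fun h => hi (Finset.mem_filter.2 ⟨Finset.mem_univ _, h⟩)) (hx.1 i)

theorem subset_of_mem_openFace (hx : x ∈ openFace B) (h : mu A x = 0) : B ⊆ A := by
  intro i hi
  by_contra hiA
  exact (hx.2.1 i hi).ne' ((mu_eq_zero_iff hx.1).1 h i hiA)

theorem mu_eq_zero_of_mem_openFace (hx : x ∈ openFace B) (h : B ⊆ A) : mu A x = 0 :=
  (mu_eq_zero_iff hx.1).2 fun i hi => hx.2.2 i fun hB => hi (h hB)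

/-- The closed face spanned by the vertices in `A`. -/
def closedFace (A : Finset (Fin (n + 1))) : Set (Fin (n + 1) → ℝ) :=
  {x | x ∈ stdSimplex ℝ (Fin (n + 1)) ∧ mu A x = 0}

theorem isCompact_closedFace : IsCompact (closedFace A) :=
  (isCompact_stdSimplex ℝ (Fin (n + 1))).inter_right
    (isClosed_singleton.preimage (continuous_mu (A := A)))

theorem openFace_subset_closedFace : openFace A ⊆ closedFace A := fun _ hx =>
  ⟨hx.1, mu_eq_zero_of_mem_openFace hx subset_rfl⟩

theorem nonempty_openFace (hA : A.Nonempty) : (openFace A).Nonempty := by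
  classical
  have hc : (0 : ℝ) < A.card := by exact_mod_cast hA.card_pos
  refine ⟨fun i => if i ∈ A then (A.card : ℝ)⁻¹ else 0, ⟨fun i => ?_, ?_⟩, fun i hi => ?_,
    fun i hi => ?_⟩
  · dsimp only; split_ifs <;> positivity
  · rw [Finset.sum_ite_mem, Finset.univ_inter, Finset.sum_const, nsmul_eq_mul,
      mul_inv_cancel₀ hc.ne']
  · simp only [hi, if_true]; positivity
  · simp [hi]

theorem closedFace_subset_closure (hA : A.Nonempty) : closedFace A ⊆ closure (openFace A) := by
  intro x hx
  obtain ⟨b, hb⟩ := nonempty_openFace hA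
  have hlim : Filter.Tendsto (fun t : ℝ => (1 - t) • x + t • b) (𝓝[>] 0) (𝓝 x) := by
    have : Continuous fun t : ℝ => (1 - t) • x + t • b := by fun_prop
    have h := this.tendsto 0
    simp only [sub_zero, one_smul, zero_smul, add_zero] at h
    exact h.mono_left nhdsWithin_le_nhds
  refine mem_closure_of_tendsto hlim ?_
  filter_upwards [Ioo_mem_nhdsGT (zero_lt_one (α := ℝ))] with t ht
  have h1 : 0 < 1 - t := by linarith [ht.2]
  refine ⟨convex_stdSimplex ℝ _ hx.1 hb.1 h1.le ht.1.le (by ring), fun i hi => ?_, fun i hi => ?_⟩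
  · have a1 := mul_nonneg h1.le (hx.1.1 i)
    have a2 := mul_pos ht.1 (hb.2.1 i hi)
    simp only [Pi.add_apply, Pi.smul_apply, smul_eq_mul]
    linarith
  · simp [(mu_eq_zero_iff hx.1).1 hx.2 i hi, hb.2.2 i hi]

theorem single_mem_closedFace (i : Fin (n + 1)) :
    (Pi.single i 1 : Fin (n + 1) → ℝ) ∈ closedFace A ↔ i ∈ A := by
  have hs : (Pi.single i 1 : Fin (n + 1) → ℝ) ∈ stdSimplex ℝ (Fin (n + 1)) :=
    single_mem_stdSimplex ℝ i
  constructor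
  · intro h
    by_contra hi
    have := (mu_eq_zero_iff hs).1 h.2 i hi
    simp at this
  · exact fun hi => ⟨hs, (mu_eq_zero_iff hs).2 fun j hj =>
      Pi.single_eq_of_ne (fun e : j = i => hj (e ▸ hi)) _⟩

end Simplex

/-! ### Strata and faces -/

section Strata

variable {E : Type*} [NormedAddCommGroup E] [NormedSpace ℝ E]
  {H : Type*} [TopologicalSpace H] {I : ModelWithCorners ℝ E H}
  {X : Type*} [TopologicalSpace X] [ChartedSpace H X]
  {E' : Type*} [NormedAddCommGroup E'] [NormedSpace ℝ E']
  {H' : Type*} [TopologicalSpace H'] {J : ModelWithCorners ℝ E' H'}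
  {N : Type*} [TopologicalSpace N] [ChartedSpace H' N]
  {ι : Type*} {Z : StratifiedSubset I X ι} {S : ι}

theorem SmoothOnSubset.continuousOn {f : X → N} {Q : Set X} (h : SmoothOnSubset I J f Q) :
    ContinuousOn f Q := by
  obtain ⟨W, -, hQ, F, hF, e⟩ := h
  exact (hF.continuousOn.mono hQ).congr e.symm

theorem StratifiedSubset.IsSimplicial.stratum_nonempty (hZ : Z.IsSimplicial) (S : ι) :
    (Z.stratum S).Nonempty := by
  obtain ⟨h, hh⟩ := hZ S
  exact closure_nonempty_iff.1
    ⟨_, hh.1.1.mapsTo (single_mem_stdSimplex ℝ (0 : Fin (Z.dim S + 1)))⟩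

theorem StratifiedSubset.eq_of_mem {T R : ι} {z : X} (hT : z ∈ Z.stratum T)
    (hR : z ∈ Z.stratum R) : T = R := by
  by_contra h
  exact (Z.disjoint T R h).le_bot ⟨hT, hR⟩

variable {n : ℕ}

/-- `h` is a diffeomorphism from the simplex onto the closure of the stratum `S`, taking the open
face `A` onto the stratum `T A`. -/
structure IsFaceParam (Z : StratifiedSubset I X ι) (S : ι) (h : (Fin (n + 1) → ℝ) → X)
    (T : Finset (Fin (n + 1)) → ι) : Prop where
  diffeo : IsDiffeoOn 𝓘(ℝ, Fin (n + 1) → ℝ) I h (stdSimplex ℝ (Fin (n + 1)))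
    (closure (Z.stratum S))
  image : ∀ A : Finset (Fin (n + 1)), A.Nonempty → h '' openFace A = Z.stratum (T A)

theorem StratifiedSubset.IsParameterization.exists_isFaceParam
    {h : (Fin (Z.dim S + 1) → ℝ) → X} (hh : Z.IsParameterization S h) :
    ∃ T, IsFaceParam Z S h T := by
  have : Nonempty ι := ⟨S⟩
  choose! T hT using hh.2
  exact ⟨T, hh.1, hT⟩

namespace IsFaceParam

variable {h : (Fin (n + 1) → ℝ) → X} {T : Finset (Fin (n + 1)) → ι} (hp : IsFaceParam Z S h T)
  {A B C : Finset (Fin (n + 1))} {x y : Fin (n + 1) → ℝ}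

include hp

theorem injOn : InjOn h (stdSimplex ℝ (Fin (n + 1))) := hp.diffeo.1.injOn

theorem continuousOn : ContinuousOn h (stdSimplex ℝ (Fin (n + 1))) := hp.diffeo.2.1.continuousOn

theorem mem_iff (hA : A.Nonempty) (hx : x ∈ stdSimplex ℝ (Fin (n + 1))) :
    h x ∈ Z.stratum (T A) ↔ x ∈ openFace A := by
  rw [← hp.image A hA]
  exact hp.injOn.mem_image_iff openFace_subset hx

theorem exists_eq_of_mem {z : X} (hA : A.Nonempty) (hz : z ∈ Z.stratum (T A)) :
    ∃ x ∈ openFace A, h x = z := by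
  rwa [← hp.image A hA] at hz

variable [T2Space X]

theorem closure_eq (hA : A.Nonempty) : closure (Z.stratum (T A)) = h '' closedFace A := by
  have hsub : closedFace A ⊆ stdSimplex ℝ (Fin (n + 1)) := fun _ hx => hx.1
  refine subset_antisymm ?_ ?_
  · rw [← hp.image A hA]
    exact closure_minimal (image_mono openFace_subset_closedFace)
      (isCompact_closedFace.image_of_continuousOn (hp.continuousOn.mono hsub)).isClosed
  · rintro _ ⟨x, hx, rfl⟩
    rw [← hp.image A hA]
    have h1 := closedFace_subset_closure hA hx
    have h2 : ContinuousWithinAt h (openFace A) x :=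
      (hp.continuousOn x hx.1).mono openFace_subset
    exact h2.mem_closure_image h1

theorem subset_closure_iff (hC : C.Nonempty) (hA : A.Nonempty) :
    Z.stratum (T C) ⊆ closure (Z.stratum (T A)) ↔ C ⊆ A := by
  rw [hp.closure_eq hA, ← hp.image C hC]
  constructor
  · intro hs
    obtain ⟨x, hx⟩ := nonempty_openFace hC
    obtain ⟨y, hy, e⟩ := hs ⟨x, hx, rfl⟩
    have := hp.injOn hy.1 hx.1 e
    exact subset_of_mem_openFace hx (this ▸ hy.2)
  · exact fun hs => image_mono fun x hx => ⟨hx.1, mu_eq_zero_of_mem_openFace hx hs⟩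

theorem T_inj (hC : C.Nonempty) (hA : A.Nonempty) : T C = T A ↔ C = A := by
  refine ⟨fun e => ?_, fun e => e ▸ rfl⟩
  exact ((hp.subset_closure_iff hC hA).1 (e ▸ subset_closure)).antisymm
    ((hp.subset_closure_iff hA hC).1 (e ▸ subset_closure))

theorem prec_iff (hC : C.Nonempty) (hA : A.Nonempty) : Z.Prec (T C) (T A) ↔ C ⊂ A := by
  rw [StratifiedSubset.Prec, Ne, hp.T_inj hC hA, hp.subset_closure_iff hC hA,
    Finset.ssubset_iff_subset_ne, and_comm]

omit [T2Space X] in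
theorem exists_eq_T {R : ι} (hne : (Z.stratum R).Nonempty)
    (hR : Z.stratum R ⊆ closure (Z.stratum S)) :
    ∃ A, A.Nonempty ∧ R = T A := by
  obtain ⟨z, hz⟩ := hne
  have := hR hz
  rw [← hp.diffeo.1.image_eq] at this
  obtain ⟨x, hx, rfl⟩ := this
  obtain ⟨A, hA, hxA⟩ := exists_mem_openFace hx
  exact ⟨A, hA, Z.eq_of_mem hz ((hp.mem_iff hA hx).2 hxA)⟩

/-- `S` meets the image of some open face `A`, hence is `T A`. The full open face is mapped into the
closure of `T A`, which forces `A` to be everything. -/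
theorem T_univ (hne : (Z.stratum S).Nonempty) : T Finset.univ = S := by
  obtain ⟨A, hA, e⟩ := hp.exists_eq_T hne subset_closure
  have h1 : Finset.univ ⊆ A := by
    rw [← hp.subset_closure_iff Finset.univ_nonempty hA, ← e, ← hp.diffeo.1.image_eq,
      ← hp.image _ Finset.univ_nonempty]
    exact image_mono openFace_subset
  rw [e, Finset.univ_subset_iff.1 h1]

theorem prec_S_iff (hne : ∀ R, (Z.stratum R).Nonempty) {R : ι} :
    Z.Prec R S ↔ ∃ A, A.Nonempty ∧ A ≠ Finset.univ ∧ R = T A := by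
  have hS := hp.T_univ (hne S)
  constructor
  · intro hR
    obtain ⟨A, hA, rfl⟩ := hp.exists_eq_T (hne R) hR.2
    exact ⟨A, hA, fun e => hR.1 (by rw [e, hS]), rfl⟩
  · rintro ⟨A, hA, hA', rfl⟩
    rw [← hS, hp.prec_iff hA Finset.univ_nonempty]
    exact Finset.ssubset_univ_iff.2 hA'

theorem faceVertices_eq (hA : A.Nonempty) : Z.faceVertices (T A) h = A := by
  classical
  ext i
  rw [StratifiedSubset.faceVertices, Finset.mem_filter, hp.closure_eq hA,
    hp.injOn.mem_image_iff (fun _ hx => hx.1) (single_mem_stdSimplex ℝ i), single_mem_closedFace]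
  simp

omit [T2Space X] in
/-- Composing with a diffeomorphism of the ambient space preserving the faces. -/
theorem comp {Φ : (Fin (n + 1) → ℝ) ≃ (Fin (n + 1) → ℝ)} (h₁ : ContDiff ℝ ∞ Φ)
    (h₂ : ContDiff ℝ ∞ Φ.symm)
    (hΦ : ∀ x, Φ x ∈ stdSimplex ℝ (Fin (n + 1)) ↔ x ∈ stdSimplex ℝ (Fin (n + 1)))
    (hface : ∀ A x, Φ x ∈ openFace A ↔ x ∈ openFace A) : IsFaceParam Z S (h ∘ Φ) T := by
  have himg : ∀ {Q : Set (Fin (n + 1) → ℝ)}, (∀ x, Φ x ∈ Q ↔ x ∈ Q) → Φ '' Q = Q := by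
    intro Q hQ
    ext x
    rw [Equiv.image_eq_preimage_symm, mem_preimage, ← hQ, Equiv.apply_symm_apply]
  refine ⟨⟨hp.diffeo.1.comp ⟨fun x hx => (hΦ x).2 hx, Φ.injective.injOn, (himg hΦ).ge⟩, ?_, ?_⟩,
    fun A hA => ?_⟩
  · obtain ⟨W, hW, hQ, F, hF, e⟩ := hp.diffeo.2.1
    refine ⟨Φ ⁻¹' W, hW.preimage h₁.continuous, fun x hx => hQ ((hΦ x).2 hx), F ∘ Φ, ?_,
      fun x hx => e ((hΦ x).2 hx)⟩
    exact hF.comp h₁.contMDiff.contMDiffOn fun _ h => h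
  · obtain ⟨g, ⟨W, hW, hQ, F, hF, e⟩, hg⟩ := hp.diffeo.2.2
    refine ⟨Φ.symm ∘ g, ⟨W, hW, hQ, Φ.symm ∘ F, ?_, fun x hx => ?_⟩, fun x hx => ?_⟩
    · exact h₂.contMDiff.comp_contMDiffOn hF
    · simp [e hx]
    · simp [hg (Φ x) ((hΦ x).2 hx)]
  · rw [image_comp, himg (hface A), hp.image A hA]

end IsFaceParam

/-! ### Tubular neighbourhoods -/

namespace TubularData

variable (D : TubularData Z)

theorem subset_U (T : ι) : Z.stratum T ⊆ D.U T := (D.distancelike T).subset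

theorem isOpen_U (T : ι) : IsOpen (D.U T) := (D.distancelike T).isOpen

theorem ρ_nonneg {T : ι} {z : X} (hz : z ∈ D.U T) : 0 ≤ D.ρ T z :=
  (D.distancelike T).nonneg z hz

/-- If the normal coordinate vanishes, `ν_T` takes the same value at `z` and at a point of the
stratum; `ν_T` is injective. -/
theorem ρ_eq_zero_iff {T : ι} {z : X} (hz : z ∈ D.U T) : D.ρ T z = 0 ↔ z ∈ Z.stratum T := by
  refine ⟨fun h => ?_, (D.distancelike T).zero z⟩
  have hm := (D.ν_diffeo T).1.mapsTo hz
  have h2 : (D.ν T z).2 = 0 := by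
    rw [D.ρ_ν T z hz] at h
    simpa using h
  have h1 : D.ν T z = D.ν T (D.ν T z).1 := by
    rw [D.ν_stratum T _ hm.1, ← h2]
  have := (D.ν_diffeo T).1.injOn hz (D.subset_U T hm.1) h1
  rw [this]; exact hm.1

/-- By the compatibility conditions between tubes, proximity to a smaller stratum `T` depends only
on the projection to `R`. This lets truncation conditions be checked on the base of a tube. -/
theorem ρ_lt_π_iff {T R : ι} (hTR : Z.Prec T R) {z : X} (hz : z ∈ D.U R) (s : ℝ) :
    (D.π R z ∈ D.U T ∧ D.ρ T (D.π R z) < s) ↔ (z ∈ D.U T ∧ D.ρ T z < s) := by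
  have h1 : z ∈ D.U T ↔ D.π R z ∈ D.U T := by
    have := Set.ext_iff.1 (D.inter_eq T R hTR) z
    constructor
    · exact fun h => (this.1 ⟨hz, h⟩).2.2
    · exact fun h => (this.2 ⟨hz, D.π_mapsTo R hz, h⟩).2
  constructor
  · rintro ⟨a, b⟩
    have := h1.2 a
    exact ⟨this, by rwa [D.ρ_π T R hTR z ⟨hz, this⟩] at b⟩
  · rintro ⟨a, b⟩
    exact ⟨h1.1 a, by rwa [D.ρ_π T R hTR z ⟨hz, a⟩]⟩

/-- If instead `R ≺ T`, then `ρ_R` would take the same value at `π_T z` as at `z`, namely zero, and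
`π_T z` would lie in both strata. -/
theorem prec_of_mem_U {T R : ι} {z : X} (hR : z ∈ Z.stratum R) (hz : z ∈ D.U T) (hne : T ≠ R) :
    Z.Prec T R := by
  rcases D.comparable T R ⟨z, hz, D.subset_U R hR⟩ with h | h | h
  · exact h
  · exfalso
    have h1 : z ∈ D.U T ∩ D.U R := ⟨hz, D.subset_U R hR⟩
    have h2 : D.π T z ∈ Z.stratum T ∩ D.U R := by
      have := h1
      rw [D.inter_eq R T h] at this
      exact this.2
    have h3 := D.ρ_π R T h z h1
    rw [(D.ρ_eq_zero_iff (D.subset_U R hR)).2 hR] at h3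
    exact hne (Z.eq_of_mem h2.1 ((D.ρ_eq_zero_iff h2.2).1 h3))
  · exact absurd h hne

/-- A stratum in the closure of another one has positive codimension, in the sense that its
trivialization has a nontrivial fibre. -/
theorem nontrivial_fibre (D : TubularData Z) {T R : ι} (hTR : Z.Prec T R)
    (hne : (Z.stratum T).Nonempty) :
    Nontrivial (EuclideanSpace ℝ (Fin (Module.finrank ℝ E - Z.dim T))) := by
  by_contra hn
  rw [not_nontrivial_iff_subsingleton] at hn
  obtain ⟨z, hz⟩ := hne
  obtain ⟨w, hwU, hwR⟩ := mem_closure_iff.1 (hTR.2 hz) _ (D.isOpen_U T) (D.subset_U T hz)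
  have h0 : D.ρ T w = 0 := by
    rw [D.ρ_ν T w hwU, Subsingleton.elim (D.ν T w).2 0]; simp
  exact hTR.1 (Z.eq_of_mem ((D.ρ_eq_zero_iff hwU).1 h0) hwR)

/-- The part of a tube over a compact piece of a stratum is compact. -/
theorem isCompact_tube {T : ι} {K : Set X} (hK : IsCompact K) (hKT : K ⊆ Z.stratum T) {c : ℝ}
    (hc : 0 ≤ c) (hγ : ∀ z ∈ K, c < D.γ T z) :
    IsCompact {z | z ∈ D.U T ∧ D.π T z ∈ K ∧ D.ρ T z ≤ c} := by
  obtain ⟨hbij, -, g, hg, hgν⟩ := D.ν_diffeo T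
  let V : Set (X × EuclideanSpace ℝ (Fin (Module.finrank ℝ E - Z.dim T))) :=
    K ×ˢ Metric.closedBall 0 (Real.sqrt c)
  have hV : IsCompact V := hK.prod (isCompact_closedBall _ _)
  have hVsub : V ⊆ {p | p.1 ∈ Z.stratum T ∧ ‖p.2‖ ^ 2 < D.γ T p.1} := by
    rintro ⟨p, y⟩ ⟨hp, hy⟩
    refine ⟨hKT hp, lt_of_le_of_lt ?_ (hγ p hp)⟩
    have hy : ‖y‖ ≤ Real.sqrt c := by simpa using hy
    calc ‖y‖ ^ 2 ≤ Real.sqrt c ^ 2 := by gcongr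
      _ = c := Real.sq_sqrt hc
  have hπ : ∀ z ∈ D.U T, D.π T z = (D.ν T z).1 := by
    intro z hz
    have := D.ν_π T z hz
    rw [D.ν_stratum T _ (D.π_mapsTo T hz)] at this
    exact congrArg Prod.fst this
  -- The tube is the image of `K` times the closed ball of radius `√c` under the inverse of `ν_T`.
  convert hV.image_of_continuousOn (hg.continuousOn.mono hVsub) using 1
  ext z
  constructor
  · rintro ⟨hz, hzK, hzc⟩
    refine ⟨D.ν T z, ⟨?_, ?_⟩, hgν z hz⟩
    · rwa [← hπ z hz]
    · rw [D.ρ_ν T z hz] at hzc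
      simpa using Real.le_sqrt_of_sq_le hzc
  · rintro ⟨p, hp, rfl⟩
    obtain ⟨w, hw, rfl⟩ := hbij.surjOn (hVsub hp)
    rw [hgν w hw]
    refine ⟨hw, ?_, ?_⟩
    · rw [hπ w hw]; exact hp.1
    · rw [D.ρ_ν T w hw]
      have : ‖(D.ν T w).2‖ ≤ Real.sqrt c := by simpa using hp.2
      calc ‖(D.ν T w).2‖ ^ 2 ≤ Real.sqrt c ^ 2 := by gcongr
        _ = c := Real.sq_sqrt hc

end TubularData

end Strata

/-! ### Tangent directions from the submersion condition, and radial directions -/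

section Directions

variable {E : Type*} [NormedAddCommGroup E] [NormedSpace ℝ E]
  {H : Type*} [TopologicalSpace H] {I : ModelWithCorners ℝ E H}
  {X : Type*} [TopologicalSpace X] [ChartedSpace H X]
  {ι : Type*} {Z : StratifiedSubset I X ι} {S : ι} {n : ℕ}

/-- `F`, smooth on the open set `W`, extends the map `h` from the simplex. -/
structure IsSmoothExtension (I : ModelWithCorners ℝ E H) (h F : (Fin (n + 1) → ℝ) → X)
    (W : Set (Fin (n + 1) → ℝ)) : Prop where
  isOpen : IsOpen W
  subset : stdSimplex ℝ (Fin (n + 1)) ⊆ W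
  smooth : ContMDiffOn 𝓘(ℝ, Fin (n + 1) → ℝ) I ∞ F W
  eqOn : EqOn F h (stdSimplex ℝ (Fin (n + 1)))

theorem IsFaceParam.exists_extension {h : (Fin (n + 1) → ℝ) → X}
    {T : Finset (Fin (n + 1)) → ι} (hp : IsFaceParam Z S h T) :
    ∃ F W, IsSmoothExtension I h F W := by
  obtain ⟨W, hW, hQ, F, hF, e⟩ := hp.diffeo.2.1
  exact ⟨F, W, hW, hQ, hF, e⟩

/-- The open set on which the pulled back distance function is defined. -/
def pullbackDomain (F : (Fin (n + 1) → ℝ) → X) (W : Set (Fin (n + 1) → ℝ)) (U : Set X) :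
    Set (Fin (n + 1) → ℝ) := W ∩ F ⁻¹' U

namespace IsSmoothExtension

variable {h F : (Fin (n + 1) → ℝ) → X} {W : Set (Fin (n + 1) → ℝ)}
  (hF : IsSmoothExtension I h F W) {U : Set X} {x : Fin (n + 1) → ℝ}

include hF

theorem isOpen_pullbackDomain (hU : IsOpen U) : IsOpen (pullbackDomain F W U) :=
  hF.smooth.continuousOn.isOpen_inter_preimage hF.isOpen hU

theorem mem_pullbackDomain (hx : x ∈ stdSimplex ℝ (Fin (n + 1))) :
    x ∈ pullbackDomain F W U ↔ h x ∈ U := by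
  rw [pullbackDomain, mem_inter_iff, mem_preimage, hF.eqOn hx, and_iff_right (hF.subset hx)]

theorem contDiffOn_ρ (D : TubularData Z) (T : ι) :
    ContDiffOn ℝ ∞ (fun x => D.ρ T (F x)) (pullbackDomain F W (D.U T)) := by
  rw [← contMDiffOn_iff_contDiffOn]
  exact (D.distancelike T).smooth.comp (hF.smooth.mono inter_subset_left) fun _ hx => hx.2

theorem contMDiffAt (hx : x ∈ stdSimplex ℝ (Fin (n + 1))) :
    ContMDiffAt 𝓘(ℝ, Fin (n + 1) → ℝ) I ∞ F x :=
  hF.smooth.contMDiffAt (hF.isOpen.mem_nhds (hF.subset hx))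

end IsSmoothExtension

theorem hasDerivAt_comp_curve {f : X → ℝ} {c : ℝ → X} {z : X} (hz : c 0 = z)
    (hf : MDifferentiableAt I 𝓘(ℝ, ℝ) f z) (hc : MDifferentiableAt 𝓘(ℝ, ℝ) I c 0)
    {v : TangentSpace I z} (hv : mfderiv 𝓘(ℝ, ℝ) I c 0 (1 : ℝ) = v) :
    HasDerivAt (fun t => f (c t)) (mfderiv I 𝓘(ℝ, ℝ) f z v) 0 := by
  subst hz
  subst hv
  let L : ℝ →L[ℝ] ℝ := (mfderiv I 𝓘(ℝ, ℝ) f (c 0)).comp (mfderiv 𝓘(ℝ, ℝ) I c 0)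
  have h : HasFDerivAt (f ∘ c) L 0 :=
    (HasMFDerivAt.comp (0 : ℝ) hf.hasMFDerivAt hc.hasMFDerivAt).hasFDerivAt
  exact h.hasDerivAt

theorem zero_mem_tangentSet {Q : Set X} {z : X} (hz : z ∈ Q) :
    (0 : TangentSpace I z) ∈ tangentSet I Q z :=
  ⟨fun _ => z, rfl, Filter.Eventually.of_forall fun _ => hz, contMDiffAt_const, by
    rw [mfderiv_const]; rfl⟩

/-- Members of a finite chain of sets, listed in increasing order. -/
theorem exists_fin_enumeration {α : Type*} (𝒞 : Finset (Finset α)) (hne : 𝒞.Nonempty)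
    (hc : ∀ A ∈ 𝒞, ∀ B ∈ 𝒞, A ⊂ B ∨ B ⊂ A ∨ A = B) :
    ∃ (ℓ : ℕ) (c : Fin (ℓ + 1) → Finset α), (∀ i j, i < j → c i ⊂ c j) ∧ (∀ i, c i ∈ 𝒞) ∧
      ∀ A ∈ 𝒞, ∃ i, c i = A := by
  classical
  -- Members of a chain are distinguished by their cardinalities, so sorting the cardinalities sorts
  -- the chain.
  have hne' : (𝒞.image Finset.card).Nonempty := hne.image _
  obtain ⟨ℓ, hℓ⟩ : ∃ ℓ, (𝒞.image Finset.card).card = ℓ + 1 :=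
    Nat.exists_eq_succ_of_ne_zero hne'.card_pos.ne'
  let e := (𝒞.image Finset.card).orderEmbOfFin hℓ
  have hmem : ∀ i, ∃ A ∈ 𝒞, A.card = e i := fun i =>
    Finset.mem_image.1 ((𝒞.image Finset.card).orderEmbOfFin_mem hℓ i)
  choose c hc𝒞 hcard using hmem
  refine ⟨ℓ, c, fun i j hij => ?_, hc𝒞, fun A hA => ?_⟩
  · have hlt : (c i).card < (c j).card := by rw [hcard, hcard]; exact e.strictMono hij
    rcases hc _ (hc𝒞 i) _ (hc𝒞 j) with h | h | h
    · exact h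
    · exact absurd (Finset.card_lt_card h) (by omega)
    · rw [h] at hlt; exact absurd hlt (lt_irrefl _)
  · have : A.card ∈ Set.range e := by
      rw [Finset.range_orderEmbOfFin]
      exact Finset.mem_coe.2 (Finset.mem_image_of_mem _ hA)
    obtain ⟨i, hi⟩ := this
    refine ⟨i, ?_⟩
    rw [← hcard] at hi
    rcases hc _ (hc𝒞 i) _ hA with h | h | h
    · exact absurd (Finset.card_lt_card h) (by omega)
    · exact absurd (Finset.card_lt_card h) (by omega)
    · exact h

variable [T2Space X] {h F : (Fin (n + 1) → ℝ) → X} {T : Finset (Fin (n + 1)) → ι}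
  {W : Set (Fin (n + 1) → ℝ)} {A B : Finset (Fin (n + 1))} {x : Fin (n + 1) → ℝ}

theorem IsFaceParam.comparable (hp : IsFaceParam Z S h T) (D : TubularData Z) {C : Finset _}
    (hA : A.Nonempty) (hC : C.Nonempty) {z : X} (hzA : z ∈ D.U (T A)) (hzC : z ∈ D.U (T C)) :
    A ⊂ C ∨ C ⊂ A ∨ A = C := by
  rw [← hp.prec_iff hA hC, ← hp.prec_iff hC hA, ← hp.T_inj hA hC]
  exact D.comparable _ _ ⟨z, hzA, hzC⟩

/-- Away from the face `A` there is a direction tangent to the faces of the simplex in which the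
distance from the face increases and the distances from smaller faces are constant. -/
theorem exists_tangent_direction (hp : IsFaceParam Z S h T) (D : TubularData Z)
    (hF : IsSmoothExtension I h F W) (hA : A.Nonempty) (hB : B.Nonempty) (hx : x ∈ openFace B)
    (hAU : h x ∈ D.U (T A)) (hAB : A ≠ B) (𝒞 : Finset (Finset (Fin (n + 1))))
    (h𝒞 : ∀ C ∈ 𝒞, C.Nonempty ∧ C ⊂ A ∧ h x ∈ D.U (T C)) :
    ∃ v : Fin (n + 1) → ℝ, (∀ i, x i = 0 → v i = 0) ∧ ∑ i, v i = 0 ∧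
      0 < fderiv ℝ (fun y => D.ρ (T A) (F y)) x v ∧
      ∀ C ∈ 𝒞, fderiv ℝ (fun y => D.ρ (T C) (F y)) x v = 0 := by
  classical
  have hxΔ := hx.1
  have hxB : h x ∈ Z.stratum (T B) := (hp.mem_iff hB hxΔ).2 hx
  have hprec : A ⊂ B := (hp.prec_iff hA hB).1
    (D.prec_of_mem_U hxB hAU fun e => hAB ((hp.T_inj hA hB).1 e))
  have hins : ∀ C ∈ insert A 𝒞, C.Nonempty ∧ C ⊂ B ∧ h x ∈ D.U (T C) := by
    intro C hC
    rcases Finset.mem_insert.1 hC with rfl | hC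
    · exact ⟨hA, hprec, hAU⟩
    · exact ⟨(h𝒞 C hC).1, (h𝒞 C hC).2.1.trans hprec, (h𝒞 C hC).2.2⟩
  obtain ⟨ℓ, c, hlt, hmem, hsurj⟩ := exists_fin_enumeration (insert A 𝒞)
    (Finset.insert_nonempty _ _) fun C hC C' hC' =>
      hp.comparable D (hins C hC).1 (hins C' hC').1 (hins C hC).2.2 (hins C' hC').2.2
  obtain ⟨-, hsub⟩ := D.submersion ℓ (fun i => T (c i)) (T B)
    (fun i j hij => (hp.prec_iff (hins _ (hmem i)).1 (hins _ (hmem j)).1).2 (hlt i j hij))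
    (fun i => (hp.prec_iff (hins _ (hmem i)).1 hB).2 (hins _ (hmem i)).2.1) (h x) hxB
    (fun i => (hins _ (hmem i)).2.2)
  -- Prescribed are the derivative `1` for `ρ_A` and `0` for the other members of the chain. The
  -- component in the base is not needed and is set to zero.
  obtain ⟨v, ⟨γ, hγ0, hγS, hγs, hγv⟩, hv, -⟩ := hsub (fun i => if c i = A then 1 else 0) 0
    (zero_mem_tangentSet (D.π_mapsTo _ (hins _ (hmem 0)).2.2))
  obtain ⟨g, ⟨W', hW', hQ, G, hG, e⟩, hg⟩ := hp.diffeo.2.2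
  have hxcl : h x ∈ closure (Z.stratum S) := hp.diffeo.1.mapsTo hxΔ
  have hGh : ∀ y ∈ stdSimplex ℝ (Fin (n + 1)), G (h y) = y := fun y hy => by
    rw [e (hp.diffeo.1.mapsTo hy), hg y hy]
  have hGγ : ContDiffAt ℝ ∞ (fun t => G (γ t)) 0 := by
    rw [← contMDiffAt_iff_contDiffAt]
    refine ContMDiffAt.comp (0 : ℝ) ?_ hγs
    rw [hγ0]
    exact hG.contMDiffAt (hW'.mem_nhds (hQ hxcl))
  -- `G` extends `h⁻¹` smoothly, so `w` is the velocity of the curve pulled back to the simplex.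
  -- That curve stays in the open face `B`, hence `w` is supported on `B` and has coordinate sum
  -- zero.
  let w := deriv (fun t => G (γ t)) 0
  have hw : HasDerivAt (fun t => G (γ t)) w 0 :=
    (hGγ.differentiableAt (by simp)).hasDerivAt
  have hG0 : G (γ 0) = x := by rw [hγ0, hGh x hxΔ]
  have hev : ∀ᶠ t in 𝓝 (0 : ℝ), G (γ t) ∈ openFace B ∧ F (G (γ t)) = γ t := by
    filter_upwards [hγS] with t ht
    obtain ⟨y, hy, e'⟩ := hp.exists_eq_of_mem hB ht
    rw [← e', hGh y hy.1]
    exact ⟨hy, hF.eqOn hy.1⟩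
  have hwi : ∀ i, HasDerivAt (fun t => G (γ t) i) (w i) 0 := fun i => (hasDerivAt_pi.1 hw) i
  have hder : ∀ C, h x ∈ D.U (T C) → fderiv ℝ (fun y => D.ρ (T C) (F y)) x w =
      mfderiv I 𝓘(ℝ, ℝ) (D.ρ (T C)) (h x) v := by
    intro C hC
    have h1 := hasDerivAt_comp_curve (f := D.ρ (T C)) hγ0
      (((D.distancelike (T C)).smooth.contMDiffAt ((D.isOpen_U _).mem_nhds hC)).mdifferentiableAt
        (by simp)) (hγs.mdifferentiableAt (by simp)) hγv
    have h2 : HasFDerivAt (fun y => D.ρ (T C) (F y)) (fderiv ℝ (fun y => D.ρ (T C) (F y)) x)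
        (G (γ 0)) := by
      rw [hG0]
      exact (((hF.contDiffOn_ρ D (T C)).contDiffAt ((hF.isOpen_pullbackDomain
        (D.isOpen_U _)).mem_nhds ((hF.mem_pullbackDomain hxΔ).2 hC))).differentiableAt
        (by simp)).hasFDerivAt
    have h3 := h2.comp_hasDerivAt (0 : ℝ) hw
    refine (h3.congr_of_eventuallyEq ?_).unique h1
    filter_upwards [hev] with t ht
    simp [ht.2]
  refine ⟨w, fun i hi => ?_, ?_, ?_, fun C hC => ?_⟩
  · have hiB : i ∉ B := fun hiB => (hx.2.1 i hiB).ne' hi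
    refine (hwi i).unique ((hasDerivAt_const (0 : ℝ) (0 : ℝ)).congr_of_eventuallyEq ?_)
    filter_upwards [hev] with t ht
    exact ht.1.2.2 i hiB
  · refine (HasDerivAt.fun_sum fun i (_ : i ∈ Finset.univ) => hwi i).unique
      ((hasDerivAt_const (0 : ℝ) (1 : ℝ)).congr_of_eventuallyEq ?_)
    filter_upwards [hev] with t ht
    exact ht.1.1.2
  · obtain ⟨i, hi⟩ := hsurj A (Finset.mem_insert_self _ _)
    have := hv i
    rw [hi] at this
    rw [hder A hAU, this]
    simp
  · obtain ⟨i, hi⟩ := hsurj C (Finset.mem_insert_of_mem hC)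
    have := hv i
    rw [hi] at this
    rw [hder C (h𝒞 C hC).2.2, this]
    simp [(h𝒞 C hC).2.1.ne]

/-- The direction moving away from the face `A` at the expense of the coordinate `i₀ ∈ A`. -/
def radial (A : Finset (Fin (n + 1))) (i₀ : Fin (n + 1)) (x : Fin (n + 1) → ℝ) :
    Fin (n + 1) → ℝ := fun j => if j ∈ A then (if j = i₀ then -mu A x else 0) else x j

/-- The growth of the coordinates outside `A` is paid for by the coordinate `i₀`, and all of these
lie outside `C`. -/
theorem sum_radial_compl {C : Finset (Fin (n + 1))} {i₀ : Fin (n + 1)} (hi₀ : i₀ ∈ A)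
    (hCA : C ⊆ A) (hi₀C : i₀ ∉ C) : mu C (radial A i₀ x) = 0 := by
  classical
  have hsplit : Cᶜ = (A \ C) ∪ Aᶜ := by
    ext j
    simp only [Finset.mem_compl, Finset.mem_union, Finset.mem_sdiff]
    have := @hCA j
    tauto
  have hdisj : Disjoint (A \ C) Aᶜ :=
    Finset.disjoint_left.2 fun j hj hj' => (Finset.mem_compl.1 hj') (Finset.mem_sdiff.1 hj).1
  rw [mu, hsplit, Finset.sum_union hdisj]
  have h1 : ∑ j ∈ A \ C, radial A i₀ x j = -mu A x := by
    rw [Finset.sum_eq_single_of_mem i₀ (Finset.mem_sdiff.2 ⟨hi₀, hi₀C⟩)]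
    · simp [radial, hi₀]
    · intro j hj hne
      simp [radial, (Finset.mem_sdiff.1 hj).1, hne]
  have h2 : ∑ j ∈ Aᶜ, radial A i₀ x j = mu A x :=
    Finset.sum_congr rfl fun j hj => by simp [radial, Finset.mem_compl.1 hj]
  rw [h1, h2]; ring

theorem sum_radial {i₀ : Fin (n + 1)} (hi₀ : i₀ ∈ A) : ∑ j, radial A i₀ x j = 0 := by
  classical
  have := sum_radial_compl (x := x) hi₀ (Finset.empty_subset A) (Finset.notMem_empty i₀)
  rwa [mu, Finset.compl_empty] at this

theorem mu_radial {i₀ : Fin (n + 1)} : mu A (radial A i₀ x) = mu A x :=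
  Finset.sum_congr rfl fun j hj => by simp [radial, Finset.mem_compl.1 hj]

theorem norm_radial_le {i₀ : Fin (n + 1)} (hx : x ∈ stdSimplex ℝ (Fin (n + 1))) :
    ‖radial A i₀ x‖ ≤ mu A x := by
  have h0 := mu_nonneg (A := A) hx
  rw [pi_norm_le_iff_of_nonneg h0]
  intro j
  rw [radial]
  split_ifs with h1 h2
  · rw [norm_neg, Real.norm_of_nonneg h0]
  · simpa using h0
  · rw [Real.norm_of_nonneg (hx.1 j)]
    exact Finset.single_le_sum (f := x) (fun i _ => hx.1 i) (Finset.mem_compl.2 h1)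

/-- Subtracting the radial vector gives the mass outside `A` back to `i₀`. This supplies a nearby
point of the face with which `x` is compared. -/
theorem sub_radial_mem {i₀ : Fin (n + 1)} (hi₀ : i₀ ∈ A)
    (hx : x ∈ stdSimplex ℝ (Fin (n + 1))) (hpos : ∀ i ∈ A, 0 < x i) :
    x - radial A i₀ x ∈ openFace A := by
  have h0 := mu_nonneg (A := A) hx
  have h1 : ∀ i ∈ A, 0 < (x - radial A i₀ x) i := by
    intro i hi
    simp only [Pi.sub_apply, radial, hi, if_true]
    have := hpos i hi
    split_ifs <;> linarith
  have h2 : ∀ i ∉ A, (x - radial A i₀ x) i = 0 := fun i hi => by simp [radial, hi]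
  refine ⟨⟨fun i => ?_, ?_⟩, h1, h2⟩
  · by_cases hi : i ∈ A
    · exact (h1 i hi).le
    · exact (h2 i hi).ge
  · simp only [Pi.sub_apply, Finset.sum_sub_distrib, sum_radial hi₀, hx.2, sub_zero]

end Directions

/-! ### The distance increases radially near a face -/

section Radial

variable {E : Type*} [NormedAddCommGroup E] [NormedSpace ℝ E]
  {H : Type*} [TopologicalSpace H] {I : ModelWithCorners ℝ E H}
  {X : Type*} [TopologicalSpace X] [ChartedSpace H X]
  {ι : Type*} {Z : StratifiedSubset I X ι} {S : ι} {n : ℕ}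
  {h F : (Fin (n + 1) → ℝ) → X} {T : Finset (Fin (n + 1)) → ι}
  {W : Set (Fin (n + 1) → ℝ)} {A : Finset (Fin (n + 1))} {y : Fin (n + 1) → ℝ}

theorem TubularData.π_eq_fst (D : TubularData Z) {R : ι} {z : X} (hz : z ∈ D.U R) :
    D.π R z = (D.ν R z).1 := by
  have := D.ν_π R z hz
  rw [D.ν_stratum R _ (D.π_mapsTo R hz)] at this
  exact congrArg Prod.fst this

/-- Near the face `A` the distance `μ_A` is bounded by the length of the normal coordinate. -/
theorem exists_mu_le_norm (hp : IsFaceParam Z S h T) (D : TubularData Z)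
    (hF : IsSmoothExtension I h F W) (hA : A.Nonempty) (hy : y ∈ openFace A) :
    ∃ K : ℝ, 0 < K ∧ ∀ᶠ x in 𝓝 y, x ∈ stdSimplex ℝ (Fin (n + 1)) →
      mu A x ≤ K * ‖(D.ν (T A) (F x)).2‖ := by
  let P := EuclideanSpace ℝ (Fin (Module.finrank ℝ E - Z.dim (T A)))
  have hyT : h y ∈ Z.stratum (T A) := (hp.mem_iff hA hy.1).2 hy
  have hFy : F y = h y := hF.eqOn hy.1
  have hyU := D.subset_U _ hyT
  obtain ⟨g, ⟨W', hW', hQ, G, hG, e⟩, hg⟩ := hp.diffeo.2.2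
  obtain ⟨hbij, -, γ, ⟨V', hV', hQV, Γ, hΓ, eΓ⟩, hγ⟩ := D.ν_diffeo (T A)
  have hGh : ∀ x ∈ stdSimplex ℝ (Fin (n + 1)), G (h x) = x := fun x hx => by
    rw [e (hp.diffeo.1.mapsTo hx), hg x hx]
  have hΓν : ∀ z ∈ D.U (T A), Γ (D.ν (T A) z) = z := fun z hz => by
    rw [eΓ (hbij.mapsTo hz), hγ z hz]
  have hΓ0 : ∀ z ∈ Z.stratum (T A), Γ (z, 0) = z := fun z hz => by
    rw [← D.ν_stratum (T A) z hz, hΓν z (D.subset_U _ hz)]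
  have hz0 : ((h y, 0) : X × P) ∈ V' := by
    have := hbij.mapsTo hyU
    rw [D.ν_stratum _ _ hyT] at this
    exact hQV this
  -- `Θ (p, w)` extends `h⁻¹ (ν⁻¹ (h p, w))`. If `q` is the point of the face with `h q = π (h x)`
  -- and `w` is the normal coordinate of `h x`, then `Θ (q, w) = x` and `Θ (q, 0) = q`. As `μ_A q =
  -- 0`, a local Lipschitz bound for `μ_A ∘ Θ` is the claim.
  let Θ : (Fin (n + 1) → ℝ) × P → Fin (n + 1) → ℝ := fun p => G (Γ (F p.1, p.2))
  have hΘ : ContDiffAt ℝ 1 Θ (y, 0) := by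
    refine ContDiffAt.of_le (n := ∞) ?_ (by norm_cast)
    rw [← contMDiffAt_iff_contDiffAt]
    have s1 : ContMDiffAt 𝓘(ℝ, (Fin (n + 1) → ℝ) × P) (I.prod 𝓘(ℝ, P)) ∞
        (fun p : (Fin (n + 1) → ℝ) × P => (F p.1, p.2)) (y, 0) :=
      ContMDiffAt.prodMk (ContMDiffAt.comp (y, (0 : P)) (hF.contMDiffAt hy.1)
        contDiff_fst.contMDiff.contMDiffAt) contDiff_snd.contMDiff.contMDiffAt
    have s2 : ContMDiffAt (I.prod 𝓘(ℝ, P)) I ∞ Γ (F y, 0) := by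
      rw [hFy]
      exact hΓ.contMDiffAt (hV'.mem_nhds hz0)
    have s3 : ContMDiffAt I 𝓘(ℝ, Fin (n + 1) → ℝ) ∞ G (Γ (F y, 0)) := by
      rw [hFy, hΓ0 _ hyT]
      exact hG.contMDiffAt (hW'.mem_nhds (hQ (hp.diffeo.1.mapsTo hy.1)))
    exact ContMDiffAt.comp (y, (0 : P)) (g := fun q => G (Γ q))
      (ContMDiffAt.comp (F y, (0 : P)) s3 s2) s1
  have hmuΘ : ContDiffAt ℝ 1 (fun p => mu A (Θ p)) (y, 0) := by
    have : ContDiff ℝ 1 (mu A : (Fin (n + 1) → ℝ) → ℝ) :=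
      ContDiff.sum fun i _ => contDiff_apply ℝ ℝ i
    exact this.contDiffAt.comp _ hΘ
  obtain ⟨K, t, ht, hK⟩ := hmuΘ.exists_lipschitzOnWith
  have cF : ContinuousAt F y := (hF.contMDiffAt hy.1).continuousAt
  have hνc : ContinuousAt (D.ν (T A)) (F y) := by
    rw [hFy]
    exact ((D.ν_diffeo (T A)).2.1.continuousOn).continuousAt ((D.isOpen_U _).mem_nhds hyU)
  have cν : ContinuousAt (fun x => D.ν (T A) (F x)) y := ContinuousAt.comp hνc cF
  have cπ : ContinuousAt (fun x => G (D.π (T A) (F x))) y := by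
    have h1 : ContinuousAt (D.π (T A)) (F y) := by
      rw [hFy]
      exact ((D.π_smooth (T A)).continuousOn).continuousAt ((D.isOpen_U _).mem_nhds hyU)
    have h2 : ContinuousAt G (D.π (T A) (F y)) := by
      rw [hFy, D.π_retraction _ _ hyT]
      exact hG.continuousOn.continuousAt (hW'.mem_nhds (hQ (hp.diffeo.1.mapsTo hy.1)))
    exact ContinuousAt.comp h2 (ContinuousAt.comp h1 cF)
  have hq0 : G (D.π (T A) (F y)) = y := by
    rw [hFy, D.π_retraction _ _ hyT, hGh y hy.1]
  have hν0 : D.ν (T A) (F y) = (h y, 0) := by rw [hFy, D.ν_stratum _ _ hyT]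
  have t1 : ∀ᶠ x in 𝓝 y, (G (D.π (T A) (F x)), (D.ν (T A) (F x)).2) ∈ t := by
    have : ContinuousAt (fun x => (G (D.π (T A) (F x)), (D.ν (T A) (F x)).2)) y :=
      cπ.prodMk cν.snd
    exact this.eventually_mem (by simpa only [hq0, hν0] using ht)
  have t2 : ∀ᶠ x in 𝓝 y, (G (D.π (T A) (F x)), (0 : P)) ∈ t := by
    have : ContinuousAt (fun x => (G (D.π (T A) (F x)), (0 : P))) y :=
      cπ.prodMk continuousAt_const
    exact this.eventually_mem (by simpa only [hq0] using ht)
  have t3 : ∀ᶠ x in 𝓝 y, F x ∈ D.U (T A) :=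
    cF.eventually_mem (by rw [hFy]; exact (D.isOpen_U _).mem_nhds hyU)
  refine ⟨K + 1, by positivity, ?_⟩
  filter_upwards [t1, t2, t3] with x h1 h2 h3 hx
  have hπT := D.π_mapsTo (T A) h3
  obtain ⟨q, hq, hqe⟩ := hp.exists_eq_of_mem hA hπT
  have hGq : G (D.π (T A) (F x)) = q := by rw [← hqe, hGh q hq.1]
  have hFq : F q = D.π (T A) (F x) := by rw [hF.eqOn hq.1, hqe]
  have e1 : Θ (G (D.π (T A) (F x)), (D.ν (T A) (F x)).2) = x := by
    simp only [Θ, hGq, hFq]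
    rw [D.π_eq_fst h3, Prod.mk.eta, hΓν _ h3, hF.eqOn hx, hGh x hx]
  have e2 : Θ (G (D.π (T A) (F x)), (0 : P)) = q := by
    simp only [Θ, hGq, hFq]
    rw [hΓ0 _ hπT, hGq]
  have hd := hK.dist_le_mul _ h1 _ h2
  simp only [e1, e2] at hd
  rw [mu_eq_zero_of_mem_openFace hq subset_rfl, Real.dist_0_eq_abs,
    abs_of_nonneg (mu_nonneg hx)] at hd
  have hd2 : dist (G (D.π (T A) (F x)), (D.ν (T A) (F x)).2)
      (G (D.π (T A) (F x)), (0 : P)) = ‖(D.ν (T A) (F x)).2‖ := by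
    rw [Prod.dist_eq, dist_self, dist_zero_right, max_eq_right (norm_nonneg _)]
  rw [hd2] at hd
  have := norm_nonneg (D.ν (T A) (F x)).2
  nlinarith

/-- Near the face `A` the distance from the face increases in the radial directions. -/
theorem eventually_radial_pos (hp : IsFaceParam Z S h T) (D : TubularData Z)
    (hF : IsSmoothExtension I h F W) (hA : A.Nonempty) (hy : y ∈ openFace A) :
    ∀ᶠ x in 𝓝 y, x ∈ stdSimplex ℝ (Fin (n + 1)) → mu A x ≠ 0 → ∀ i₀ ∈ A, 0 < x i₀ ∧
      0 < fderiv ℝ (fun y => D.ρ (T A) (F y)) x (radial A i₀ x) := by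
  obtain ⟨K, hK0, hK⟩ := exists_mu_le_norm hp D hF hA hy
  have hyT : h y ∈ Z.stratum (T A) := (hp.mem_iff hA hy.1).2 hy
  have hyU := D.subset_U _ hyT
  obtain ⟨V, hV, hUV, N, hN, eN⟩ := (D.ν_diffeo (T A)).2.1
  let O := pullbackDomain F W (D.U (T A))
  have hO : IsOpen O := hF.isOpen_pullbackDomain (D.isOpen_U _)
  have hyO : y ∈ O := (hF.mem_pullbackDomain hy.1).2 hyU
  let f : (Fin (n + 1) → ℝ) → EuclideanSpace ℝ (Fin (Module.finrank ℝ E - Z.dim (T A))) :=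
    fun x => (N (F x)).2
  have hfν : ∀ x ∈ O, f x = (D.ν (T A) (F x)).2 := fun x hx => by simp only [f, eN hx.2]
  have hf : ContDiffOn ℝ ∞ f O := by
    rw [← contMDiffOn_iff_contDiffOn]
    exact contMDiff_snd.comp_contMDiffOn
      (hN.comp (hF.smooth.mono inter_subset_left) fun x hx => hUV hx.2)
  have hfat : ∀ x ∈ O, ContDiffAt ℝ ∞ f x := fun x hx => hf.contDiffAt (hO.mem_nhds hx)
  have hρ : ∀ x ∈ O, D.ρ (T A) (F x) = ‖f x‖ ^ 2 := fun x hx => by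
    rw [hfν x hx, D.ρ_ν _ _ hx.2]
  have hfd : ∀ x ∈ O, ∀ v, fderiv ℝ (fun y => D.ρ (T A) (F y)) x v =
      2 * inner ℝ (f x) (fderiv ℝ f x v) := by
    intro x hx v
    have h1 : HasFDerivAt f (fderiv ℝ f x) x :=
      ((hfat x hx).differentiableAt (by simp)).hasFDerivAt
    have h2 : (fun y => D.ρ (T A) (F y)) =ᶠ[𝓝 x] fun y => ‖f y‖ ^ 2 := by
      filter_upwards [hO.mem_nhds hx] with z hz using hρ z hz
    rw [h2.fderiv_eq, h1.norm_sq.fderiv]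
    simp
  let L := fderiv ℝ f y
  -- Chosen so that `2 * ε * μ_A ≤ ‖f‖ / 2`, given `μ_A ≤ K * ‖f‖`.
  let ε : ℝ := 1 / (4 * K)
  have hε : 0 < ε := by positivity
  have hstrict := ((hfat y hyO).hasStrictFDerivAt (by simp)).isLittleO.def hε
  obtain ⟨r, hr, hball⟩ := Metric.eventually_nhds_iff_ball.1 hstrict
  have e1 : ∀ᶠ x in 𝓝 y, dist x y < r / 2 := Metric.ball_mem_nhds y (by linarith)
  have e2 : ∀ᶠ x in 𝓝 y, mu A x < r / 2 := by
    have := continuous_mu (A := A) |>.continuousAt (x := y)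
    refine this.eventually (gt_mem_nhds ?_)
    rw [mu_eq_zero_of_mem_openFace hy subset_rfl]
    linarith
  have e3 : ∀ᶠ x in 𝓝 y, ‖fderiv ℝ f x - L‖ < ε := by
    have := ((hf.continuousOn_fderiv_of_isOpen hO (by simp)).continuousAt (hO.mem_nhds hyO))
    have := (this.sub (continuousAt_const (y := L))).norm
    refine this.eventually (gt_mem_nhds ?_)
    simpa [L] using hε
  have e4 : ∀ᶠ x in 𝓝 y, ∀ i ∈ A, 0 < x i := by
    rw [Filter.eventually_all_finset]
    exact fun i hi => (continuous_apply i).continuousAt.eventually (lt_mem_nhds (hy.2.1 i hi))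
  filter_upwards [hK, e1, e2, e3, e4, hO.mem_nhds hyO] with x hKx h1 h2 h3 h4 hxO hx hne i₀ hi₀
  refine ⟨h4 i₀ hi₀, ?_⟩
  have hm : 0 < mu A x := lt_of_le_of_ne (mu_nonneg hx) (Ne.symm hne)
  -- Since `x - b` lies in the face, `f (x - b) = 0`. Strict differentiability at `y` then gives
  -- that `f x` is the derivative of `f` along `b` up to an error `2 * ε * μ_A x ≤ ‖f x‖ / 2`, so
  -- the inner product of the two is at least `‖f x‖ ^ 2 / 2`.
  set b := radial A i₀ x with hb
  have hbn : ‖b‖ ≤ mu A x := norm_radial_le hx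
  have hxb : x - b ∈ openFace A := sub_radial_mem hi₀ hx h4
  have hxbT : h (x - b) ∈ Z.stratum (T A) := (hp.mem_iff hA hxb.1).2 hxb
  have hxbO : x - b ∈ O := (hF.mem_pullbackDomain hxb.1).2 (D.subset_U _ hxbT)
  have hfxb : f (x - b) = 0 := by
    rw [hfν _ hxbO, hF.eqOn hxb.1, D.ν_stratum _ _ hxbT]
  have hs : ‖f x - L b‖ ≤ ε * mu A x := by
    have hd : dist (x - b) y < r := by
      calc dist (x - b) y ≤ dist (x - b) x + dist x y := dist_triangle _ _ _
        _ < r / 2 + r / 2 := by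
          refine add_lt_add ?_ h1
          rw [dist_eq_norm, sub_sub_cancel_left, norm_neg]
          linarith
        _ = r := by ring
    have := hball (x, x - b) (by
      rw [Metric.mem_ball, Prod.dist_eq]
      exact max_lt (by dsimp only; linarith) hd)
    simp only [hfxb, sub_zero, sub_sub_cancel] at this
    exact this.trans (by gcongr)
  have hs' : ‖f x - fderiv ℝ f x b‖ ≤ 2 * ε * mu A x := by
    have e : f x - fderiv ℝ f x b = (f x - L b) - (fderiv ℝ f x - L) b := by
      rw [sub_apply]; abel
    have h5 : ‖(fderiv ℝ f x - L) b‖ ≤ ε * mu A x :=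
      (ContinuousLinearMap.le_opNorm _ _).trans
        (mul_le_mul h3.le hbn (norm_nonneg _) hε.le)
    rw [e]
    calc _ ≤ ‖f x - L b‖ + ‖(fderiv ℝ f x - L) b‖ := norm_sub_le _ _
      _ ≤ _ := by linarith
  have hlow : mu A x ≤ K * ‖f x‖ := by rw [hfν x hxO]; exact hKx hx
  have hfpos : 0 < ‖f x‖ := by
    by_contra hn
    have : ‖f x‖ = 0 := le_antisymm (not_lt.1 hn) (norm_nonneg _)
    rw [this, mul_zero] at hlow
    linarith
  rw [hfd x hxO]
  have hinner : inner ℝ (f x) (fderiv ℝ f x b) =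
      ‖f x‖ ^ 2 - inner ℝ (f x) (f x - fderiv ℝ f x b) := by
    rw [inner_sub_right, real_inner_self_eq_norm_sq]; ring
  have hcs : inner ℝ (f x) (f x - fderiv ℝ f x b) ≤ ‖f x‖ * (2 * ε * mu A x) :=
    (real_inner_le_norm _ _).trans (by gcongr)
  have hεμ : 2 * ε * mu A x ≤ ‖f x‖ / 2 := by
    have : 2 * ε * mu A x ≤ 2 * ε * (K * ‖f x‖) := by gcongr
    refine this.trans (le_of_eq ?_)
    simp only [ε]; field_simp; norm_num
  have : ‖f x‖ * (2 * ε * mu A x) ≤ ‖f x‖ * (‖f x‖ / 2) := by gcongr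
  nlinarith

end Radial

/-- On a compact set, a property which holds near the points with `f ≤ 0` holds where `f` is
small. -/
theorem _root_.IsCompact.exists_pos_of_forall_le {Y : Type*} [TopologicalSpace Y] {Q : Set Y}
    (hQ : IsCompact Q) {f : Y → ℝ} (hf : ContinuousOn f Q) {P : Y → Prop}
    (hP : ∀ x ∈ Q, f x ≤ 0 → ∀ᶠ y in 𝓝[Q] x, P y) : ∃ m > 0, ∀ x ∈ Q, f x ≤ m → P x := by
  suffices h : ∃ m > 0, ∀ x ∈ Q, x ∈ Q → f x ≤ m → P x by
    obtain ⟨m, hm, h⟩ := h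
    exact ⟨m, hm, fun x hx => h x hx hx⟩
  refine hQ.induction_on (p := fun s => ∃ m > 0, ∀ x ∈ s, x ∈ Q → f x ≤ m → P x) ?_ ?_ ?_ ?_
  · exact ⟨1, one_pos, fun x hx => hx.elim⟩
  · rintro s t hst ⟨m, hm, h⟩
    exact ⟨m, hm, fun x hx => h x (hst hx)⟩
  · rintro s t ⟨m, hm, h⟩ ⟨m', hm', h'⟩
    refine ⟨min m m', lt_min hm hm', fun x hx hxQ hfx => ?_⟩
    rcases hx with hx | hx
    · exact h x hx hxQ (hfx.trans (min_le_left _ _))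
    · exact h' x hx hxQ (hfx.trans (min_le_right _ _))
  · intro x hx
    by_cases hfx : f x ≤ 0
    · exact ⟨_, hP x hx hfx, 1, one_pos, fun y hy _ _ => hy⟩
    · rw [not_le] at hfx
      refine ⟨_, (hf x hx).eventually (lt_mem_nhds (half_lt_self hfx)), f x / 2, half_pos hfx,
        fun y hy _ hy' => absurd hy (not_lt.2 hy')⟩

/-! ### Truncated simplices, straight distance functions, and compact tubes -/

section Truncation

variable {n : ℕ}

/-- The simplex truncated near the proper faces of the face `A`. -/
def truncated (δ σ : Finset (Fin (n + 1)) → ℝ) (A : Finset (Fin (n + 1))) :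
    Set (Fin (n + 1) → ℝ) :=
  {x | x ∈ stdSimplex ℝ (Fin (n + 1)) ∧ ∀ C : Finset (Fin (n + 1)), C.Nonempty → C ⊂ A →
    δ C * σ C ≤ mu C x}

variable {δ σ σ' η η' : Finset (Fin (n + 1)) → ℝ} {A B C : Finset (Fin (n + 1))}
  {x y : Fin (n + 1) → ℝ}

theorem truncated_anti (hδ : ∀ C, 0 < δ C) (h : ∀ C, σ C ≤ σ' C) :
    truncated δ σ' A ⊆ truncated δ σ A := fun _ hx =>
  ⟨hx.1, fun C hC hCA => (mul_le_mul_of_nonneg_left (h C) (hδ C).le).trans (hx.2 C hC hCA)⟩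

theorem truncated_mono (h : B ⊆ A) : truncated δ σ A ⊆ truncated δ σ B := fun _ hx =>
  ⟨hx.1, fun C hC hCB => hx.2 C hC (hCB.trans_subset h)⟩

theorem isCompact_truncated : IsCompact (truncated δ σ A) := by
  refine (isCompact_stdSimplex ℝ (Fin (n + 1))).inter_right
    (t := {x | ∀ C : Finset (Fin (n + 1)), C.Nonempty → C ⊂ A → δ C * σ C ≤ mu C x}) ?_
  simp only [ofPred_forall]
  exact isClosed_iInter fun C => isClosed_iInter fun _ => isClosed_iInter fun _ =>
    isClosed_le continuous_const continuous_mu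

/-- A point of the face `A` outside its open face lies on an open face `C ⊂ A`, where `μ_C = 0`;
truncation excludes this. -/
theorem mem_openFace_of_truncated (hδ : ∀ C, 0 < δ C) (hσ : ∀ C, 0 < σ C)
    (hx : x ∈ truncated δ σ A) (h0 : mu A x = 0) : x ∈ openFace A := by
  obtain ⟨C, hC, hxC⟩ := exists_mem_openFace hx.1
  have hCA := subset_of_mem_openFace hxC h0
  rcases hCA.eq_or_ssubset with rfl | hss
  · exact hxC
  · have := hx.2 C hC hss
    rw [mu_eq_zero_of_mem_openFace hxC subset_rfl] at this
    exact absurd (mul_pos (hδ C) (hσ C)) (not_lt.2 this)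

variable {E : Type*} [NormedAddCommGroup E] [NormedSpace ℝ E]
  {H : Type*} [TopologicalSpace H] {I : ModelWithCorners ℝ E H}
  {X : Type*} [TopologicalSpace X] [ChartedSpace H X]
  {ι : Type*} {Z : StratifiedSubset I X ι} {S : ι}

/-- In the truncated simplex, the distance from the stratum of the face `B` is `μ_B / δ_B`, as far
as it lies between `σ_B` and `η_B`. -/
def IsStraight (D : TubularData Z) (h : (Fin (n + 1) → ℝ) → X) (T : Finset (Fin (n + 1)) → ι)
    (δ σ η : Finset (Fin (n + 1)) → ℝ) (B : Finset (Fin (n + 1))) : Prop :=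
  ∀ x ∈ truncated δ σ B,
    (∀ t ∈ Icc (σ B) (η B), (h x ∈ D.U (T B) ∧ D.ρ (T B) (h x) = t) ↔ mu B x = δ B * t) ∧
    ((h x ∈ D.U (T B) ∧ D.ρ (T B) (h x) < σ B) ↔ mu B x < δ B * σ B)

variable {D : TubularData Z} {h : (Fin (n + 1) → ℝ) → X} {T : Finset (Fin (n + 1)) → ι}

/-- Raising the lower threshold shrinks the truncated set. The sublevel clause at `σ' B` is
assembled from the old one below `σ B` and the linear range above it, which is why `σ' B ≤ η B` is
assumed. -/
theorem IsStraight.mono (hst : IsStraight D h T δ σ η B) (hδ : ∀ C, 0 < δ C)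
    (hσ : ∀ C, σ C ≤ σ' C) (hη : ∀ C, η' C ≤ η C) (hση : σ' B ≤ η B) :
    IsStraight D h T δ σ' η' B := by
  intro x hx
  obtain ⟨h1, h2⟩ := hst x (truncated_anti hδ hσ hx)
  refine ⟨fun t ht => h1 t ⟨(hσ B).trans ht.1, ht.2.trans (hη B)⟩, ?_⟩
  constructor
  · rintro ⟨hU, hlt⟩
    rcases lt_or_ge (D.ρ (T B) (h x)) (σ B) with h3 | h3
    · exact (h2.1 ⟨hU, h3⟩).trans_le (mul_le_mul_of_nonneg_left (hσ B) (hδ B).le)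
    · rw [(h1 _ ⟨h3, hlt.le.trans hση⟩).1 ⟨hU, rfl⟩]
      exact mul_lt_mul_of_pos_left hlt (hδ B)
  · intro hlt
    rcases lt_or_ge (mu B x) (δ B * σ B) with h3 | h3
    · exact ⟨(h2.2 h3).1, (h2.2 h3).2.trans_le (hσ B)⟩
    · have e : mu B x = δ B * (mu B x / δ B) := by field_simp [(hδ B).ne']
      have h4 : σ B ≤ mu B x / δ B := by rw [le_div_iff₀ (hδ B)]; linarith
      have h5 : mu B x / δ B < σ' B := by rw [div_lt_iff₀ (hδ B)]; linarith
      obtain ⟨hU, he⟩ := (h1 _ ⟨h4, h5.le.trans hση⟩).2 e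
      exact ⟨hU, he ▸ h5⟩

/-- Straightness for `C` is known only on the simplex truncated at the proper subfaces of `C`. By
strong induction the conditions for smaller faces put `x` there, and then the condition for `C`
translates. -/
theorem mem_truncated_iff (hst : ∀ C, C.Nonempty → C ⊂ A → IsStraight D h T δ σ η C)
    (hx : x ∈ stdSimplex ℝ (Fin (n + 1))) :
    x ∈ truncated δ σ A ↔
      ∀ C, C.Nonempty → C ⊂ A → ¬(h x ∈ D.U (T C) ∧ D.ρ (T C) (h x) < σ C) := by
  constructor
  · intro hxA C hC hCA hlt
    have := ((hst C hC hCA x (truncated_mono hCA.subset hxA)).2).1 hlt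
    exact absurd (hxA.2 C hC hCA) (not_le.2 this)
  · intro hall
    refine ⟨hx, fun C => ?_⟩
    induction C using Finset.strongInduction with
    | H C ih =>
      intro hC hCA
      by_contra hlt
      have hxC : x ∈ truncated δ σ C := ⟨hx, fun C' hC' hss => ih C' hss hC' (hss.trans hCA)⟩
      exact hall C hC hCA ((hst C hC hCA x hxC).2.2 (not_le.1 hlt))

variable [T2Space X]

/-- Expressed through the distances, the truncation conditions depend only on the projection to `T
A`, by `ρ_lt_π_iff`. -/
theorem mem_truncated_iff_of_π (hp : IsFaceParam Z S h T) (hA : A.Nonempty)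
    (hst : ∀ C, C.Nonempty → C ⊂ A → IsStraight D h T δ σ η C)
    (hx : x ∈ stdSimplex ℝ (Fin (n + 1))) (hxU : h x ∈ D.U (T A))
    (hy : y ∈ stdSimplex ℝ (Fin (n + 1))) (hyx : h y = D.π (T A) (h x)) :
    y ∈ truncated δ σ A ↔ x ∈ truncated δ σ A := by
  rw [mem_truncated_iff hst hx, mem_truncated_iff hst hy]
  refine forall_congr' fun C => forall_congr' fun hC => forall_congr' fun hCA => not_congr ?_
  rw [hyx]
  exact D.ρ_lt_π_iff ((hp.prec_iff hC hA).2 hCA) hxU _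

theorem isCompact_truncated_tube (hp : IsFaceParam Z S h T) (hA : A.Nonempty)
    (hst : ∀ C, C.Nonempty → C ⊂ A → IsStraight D h T δ σ η C)
    (hδ : ∀ C, 0 < δ C) (hσ : ∀ C, 0 < σ C) {c : ℝ} (hc : 0 ≤ c)
    (hγ : ∀ y ∈ truncated δ σ A, mu A y = 0 → c < D.γ (T A) (h y)) :
    IsCompact {x | x ∈ truncated δ σ A ∧ h x ∈ D.U (T A) ∧ D.ρ (T A) (h x) ≤ c} := by
  let K := {x | x ∈ truncated δ σ A ∧ mu A x = 0}
  have hKA : K ⊆ openFace A := fun x hx => mem_openFace_of_truncated hδ hσ hx.1 hx.2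
  have hK : IsCompact K :=
    isCompact_truncated.inter_right (isClosed_singleton.preimage (continuous_mu (A := A)))
  have hhK : IsCompact (h '' K) :=
    hK.image_of_continuousOn (hp.continuousOn.mono (hKA.trans openFace_subset))
  have htube := D.isCompact_tube (T := T A) hhK
    (by rw [← hp.image A hA]; exact image_mono hKA) hc
    (by rintro _ ⟨y, hy, rfl⟩; exact hγ y hy.1 hy.2)
  have hcl := hp.continuousOn.preimage_isClosed_of_isClosed
    (isCompact_stdSimplex ℝ (Fin (n + 1))).isClosed htube.isClosed
  -- The set in question is the preimage under `h` of the compact tube over the image of the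
  -- truncated face.
  convert (isCompact_stdSimplex ℝ (Fin (n + 1))).of_isClosed_subset hcl
    inter_subset_left using 1
  ext x
  refine Iff.symm ⟨?_, ?_⟩
  · rintro ⟨hx, hU, ⟨y, hy, hyx⟩, hle⟩
    exact ⟨(mem_truncated_iff_of_π hp hA hst hx hU hy.1.1 hyx).1 hy.1, hU, hle⟩
  · rintro ⟨hx, hU, hle⟩
    obtain ⟨y, hy, hyx⟩ := hp.exists_eq_of_mem hA (D.π_mapsTo _ hU)
    refine ⟨hx.1, hU, ⟨y, ⟨(mem_truncated_iff_of_π hp hA hst hx.1 hU hy.1 hyx).2 hx,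
      mu_eq_zero_of_mem_openFace hy subset_rfl⟩, hyx⟩, hle⟩

omit [T2Space X] in
/-- The tube condition persists for slightly smaller parameters and a slightly larger radius. -/
theorem exists_threshold (hp : IsFaceParam Z S h T) (hA : A.Nonempty)
    (hst : ∀ C, C.Nonempty → C ⊂ A → IsStraight D h T δ σ η C)
    (hδ : ∀ C, 0 < δ C) (hσ : ∀ C, 0 < σ C) {τ' : Finset (Fin (n + 1)) → ℝ}
    (hστ : ∀ C, σ C < τ' C) (hτη : ∀ C, τ' C ≤ η C) {r : ℝ}
    (hγ : ∀ z ∈ Z.stratum (T A), (∀ C, C.Nonempty → C ⊂ A →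
      ¬(z ∈ D.U (T C) ∧ D.ρ (T C) z < τ' C)) → r < D.γ (T A) z) :
    ∃ (σ₁ : Finset (Fin (n + 1)) → ℝ) (θ : ℝ), (∀ C, σ C < σ₁ C) ∧ (∀ C, σ₁ C < τ' C) ∧ r < θ ∧
      ∀ y ∈ truncated δ σ₁ A, mu A y = 0 → θ < D.γ (T A) (h y) := by
  -- Thresholds increasing to `τ'`; the `2` in the denominator keeps even the first one strictly
  -- above `σ`.
  let s : ℕ → Finset (Fin (n + 1)) → ℝ := fun m C => τ' C - (τ' C - σ C) / (m + 2)
  have hs1 : ∀ m C, σ C < s m C := fun m C => by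
    have h1 : 0 < τ' C - σ C := sub_pos.2 (hστ C)
    have h2 : (τ' C - σ C) / (m + 2) < τ' C - σ C :=
      div_lt_self h1 (by have := Nat.cast_nonneg (α := ℝ) m; linarith)
    simp only [s]; linarith
  have hs2 : ∀ m C, s m C < τ' C := fun m C => by
    have : 0 < (τ' C - σ C) / (m + 2) := div_pos (sub_pos.2 (hστ C)) (by positivity)
    simp only [s]; linarith
  have hsm : ∀ C, Monotone fun m => s m C := fun C m m' hm => by
    have h1 : 0 < τ' C - σ C := sub_pos.2 (hστ C)
    simp only [s]; gcongr
  have hslim : ∀ C, Filter.Tendsto (fun m => s m C) Filter.atTop (𝓝 (τ' C)) := fun C => by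
    have h1 : Filter.Tendsto (fun m : ℕ => (τ' C - σ C) / ((m : ℝ) + 2)) Filter.atTop (𝓝 0) :=
      Filter.Tendsto.div_atTop tendsto_const_nhds
        (Filter.tendsto_atTop_add_const_right _ _ tendsto_natCast_atTop_atTop)
    simpa using h1.const_sub (τ' C)
  have hKface : ∀ {σ₁ : Finset (Fin (n + 1)) → ℝ}, (∀ C, 0 < σ₁ C) →
      {x | x ∈ truncated δ σ₁ A ∧ mu A x = 0} ⊆ openFace A := fun hσ₁ x hx =>
    mem_openFace_of_truncated hδ hσ₁ hx.1 hx.2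
  have hKc : ∀ (σ₁ : Finset (Fin (n + 1)) → ℝ),
      IsCompact {x | x ∈ truncated δ σ₁ A ∧ mu A x = 0} := fun σ₁ =>
    isCompact_truncated.inter_right (isClosed_singleton.preimage (continuous_mu (A := A)))
  have hγc : ContinuousOn (fun y => D.γ (T A) (h y)) (openFace A) :=
    (D.γ_smooth (T A)).continuousOn.comp (hp.continuousOn.mono openFace_subset)
      fun y hy => (hp.mem_iff hA hy.1).2 hy
  -- The bad points are those of the face with `γ ≤ r`. By hypothesis each violates a truncation
  -- condition for `τ'`, hence one for some `s m`. These violations are open and increasing in `m`,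
  -- so a single `m` excludes all bad points.
  have hbad : IsCompact ({x | x ∈ truncated δ σ A ∧ mu A x = 0} ∩
      (fun y => D.γ (T A) (h y)) ⁻¹' Iic r) := by
    refine (hKc σ).of_isClosed_subset ?_ inter_subset_left
    exact (hγc.mono (hKface hσ)).preimage_isClosed_of_isClosed (hKc σ).isClosed isClosed_Iic
  obtain ⟨m, hm⟩ := hbad.elim_directed_cover
    (fun m : ℕ => ⋃ C ∈ {C : Finset (Fin (n + 1)) | C.Nonempty ∧ C ⊂ A},
      {x | mu C x < δ C * s m C})
    (fun m => isOpen_biUnion fun C _ => isOpen_lt continuous_mu continuous_const)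
    (fun y hy => by
      by_contra hcon
      simp only [mem_iUnion, not_exists, mem_ofPred_eq, not_lt] at hcon
      have hyt : y ∈ truncated δ τ' A := ⟨hy.1.1.1, fun C hC hCA =>
        le_of_tendsto ((hslim C).const_mul (δ C))
          (Filter.Eventually.of_forall fun m => hcon m C ⟨hC, hCA⟩)⟩
      have hst' : ∀ C, C.Nonempty → C ⊂ A → IsStraight D h T δ τ' η C := fun C hC hCA =>
        (hst C hC hCA).mono hδ (fun C => (hστ C).le) (fun _ => le_rfl) (hτη C)
      have := hγ (h y) ((hp.mem_iff hA hy.1.1.1).2 (hKface hσ hy.1))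
        ((mem_truncated_iff hst' hy.1.1.1).1 hyt)
      exact absurd hy.2 (not_le.2 this))
    (Monotone.directed_le fun m m' hm => iUnion₂_mono fun C _ x hx =>
      lt_of_lt_of_le (show mu C x < δ C * s m C from hx)
        (mul_le_mul_of_nonneg_left (hsm C hm) (hδ C).le))
  have hgood : ∀ y ∈ {x | x ∈ truncated δ (s m) A ∧ mu A x = 0}, r < D.γ (T A) (h y) := by
    intro y hy
    by_contra hle
    have := hm ⟨⟨truncated_anti hδ (fun C => (hs1 m C).le) hy.1, hy.2⟩, not_lt.1 hle⟩
    simp only [mem_iUnion] at this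
    obtain ⟨C, hC, hlt⟩ := this
    exact absurd (hy.1.2 C hC.1 hC.2) (not_le.2 hlt)
  rcases Set.eq_empty_or_nonempty {x | x ∈ truncated δ (s m) A ∧ mu A x = 0} with he | hne
  · refine ⟨s m, r + 1, hs1 m, hs2 m, by linarith, fun y hy h0 => ?_⟩
    exact absurd (show y ∈ {x | x ∈ truncated δ (s m) A ∧ mu A x = 0} from ⟨hy, h0⟩)
      (by rw [he]; exact notMem_empty y)
  · obtain ⟨z, hz, hmin⟩ := (hKc (s m)).exists_isMinOn hne
      (hγc.mono (hKface fun C => (hσ C).trans (hs1 m C)))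
    have hz' := hgood z hz
    refine ⟨s m, (r + D.γ (T A) (h z)) / 2, hs1 m, hs2 m, by linarith, fun y hy h0 => ?_⟩
    have : D.γ (T A) (h z) ≤ D.γ (T A) (h y) := hmin ⟨hy, h0⟩
    linarith

end Truncation

/-! ### Directions compatible with the faces already straightened -/

section Admissible

variable {n : ℕ} {A B C : Finset (Fin (n + 1))} {b : Finset (Fin (n + 1)) → ℝ}
  {x y v : Fin (n + 1) → ℝ}

theorem mu_add_smul (s : ℝ) : mu C (x + s • v) = mu C x + s * mu C v := by
  simp only [mu, Pi.add_apply, Pi.smul_apply, smul_eq_mul, Finset.sum_add_distrib, Finset.mul_sum]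

/-- Directions at `x` tangent to all the faces of the simplex through `x`, along which those of the
functions `μ_C`, for proper faces `C` of `A`, which are at most `b_C` are constant. -/
structure IsAdmissible (A : Finset (Fin (n + 1))) (b : Finset (Fin (n + 1)) → ℝ)
    (x v : Fin (n + 1) → ℝ) : Prop where
  supp : ∀ i, x i = 0 → v i = 0
  sum : ∑ i, v i = 0
  mu_zero : ∀ C : Finset (Fin (n + 1)), C.Nonempty → C ⊂ A → mu C x ≤ b C → mu C v = 0

open Classical in
/-- The quantities preserved by the deformations for the face `A`. -/
def faceInv (A : Finset (Fin (n + 1))) (b : Finset (Fin (n + 1)) → ℝ) (y : Fin (n + 1) → ℝ) :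
    (Fin (n + 1) → SignType) × ℝ × (Finset (Fin (n + 1)) → ℝ) :=
  (fun i => SignType.sign (y i), ∑ i, y i,
    fun C => if C.Nonempty ∧ C ⊂ A then min (mu C y) (b C) else 0)

theorem faceInv_sign (h : faceInv A b x = faceInv A b y) (i : Fin (n + 1)) :
    SignType.sign (x i) = SignType.sign (y i) := congrFun (congrArg Prod.fst h) i

theorem faceInv_min (h : faceInv A b x = faceInv A b y) (hC : C.Nonempty) (hCA : C ⊂ A) :
    min (mu C x) (b C) = min (mu C y) (b C) := by
  have := congrFun (congrArg (fun p => p.2.2) h) C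
  simpa [faceInv, hC, hCA] using this

theorem mem_stdSimplex_of_faceInv (h : faceInv A b x = faceInv A b y)
    (hx : x ∈ stdSimplex ℝ (Fin (n + 1))) : y ∈ stdSimplex ℝ (Fin (n + 1)) := by
  refine ⟨fun i => ?_, ?_⟩
  · rw [← sign_nonneg_iff, ← faceInv_sign h i, sign_nonneg_iff]
    exact hx.1 i
  · have : ∑ i, x i = ∑ i, y i := congrArg (fun p => p.2.1) h
    rw [← this, hx.2]

theorem mem_openFace_of_faceInv (h : faceInv A b x = faceInv A b y) (hx : x ∈ openFace B) :
    y ∈ openFace B := by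
  refine ⟨mem_stdSimplex_of_faceInv h hx.1, fun i hi => ?_, fun i hi => ?_⟩
  · rw [← sign_eq_one_iff, ← faceInv_sign h i, sign_eq_one_iff]
    exact hx.2.1 i hi
  · rw [← sign_eq_zero_iff, ← faceInv_sign h i, sign_eq_zero_iff]
    exact hx.2.2 i hi

/-- Near `x`, positive coordinates stay positive and each `μ_C` exceeding `b C` keeps exceeding it,
so its minimum with `b C` is constant. The other entries do not change along `v`. -/
theorem IsAdmissible.exists_nhds (hv : IsAdmissible A b x v)
    (hx : x ∈ stdSimplex ℝ (Fin (n + 1))) :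
    ∃ W ∈ 𝓝 x, ∀ y ∈ W, ∀ s : ℝ, y + s • v ∈ W → faceInv A b (y + s • v) = faceInv A b y := by
  refine ⟨{y | (∀ i, 0 < x i → 0 < y i) ∧ ∀ C, b C < mu C x → b C < mu C y}, ?_, ?_⟩
  · have h1 : ∀ i, ∀ᶠ y in 𝓝 x, 0 < x i → 0 < y i := fun i => by
      by_cases hi : 0 < x i
      · filter_upwards [(continuous_apply i).continuousAt.eventually (lt_mem_nhds hi)] with y hy _
        exact hy
      · exact Filter.Eventually.of_forall fun y h => absurd h hi
    have h2 : ∀ C, ∀ᶠ y in 𝓝 x, b C < mu C x → b C < mu C y := fun C => by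
      by_cases hi : b C < mu C x
      · filter_upwards [continuous_mu.continuousAt.eventually (lt_mem_nhds hi)] with y hy _
        exact hy
      · exact Filter.Eventually.of_forall fun y h => absurd h hi
    exact (Filter.eventually_all.2 h1).and (Filter.eventually_all.2 h2)
  · rintro y ⟨hy1, hy2⟩ s ⟨hs1, hs2⟩
    refine Prod.ext (funext fun i => ?_) (Prod.ext ?_ (funext fun C => ?_))
    · change SignType.sign ((y + s • v) i) = SignType.sign (y i)
      rcases (hx.1 i).eq_or_lt' with h0 | h0
      · simp [hv.supp i h0]
      · rw [sign_pos (hy1 i h0), sign_pos (hs1 i h0)]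
    · simp [faceInv, Finset.sum_add_distrib, ← Finset.mul_sum, hv.sum]
    · simp only [faceInv]
      split_ifs with hC
      · by_cases hb : mu C x ≤ b C
        · rw [mu_add_smul, hv.mu_zero C hC.1 hC.2 hb]; simp
        · rw [not_le] at hb
          rw [min_eq_right (hy2 C hb).le, min_eq_right (hs2 C hb).le]
      · rfl

theorem eventually_line_mem (hx : x ∈ stdSimplex ℝ (Fin (n + 1))) (hv : ∀ i, x i = 0 → v i = 0)
    (hs : ∑ i, v i = 0) : ∀ᶠ t in 𝓝 (0 : ℝ), x + t • v ∈ stdSimplex ℝ (Fin (n + 1)) := by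
  have h1 : ∀ i, ∀ᶠ t in 𝓝 (0 : ℝ), 0 ≤ (x + t • v) i := fun i => by
    rcases (hx.1 i).eq_or_lt' with h0 | h0
    · exact Filter.Eventually.of_forall fun t => by simp [h0, hv i h0]
    · have : Continuous fun t : ℝ => (x + t • v) i := by
        simp only [Pi.add_apply, Pi.smul_apply]; fun_prop
      have h2 := this.continuousAt.eventually (lt_mem_nhds (show 0 < (x + (0 : ℝ) • v) i by simpa))
      filter_upwards [h2] with t ht using ht.le
  filter_upwards [Filter.eventually_all.2 h1] with t ht
  refine ⟨ht, ?_⟩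
  simp [Finset.sum_add_distrib, ← Finset.mul_sum, hs, hx.2]

variable {E : Type*} [NormedAddCommGroup E] [NormedSpace ℝ E]
  {H : Type*} [TopologicalSpace H] {I : ModelWithCorners ℝ E H}
  {X : Type*} [TopologicalSpace X] [ChartedSpace H X]
  {ι : Type*} {Z : StratifiedSubset I X ι} {S : ι} {D : TubularData Z}
  {h F : (Fin (n + 1) → ℝ) → X} {T : Finset (Fin (n + 1)) → ι}
  {W : Set (Fin (n + 1) → ℝ)} {δ σ σ₁ η η₁ : Finset (Fin (n + 1)) → ℝ}

/-- Near points where `μ_C` is small, the distance from the stratum of `C` is linear. -/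
theorem eventually_ρ_eq (hst : ∀ C, C.Nonempty → C ⊂ A → IsStraight D h T δ σ η C)
    (hδ : ∀ C, 0 < δ C) (hσ : ∀ C, σ C < σ₁ C) (hη : ∀ C, η₁ C < η C)
    (hx : x ∈ truncated δ σ₁ A) (hC : C.Nonempty) (hCA : C ⊂ A) (hle : mu C x ≤ δ C * η₁ C) :
    ∀ᶠ y in 𝓝 x, y ∈ stdSimplex ℝ (Fin (n + 1)) →
      h y ∈ D.U (T C) ∧ D.ρ (T C) (h y) = mu C y / δ C := by
  have h1 : ∀ C' : Finset (Fin (n + 1)), ∀ᶠ y in 𝓝 x, C'.Nonempty → C' ⊂ A →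
      δ C' * σ C' < mu C' y := fun C' => by
    by_cases hC' : C'.Nonempty ∧ C' ⊂ A
    · have : δ C' * σ C' < mu C' x :=
        (mul_lt_mul_of_pos_left (hσ C') (hδ C')).trans_le (hx.2 C' hC'.1 hC'.2)
      filter_upwards [continuous_mu.continuousAt.eventually (lt_mem_nhds this)] with y hy _ _
      exact hy
    · exact Filter.Eventually.of_forall fun y a b => absurd ⟨a, b⟩ hC'
  have h2 : ∀ᶠ y in 𝓝 x, mu C y < δ C * η C :=
    continuous_mu.continuousAt.eventually
      (gt_mem_nhds (hle.trans_lt (mul_lt_mul_of_pos_left (hη C) (hδ C))))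
  filter_upwards [Filter.eventually_all.2 h1, h2] with y hy1 hy2 hy
  have hyt : y ∈ truncated δ σ C := ⟨hy, fun C' hC' hss => (hy1 C' hC' (hss.trans hCA)).le⟩
  refine ((hst C hC hCA y hyt).1 (mu C y / δ C) ⟨?_, ?_⟩).2 ?_
  · rw [le_div_iff₀ (hδ C)]; linarith [hy1 C hC hCA]
  · rw [div_le_iff₀ (hδ C)]; linarith
  · field_simp [(hδ C).ne']

variable [T2Space X]

/-- `exists_tangent_direction` is applied to the faces `C` with `μ_C` at most its bound. For these
the distance is already `μ_C / δ_C` on the simplex near `x`, so fixing it to first order fixes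
`μ_C`. -/
theorem exists_admissible (hp : IsFaceParam Z S h T) (hF : IsSmoothExtension I h F W)
    (hA : A.Nonempty) (hst : ∀ C, C.Nonempty → C ⊂ A → IsStraight D h T δ σ η C)
    (hδ : ∀ C, 0 < δ C) (hσ : ∀ C, σ C < σ₁ C) (hη : ∀ C, η₁ C < η C)
    (hx : x ∈ truncated δ σ₁ A) (hxU : h x ∈ D.U (T A)) (hne : mu A x ≠ 0) :
    ∃ v, IsAdmissible A (fun C => δ C * η₁ C) x v ∧
      0 < fderiv ℝ (fun y => D.ρ (T A) (F y)) x v := by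
  classical
  obtain ⟨B, hB, hxB⟩ := exists_mem_openFace hx.1
  have hAB : A ≠ B := fun e => hne (mu_eq_zero_of_mem_openFace hxB e.ge)
  let 𝒞 : Finset (Finset (Fin (n + 1))) :=
    Finset.univ.filter fun C => C.Nonempty ∧ C ⊂ A ∧ mu C x ≤ δ C * η₁ C
  have ev : ∀ C ∈ 𝒞, _ := fun C hC =>
    have hC' := (Finset.mem_filter.1 hC).2
    eventually_ρ_eq hst hδ hσ hη hx hC'.1 hC'.2.1 hC'.2.2
  have hUC : ∀ C ∈ 𝒞, h x ∈ D.U (T C) := fun C hC => ((ev C hC).self_of_nhds hx.1).1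
  obtain ⟨v, hv1, hv2, hv3, hv4⟩ := exists_tangent_direction hp D hF hA hB hxB hxU hAB 𝒞
    fun C hC => ⟨(Finset.mem_filter.1 hC).2.1, (Finset.mem_filter.1 hC).2.2.1, hUC C hC⟩
  refine ⟨v, ⟨hv1, hv2, fun C hC hCA hle => ?_⟩, hv3⟩
  have hC𝒞 : C ∈ 𝒞 := Finset.mem_filter.2 ⟨Finset.mem_univ _, hC, hCA, hle⟩
  have hline : HasDerivAt (fun t : ℝ => x + t • v) v 0 := by
    simpa using ((hasDerivAt_id (0 : ℝ)).smul_const v).const_add x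
  have hd1 : HasFDerivAt (fun y => D.ρ (T C) (F y)) (fderiv ℝ (fun y => D.ρ (T C) (F y)) x)
      (x + (0 : ℝ) • v) := by
    simp only [zero_smul, add_zero]
    exact (((hF.contDiffOn_ρ D (T C)).contDiffAt ((hF.isOpen_pullbackDomain
      (D.isOpen_U _)).mem_nhds ((hF.mem_pullbackDomain hx.1).2 (hUC C hC𝒞)))).differentiableAt
      (by simp)).hasFDerivAt
  have hd2 := hd1.comp_hasDerivAt (0 : ℝ) hline
  rw [hv4 C hC𝒞] at hd2
  have hd3 : HasDerivAt (fun t : ℝ => (mu C x + t * mu C v) / δ C) (mu C v / δ C) 0 := by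
    simpa using (((hasDerivAt_id (0 : ℝ)).mul_const (mu C v)).const_add (mu C x)).div_const (δ C)
  have hto : Filter.Tendsto (fun t : ℝ => x + t • v) (𝓝 0) (𝓝 x) := by
    simpa using hline.continuousAt.tendsto
  -- The linear formula for the distance is available only on the simplex; it may be differentiated
  -- along `v` because the line stays in the simplex for small `t`.
  have heq : (fun t : ℝ => (mu C x + t * mu C v) / δ C) =ᶠ[𝓝 0]
      (fun y => D.ρ (T C) (F y)) ∘ fun t : ℝ => x + t • v := by
    filter_upwards [eventually_line_mem hx.1 hv1 hv2, hto.eventually (ev C hC𝒞)] with t h1 h2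
    simp only [Function.comp_apply]
    rw [hF.eqOn h1, (h2 h1).2, mu_add_smul]
  have := hd3.unique (hd2.congr_of_eventuallyEq heq)
  rwa [div_eq_zero_iff, or_iff_left (hδ C).ne'] at this

/-- The coordinate `i₀` must lie in `A` but in no `C` with `μ_C` at most its bound. The tubes of
these `C` all contain `h x`, so they form a chain; any `i₀` in `A` outside the largest one will do.
-/
theorem exists_admissible_radial (hp : IsFaceParam Z S h T)
    (hA : A.Nonempty) (hst : ∀ C, C.Nonempty → C ⊂ A → IsStraight D h T δ σ η C)
    (hδ : ∀ C, 0 < δ C) (hσ : ∀ C, σ C < σ₁ C) (hη : ∀ C, η₁ C < η C)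
    (hx : x ∈ truncated δ σ₁ A) (hne : mu A x ≠ 0)
    (hrad : ∀ i₀ ∈ A, 0 < x i₀ ∧ 0 < fderiv ℝ (fun y => D.ρ (T A) (F y)) x (radial A i₀ x)) :
    ∃ v, IsAdmissible A (fun C => δ C * η₁ C) x v ∧
      0 < fderiv ℝ (fun y => D.ρ (T A) (F y)) x v ∧ 0 < mu A v := by
  classical
  let 𝒞 : Finset (Finset (Fin (n + 1))) :=
    Finset.univ.filter fun C => C.Nonempty ∧ C ⊂ A ∧ mu C x ≤ δ C * η₁ C
  have hUC : ∀ C ∈ 𝒞, h x ∈ D.U (T C) := fun C hC => by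
    have hC' := (Finset.mem_filter.1 hC).2
    exact ((eventually_ρ_eq hst hδ hσ hη hx hC'.1 hC'.2.1 hC'.2.2).self_of_nhds hx.1).1
  obtain ⟨i₀, hi₀, hi₀C⟩ : ∃ i₀ ∈ A, ∀ C ∈ 𝒞, i₀ ∉ C := by
    rcases 𝒞.eq_empty_or_nonempty with he | hne
    · obtain ⟨i, hi⟩ := hA
      exact ⟨i, hi, fun C hC => by simp [he] at hC⟩
    · obtain ⟨M, hM, hmax⟩ := 𝒞.exists_max_image Finset.card hne
      have hM' := (Finset.mem_filter.1 hM).2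
      obtain ⟨i, hi, hiM⟩ := Finset.exists_of_ssubset hM'.2.1
      refine ⟨i, hi, fun C hC hiC => hiM ?_⟩
      have hC' := (Finset.mem_filter.1 hC).2
      rcases hp.comparable D hC'.1 hM'.1 (hUC C hC) (hUC M hM) with hlt | hlt | heq
      · exact hlt.subset hiC
      · exact absurd (Finset.card_lt_card hlt) (not_lt.2 (hmax C hC))
      · exact heq ▸ hiC
  refine ⟨radial A i₀ x, ⟨fun i hi => ?_, sum_radial hi₀, fun C hC hCA hle => ?_⟩,
    (hrad i₀ hi₀).2, ?_⟩
  · by_cases hiA : i ∈ A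
    · exact absurd hi (hrad i hiA).1.ne'
    · simp [radial, hiA, hi]
  · exact sum_radial_compl hi₀ hCA.subset
      (hi₀C C (Finset.mem_filter.2 ⟨Finset.mem_univ _, hC, hCA, hle⟩))
  · rw [mu_radial]
    exact lt_of_le_of_ne (mu_nonneg hx.1) (Ne.symm hne)

end Admissible

/-! ### Straightening the distance function of one face -/

section Step

variable {E : Type*} [NormedAddCommGroup E] [NormedSpace ℝ E]
  {H : Type*} [TopologicalSpace H] {I : ModelWithCorners ℝ E H}
  {X : Type*} [TopologicalSpace X] [ChartedSpace H X]
  {ι : Type*} {Z : StratifiedSubset I X ι} {S : ι} {D : TubularData Z} {n : ℕ}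
  {h F : (Fin (n + 1) → ℝ) → X} {T : Finset (Fin (n + 1)) → ι}
  {W : Set (Fin (n + 1) → ℝ)} {δ σ σ₁ σ₂ η η₁ : Finset (Fin (n + 1)) → ℝ}
  {A : Finset (Fin (n + 1))} {x : Fin (n + 1) → ℝ} {θ : ℝ}

theorem IsFaceParam.continuousWithinAt_ρ (hp : IsFaceParam Z S h T) {R : ι}
    (hx : x ∈ stdSimplex ℝ (Fin (n + 1))) (hU : h x ∈ D.U R) :
    ContinuousWithinAt (fun y => D.ρ R (h y)) (stdSimplex ℝ (Fin (n + 1))) x :=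
  ContinuousAt.comp_continuousWithinAt
    ((D.distancelike R).smooth.continuousOn.continuousAt ((D.isOpen_U R).mem_nhds hU))
    (hp.continuousOn x hx)

/-- By compactness it suffices to look near points with `μ_A = 0`. They lie in the open face `A`,
where the distance vanishes. -/
theorem exists_near (D : TubularData Z) (hp : IsFaceParam Z S h T) (hA : A.Nonempty)
    (hδ : ∀ C, 0 < δ C) (hσ : ∀ C, 0 < σ C) {ε : ℝ} (hε : 0 < ε) :
    ∃ m > 0, ∀ x ∈ truncated δ σ A, mu A x ≤ m → h x ∈ D.U (T A) ∧ D.ρ (T A) (h x) < ε := by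
  refine isCompact_truncated.exists_pos_of_forall_le continuous_mu.continuousOn fun x hx h0 => ?_
  have hxA := mem_openFace_of_truncated hδ hσ hx (le_antisymm h0 (mu_nonneg hx.1))
  have hxT : h x ∈ Z.stratum (T A) := (hp.mem_iff hA hx.1).2 hxA
  have hxU := D.subset_U _ hxT
  have hsub : truncated δ σ A ⊆ stdSimplex ℝ (Fin (n + 1)) := fun _ hx => hx.1
  have h1 := (hp.continuousOn x hx.1).mono hsub
  have h2 := (hp.continuousWithinAt_ρ (D := D) hx.1 hxU).mono hsub
  refine (h1.eventually_mem ((D.isOpen_U _).mem_nhds hxU)).and (h2.eventually (gt_mem_nhds ?_))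
  exact ((D.ρ_eq_zero_iff hxU).2 hxT).trans_lt hε

theorem exists_radial_range (hp : IsFaceParam Z S h T) (hF : IsSmoothExtension I h F W)
    (hA : A.Nonempty) (hδ : ∀ C, 0 < δ C) (hσ : ∀ C, 0 < σ C) :
    ∃ m > 0, ∀ x ∈ truncated δ σ A, mu A x ≤ m → mu A x ≠ 0 → ∀ i₀ ∈ A, 0 < x i₀ ∧
      0 < fderiv ℝ (fun y => D.ρ (T A) (F y)) x (radial A i₀ x) := by
  refine isCompact_truncated.exists_pos_of_forall_le continuous_mu.continuousOn fun x hx h0 => ?_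
  have hxA := mem_openFace_of_truncated hδ hσ hx (le_antisymm h0 (mu_nonneg hx.1))
  filter_upwards [nhdsWithin_le_nhds (eventually_radial_pos hp D hF hA hxA),
    self_mem_nhdsWithin] with y hy hyt using hy hyt.1

/-- The converse comparison to `exists_near`. It needs the compact tube, because the distance lives
only on the open set `U (T A)`. -/
theorem exists_far (hp : IsFaceParam Z S h T) (hA : A.Nonempty)
    (hcomp : IsCompact {x | x ∈ truncated δ σ A ∧ h x ∈ D.U (T A) ∧ D.ρ (T A) (h x) ≤ θ})
    {m : ℝ} (hm : 0 < m) :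
    ∃ ε > 0, ∀ x ∈ truncated δ σ A, h x ∈ D.U (T A) → D.ρ (T A) (h x) ≤ θ →
      D.ρ (T A) (h x) ≤ ε → mu A x < m := by
  have := hcomp.exists_pos_of_forall_le (f := fun x => D.ρ (T A) (h x)) (P := fun x => mu A x < m)
    (fun x hx => (hp.continuousWithinAt_ρ hx.1.1 hx.2.1).mono fun y hy => hy.1.1)
    fun x hx h0 => by
      have hxT := (D.ρ_eq_zero_iff hx.2.1).1 (le_antisymm h0 (D.ρ_nonneg hx.2.1))
      have hxA := (hp.mem_iff hA hx.1.1).1 hxT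
      refine nhdsWithin_le_nhds (continuous_mu.continuousAt.eventually (gt_mem_nhds ?_))
      rwa [mu_eq_zero_of_mem_openFace hxA subset_rfl]
  obtain ⟨ε, hε, hh⟩ := this
  exact ⟨ε, hε, fun x h1 h2 h3 => hh x ⟨h1, h2, h3⟩⟩

/-- The cutoff function which is `1` on the truncated simplex with parameters `σ₂` and `0` outside
the one with parameters `σ₁`. -/
theorem exists_cutoff (hδ : ∀ C, 0 < δ C) (h12 : ∀ C, σ₁ C < σ₂ C) (h2η : ∀ C, σ₂ C ≤ η₁ C) :
    ∃ χ : (Fin (n + 1) → ℝ) → ℝ, ContDiff ℝ ∞ χ ∧ (∀ x, 0 ≤ χ x) ∧ (∀ x, χ x ≤ 1) ∧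
      (∀ x ∈ truncated δ σ₂ A, χ x = 1) ∧
      (∀ x ∈ stdSimplex ℝ (Fin (n + 1)), x ∉ truncated δ σ₁ A → χ x = 0) ∧
      ∀ x v, IsAdmissible A (fun C => δ C * η₁ C) x v → ∀ᶠ t in 𝓝 (0 : ℝ), χ (x + t • v) = χ x := by
  classical
  let κ : Finset (Fin (n + 1)) → (Fin (n + 1) → ℝ) → ℝ := fun C x =>
    Real.smoothTransition ((mu C x - δ C * σ₁ C) / (δ C * (σ₂ C - σ₁ C)))
  have hpos : ∀ C, 0 < δ C * (σ₂ C - σ₁ C) := fun C => mul_pos (hδ C) (sub_pos.2 (h12 C))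
  have hκ1 : ∀ C x, δ C * σ₂ C ≤ mu C x → κ C x = 1 := fun C x hx =>
    Real.smoothTransition.one_of_one_le ((one_le_div (hpos C)).2 (by linarith))
  have hκ0 : ∀ C x, mu C x < δ C * σ₁ C → κ C x = 0 := fun C x hx =>
    Real.smoothTransition.zero_of_nonpos
      (div_nonpos_of_nonpos_of_nonneg (by linarith) (hpos C).le)
  let Q : Finset (Finset (Fin (n + 1))) := Finset.univ.filter fun C => C.Nonempty ∧ C ⊂ A
  have hQ : ∀ {C}, C ∈ Q ↔ C.Nonempty ∧ C ⊂ A := by simp [Q]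
  refine ⟨fun x => ∏ C ∈ Q, κ C x, contDiff_prod fun C _ => ?_,
    fun x => Finset.prod_nonneg fun C _ => Real.smoothTransition.nonneg _,
    fun x => Finset.prod_le_one (fun C _ => Real.smoothTransition.nonneg _)
      fun C _ => Real.smoothTransition.le_one _,
    fun x hx => Finset.prod_eq_one fun C hC => hκ1 C x (hx.2 C (hQ.1 hC).1 (hQ.1 hC).2),
    fun x hx hxn => ?_, fun x v hv => ?_⟩
  · refine Real.smoothTransition.contDiff.comp ((ContDiff.sub ?_ contDiff_const).div_const _)
    exact ContDiff.sum fun i _ => contDiff_apply ℝ ℝ i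
  · have : ∃ C, C.Nonempty ∧ C ⊂ A ∧ mu C x < δ C * σ₁ C := by
      by_contra hcon
      push Not at hcon
      exact hxn ⟨hx, hcon⟩
    obtain ⟨C, hC, hCA, hlt⟩ := this
    exact Finset.prod_eq_zero (hQ.2 ⟨hC, hCA⟩) (hκ0 C x hlt)
  -- Along an admissible direction either `μ_C` is constant, or `μ_C` exceeds `δ C * η₁ C ≥ δ C * σ₂
  -- C` and the factor `κ C` is `1` nearby.
  · have : ∀ C ∈ Q, ∀ᶠ t in 𝓝 (0 : ℝ), κ C (x + t • v) = κ C x := by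
      intro C hC
      by_cases hle : mu C x ≤ δ C * η₁ C
      · refine Filter.Eventually.of_forall fun t => ?_
        simp only [κ, mu_add_smul, hv.mu_zero C (hQ.1 hC).1 (hQ.1 hC).2 hle, mul_zero, add_zero]
      · have hlt : δ C * σ₂ C < mu C x :=
          (mul_le_mul_of_nonneg_left (h2η C) (hδ C).le).trans_lt (not_le.1 hle)
        have hc : Continuous fun t : ℝ => mu C (x + t • v) := by
          simp only [mu_add_smul]; fun_prop
        filter_upwards [hc.continuousAt.eventually
          (lt_mem_nhds (show δ C * σ₂ C < mu C (x + (0 : ℝ) • v) by simpa))] with t ht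
        rw [hκ1 C _ ht.le, hκ1 C x hlt.le]
    filter_upwards [(Filter.eventually_all_finset Q).2 this] with t ht
    exact Finset.prod_congr rfl ht

variable [T2Space X]

/-- The distance from the stratum of the face `A` can be made linear in the truncated simplex. -/
theorem exists_straightening (hp : IsFaceParam Z S h T) (hF : IsSmoothExtension I h F W)
    (hA : A.Nonempty) (hst : ∀ C, C.Nonempty → C ⊂ A → IsStraight D h T δ σ η C)
    (hδ : ∀ C, 0 < δ C) (hσ : ∀ C, 0 < σ C) (h01 : ∀ C, σ C < σ₁ C) (h12 : ∀ C, σ₁ C < σ₂ C)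
    (h2η : ∀ C, σ₂ C < η₁ C) (hη : ∀ C, η₁ C < η C)
    (hγ : ∀ y ∈ truncated δ σ₁ A, mu A y = 0 → θ < D.γ (T A) (h y))
    {a b : ℝ} (ha : 0 < a) (hab : a < b) (hbθ : b < θ) :
    ∃ (Φ : (Fin (n + 1) → ℝ) ≃ (Fin (n + 1) → ℝ)) (d : ℝ), 0 < d ∧
      IsInvDiffeo (faceInv A fun C => δ C * η₁ C) (pullbackDomain F W (D.U (T A))) Φ ∧
      ∀ x ∈ truncated δ σ₂ A,
        (∀ t ∈ Icc a b, (h (Φ x) ∈ D.U (T A) ∧ D.ρ (T A) (h (Φ x)) = t) ↔ mu A x = d * t) ∧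
        ((h (Φ x) ∈ D.U (T A) ∧ D.ρ (T A) (h (Φ x)) < a) ↔ mu A x < d * a) := by
  have hσ₁ : ∀ C, 0 < σ₁ C := fun C => (hσ C).trans (h01 C)
  have hst₁ : ∀ C, C.Nonempty → C ⊂ A → IsStraight D h T δ σ₁ η C := fun C hC hCA =>
    (hst C hC hCA).mono hδ (fun C => (h01 C).le) (fun _ => le_rfl)
      (((h12 C).trans (h2η C)).trans (hη C)).le
  have hθ : 0 < θ := ha.trans (hab.trans hbθ)
  have hcomp := isCompact_truncated_tube (D := D) hp hA hst₁ hδ hσ₁ hθ.le hγ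
  -- Thresholds for the distance `ρ` and for `μ` are chosen alternately, from large to small, with
  -- `ez < e₀ < e₂ < θ` and `mz < d * a < d * b < m₁`. On the truncated simplex, and within the tube
  -- where `ρ` is bounded, `ρ ≤ ez` gives `μ < mz`, `μ ≤ mz` gives `ρ < e₀`, `ρ ≤ e₀` gives `μ < d *
  -- a`, `μ ≤ d * b` gives `ρ < e₂`, `ρ ≤ e₂` gives `μ < m₁`, and `μ ≤ m₁` gives `ρ < θ` and radial
  -- growth.
  obtain ⟨mr, hmr, hrad⟩ := exists_radial_range (D := D) hp hF hA hδ hσ₁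
  obtain ⟨mθ, hmθ, hnθ⟩ := exists_near D hp hA hδ hσ₁ hθ
  obtain ⟨m₁, hm₁, hm₁r, hm₁θ⟩ : ∃ m₁ : ℝ, 0 < m₁ ∧ m₁ ≤ mr ∧ m₁ ≤ mθ :=
    ⟨min mr mθ, lt_min hmr hmθ, min_le_left _ _, min_le_right _ _⟩
  obtain ⟨e₂', he₂', hfar₂⟩ := exists_far hp hA hcomp hm₁
  obtain ⟨e₂, he₂, he₂l, he₂θ⟩ : ∃ e₂ : ℝ, 0 < e₂ ∧ e₂ ≤ e₂' ∧ e₂ < θ :=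
    ⟨min e₂' (θ / 2), lt_min he₂' (by linarith), min_le_left _ _,
      (min_le_right _ _).trans_lt (by linarith)⟩
  obtain ⟨m₂', hm₂', hn₂⟩ := exists_near D hp hA hδ hσ₁ he₂
  have hb : 0 < b := ha.trans hab
  obtain ⟨d, hd, hd₂, hd₁⟩ : ∃ d : ℝ, 0 < d ∧ d * b ≤ m₂' ∧ d * b < m₁ := by
    refine ⟨min m₂' (m₁ / 2) / b, div_pos (lt_min hm₂' (by linarith)) hb, ?_, ?_⟩
    · rw [div_mul_cancel₀ _ hb.ne']; exact min_le_left _ _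
    · rw [div_mul_cancel₀ _ hb.ne']; exact (min_le_right _ _).trans_lt (by linarith)
  have hda : 0 < d * a := mul_pos hd ha
  have hdab : d * a < d * b := mul_lt_mul_of_pos_left hab hd
  obtain ⟨e₀', he₀', hfar₀⟩ := exists_far hp hA hcomp hda
  obtain ⟨e₀, he₀, he₀l, he₀₂⟩ : ∃ e₀ : ℝ, 0 < e₀ ∧ e₀ ≤ e₀' ∧ e₀ < e₂ :=
    ⟨min e₀' (e₂ / 2), lt_min he₀' (by linarith), min_le_left _ _,
      (min_le_right _ _).trans_lt (by linarith)⟩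
  obtain ⟨mz', hmz', hnz⟩ := exists_near D hp hA hδ hσ₁ he₀
  obtain ⟨mz, hmz, hmzl, hmza⟩ : ∃ mz : ℝ, 0 < mz ∧ mz ≤ mz' ∧ mz < d * a :=
    ⟨min mz' (d * a / 2), lt_min hmz' (by linarith), min_le_left _ _,
      (min_le_right _ _).trans_lt (by linarith)⟩
  obtain ⟨ez', hez', hfarz⟩ := exists_far hp hA hcomp hmz
  obtain ⟨ez, hez, hezl, heza, hez₀⟩ : ∃ ez : ℝ, 0 < ez ∧ ez ≤ ez' ∧ ez < a ∧ ez < e₀ := by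
    refine ⟨min ez' (min (a / 2) (e₀ / 2)), lt_min hez' (lt_min (by linarith) (by linarith)),
      min_le_left _ _, ?_, ?_⟩
    · exact ((min_le_right _ _).trans (min_le_left _ _)).trans_lt (by linarith)
    · exact ((min_le_right _ _).trans (min_le_right _ _)).trans_lt (by linarith)
  obtain ⟨α, β, α', β', c₀, c₁, αs, βs, αd, βd, αn, βn, αlow, αpos₀, αpos₂, βlow, βpos, αhigh,
    βhigh, αle, αge, βmid, βlt, βgt⟩ :=
    exists_profile hez₀ he₀₂ heza hab hbθ he₂θ hd hmza hd₁
  obtain ⟨χ, χs, χn, χle, χ1, χ0, χv⟩ := exists_cutoff (A := A) hδ h12 fun C => (h2η C).le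
  let O := pullbackDomain F W (D.U (T A))
  have hO : IsOpen O := hF.isOpen_pullbackDomain (D.isOpen_U _)
  let g₀ : (Fin (n + 1) → ℝ) → ℝ := fun x => D.ρ (T A) (F x)
  -- Where `χ = 1`, this is `α (g₀) + β (μ_A)`: it equals `g₀` close to the face and far away, where
  -- the two constants `c₁` cancel. For `μ_A` between `d * a` and `d * b` it is `c₀ + (μ_A / d -
  -- c₀)`.
  let g₁ : (Fin (n + 1) → ℝ) → ℝ := fun x => g₀ x + χ x * (α (g₀ x) + β (mu A x) - g₀ x)
  have hg₀ : ContDiffOn ℝ ∞ g₀ O := hF.contDiffOn_ρ D (T A)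
  have hmu : ContDiff ℝ ∞ (mu A : (Fin (n + 1) → ℝ) → ℝ) :=
    ContDiff.sum fun i _ => contDiff_apply ℝ ℝ i
  have hg₁ : ContDiffOn ℝ ∞ g₁ O :=
    hg₀.add (χs.contDiffOn.mul (((αs.comp_contDiffOn hg₀).add (βs.comp hmu).contDiffOn).sub hg₀))
  have hg₀h : ∀ x ∈ stdSimplex ℝ (Fin (n + 1)), g₀ x = D.ρ (T A) (h x) := fun x hx => by
    simp only [g₀, hF.eqOn hx]
  let Dθ := {x | x ∈ truncated δ σ₁ A ∧ h x ∈ D.U (T A) ∧ D.ρ (T A) (h x) ≤ θ}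
  let N := Dθ ∩ (fun x => D.ρ (T A) (h x)) ⁻¹' Ici ez
  have hN : IsCompact N := by
    refine hcomp.of_isClosed_subset (ContinuousOn.preimage_isClosed_of_isClosed ?_ hcomp.isClosed
      isClosed_Ici) inter_subset_left
    exact fun x hx => (hp.continuousWithinAt_ρ hx.1.1 hx.2.1).mono fun y hy => hy.1.1
  have hNO : N ⊆ O := fun x hx => (hF.mem_pullbackDomain hx.1.1.1).2 hx.1.2.1
  have heq : ∀ x ∈ stdSimplex ℝ (Fin (n + 1)) ∩ O, x ∉ N → g₀ x = g₁ x := by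
    rintro x ⟨hxΔ, hxO⟩ hxN
    have hxU := (hF.mem_pullbackDomain hxΔ).1 hxO
    simp only [g₁]
    by_cases hxt : x ∈ truncated δ σ₁ A
    swap
    · rw [χ0 x hxΔ hxt]; ring
    rcases le_or_gt (D.ρ (T A) (h x)) θ with hle | hlt
    · have hlt : D.ρ (T A) (h x) < ez := by
        by_contra hcon
        exact hxN ⟨⟨hxt, hxU, hle⟩, not_lt.1 hcon⟩
      have hmux := hfarz x hxt hxU hle (hlt.le.trans hezl)
      rw [(βlow _ hmux.le).1, αlow _ (by rw [hg₀h x hxΔ]; exact hlt.le)]; ring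
    · have hmux : m₁ ≤ mu A x := by
        by_contra hcon
        exact absurd (hnθ x hxt ((not_le.1 hcon).le.trans hm₁θ)).2 (not_lt.2 hlt.le)
      rw [(βhigh _ hmux).1, αhigh _ (by rw [hg₀h x hxΔ]; exact hlt.le)]; ring
  have hderiv : ∀ x ∈ O, ∀ v, IsAdmissible A (fun C => δ C * η₁ C) x v →
      fderiv ℝ g₁ x v = (1 - χ x) * fderiv ℝ g₀ x v +
        χ x * (α' (g₀ x) * fderiv ℝ g₀ x v + β' (mu A x) * mu A v) := by
    intro x hx v hv
    have hline : HasDerivAt (fun t : ℝ => x + t • v) v 0 := by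
      simpa using ((hasDerivAt_id (0 : ℝ)).smul_const v).const_add x
    have along : ∀ {g : (Fin (n + 1) → ℝ) → ℝ}, ContDiffOn ℝ ∞ g O →
        HasDerivAt (fun t : ℝ => g (x + t • v)) (fderiv ℝ g x v) 0 := fun {g} hg => by
      have h1 : HasFDerivAt g (fderiv ℝ g x) (x + (0 : ℝ) • v) := by
        simp only [zero_smul, add_zero]
        exact ((hg.contDiffAt (hO.mem_nhds hx)).differentiableAt (by simp)).hasFDerivAt
      exact h1.comp_hasDerivAt (0 : ℝ) hline
    have d0 := along hg₀
    have dα : HasDerivAt (fun t : ℝ => α (g₀ (x + t • v))) (α' (g₀ x) * fderiv ℝ g₀ x v) 0 := by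
      have h1 : HasDerivAt α (α' (g₀ x)) (g₀ (x + (0 : ℝ) • v)) := by simpa using αd (g₀ x)
      exact h1.comp (0 : ℝ) d0
    have dβ : HasDerivAt (fun t : ℝ => β (mu A (x + t • v))) (β' (mu A x) * mu A v) 0 := by
      have h2 : HasDerivAt (fun t : ℝ => mu A (x + t • v)) (mu A v) 0 := by
        simp only [mu_add_smul]
        simpa using ((hasDerivAt_id (0 : ℝ)).mul_const (mu A v)).const_add (mu A x)
      have h1 : HasDerivAt β (β' (mu A x)) (mu A (x + (0 : ℝ) • v)) := by simpa using βd (mu A x)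
      exact h1.comp (0 : ℝ) h2
    have dtot := d0.add (((dα.add dβ).sub d0).const_mul (χ x))
    have e := (along hg₁).unique (dtot.congr_of_eventuallyEq (by
      filter_upwards [χv x v hv] with t ht
      simp only [g₁, ht, Pi.add_apply, Pi.sub_apply]))
    rw [e]; ring
  have hdir : ∀ x ∈ N, ∃ v, 0 < fderiv ℝ g₀ x v ∧ 0 < fderiv ℝ g₁ x v ∧
      ∃ V ∈ 𝓝 x, ∀ y ∈ V, ∀ s : ℝ, y + s • v ∈ V →
        faceInv A (fun C => δ C * η₁ C) (y + s • v) = faceInv A (fun C => δ C * η₁ C) y := by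
    intro x hx
    have hxt := hx.1.1
    have hxU := hx.1.2.1
    have hne : mu A x ≠ 0 := fun h0 => by
      have hxA := mem_openFace_of_truncated hδ hσ₁ hxt h0
      have h1 := (D.ρ_eq_zero_iff hxU).2 ((hp.mem_iff hA hxt.1).2 hxA)
      have h2 : ez ≤ D.ρ (T A) (h x) := hx.2
      linarith
    suffices hv : ∃ v, IsAdmissible A (fun C => δ C * η₁ C) x v ∧ 0 < fderiv ℝ g₀ x v ∧
        0 < α' (g₀ x) * fderiv ℝ g₀ x v + β' (mu A x) * mu A v by
      obtain ⟨v, hv, h1, h2⟩ := hv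
      refine ⟨v, h1, ?_, hv.exists_nhds hxt.1⟩
      rw [hderiv x (hNO hx) v hv]
      rcases (χn x).eq_or_lt' with h0 | h0
      · rw [h0]; linarith
      · exact add_pos_of_nonneg_of_pos (mul_nonneg (sub_nonneg.2 (χle x)) h1.le) (mul_pos h0 h2)
    -- In the middle range `α` may be constant, but `β` increases with `μ_A` and a radial direction
    -- is used. For `μ_A ≤ mz` the distance is below `e₀`, and for `μ_A ≥ m₁` it is above `e₂`; in
    -- both cases `β` is stationary, `α` increases, and any admissible direction increasing the
    -- distance serves.
    by_cases hmid : mz < mu A x ∧ mu A x < m₁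
    · obtain ⟨v, hv, h1, h2⟩ := exists_admissible_radial hp hA hst hδ h01 hη hxt hne
        (hrad x hxt (hmid.2.le.trans hm₁r) hne)
      exact ⟨v, hv, h1, add_pos_of_nonneg_of_pos (mul_nonneg (αn _) h1.le)
        (mul_pos (βpos _ hmid) h2)⟩
    · obtain ⟨v, hv, h1⟩ := exists_admissible hp hF hA hst hδ h01 hη hxt hxU hne
      refine ⟨v, hv, h1, ?_⟩
      rcases le_or_gt (mu A x) mz with hle | hgt
      · rw [(βlow _ hle).2, zero_mul, add_zero]
        refine mul_pos (αpos₀ _ ?_) h1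
        rw [hg₀h x hxt.1]
        exact (hnz x hxt (hle.trans hmzl)).2
      · have hge : m₁ ≤ mu A x := not_lt.1 fun hlt => hmid ⟨hgt, hlt⟩
        rw [(βhigh _ hge).2, zero_mul, add_zero]
        refine mul_pos (αpos₂ _ ?_) h1
        rw [hg₀h x hxt.1]
        by_contra hcon
        exact absurd (hfar₂ x hxt hxU hx.1.2.2 ((not_lt.1 hcon).trans he₂l)) (not_lt.2 hge)
  obtain ⟨Φ, hΦ, hΦg⟩ := exists_isotopy (faceInv A fun C => δ C * η₁ C)
    (Q := stdSimplex ℝ (Fin (n + 1))) (fun x y e hx => mem_stdSimplex_of_faceInv e hx) hO hN hNO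
    hg₀ hg₁ heq hdir
  refine ⟨Φ, d, hd, hΦ, fun x hx => ?_⟩
  have hx₁ : x ∈ truncated δ σ₁ A := truncated_anti hδ (fun C => (h12 C).le) hx
  have hyΔ : Φ x ∈ stdSimplex ℝ (Fin (n + 1)) :=
    mem_stdSimplex_of_faceInv (hΦ.inv_eq x).symm hx.1
  have hUiff : h (Φ x) ∈ D.U (T A) ↔ h x ∈ D.U (T A) := by
    rw [← hF.mem_pullbackDomain hyΔ, ← hF.mem_pullbackDomain hx.1]
    refine ⟨fun hy => ?_, hΦ.mem⟩
    by_contra hxO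
    rw [hΦ.fix x hxO] at hy
    exact hxO hy
  have hval : h x ∈ D.U (T A) →
      D.ρ (T A) (h (Φ x)) = α (D.ρ (T A) (h x)) + β (mu A x) := fun hxU => by
    have := hΦg x ⟨hx.1, (hF.mem_pullbackDomain hx.1).2 hxU⟩
    rw [hg₀h _ hyΔ] at this
    rw [this]
    simp only [g₁, χ1 x hx, hg₀h x hx.1]
    ring
  have hnear : mu A x ≤ d * b → h x ∈ D.U (T A) ∧ D.ρ (T A) (h x) < e₂ := fun hle =>
    hn₂ x hx₁ (hle.trans hd₂)
  have hfar : h x ∈ D.U (T A) → d * a ≤ mu A x → e₀ ≤ D.ρ (T A) (h x) := fun hxU hle => by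
    by_contra hcon
    have hlt := not_le.1 hcon
    exact absurd (hfar₀ x hx₁ hxU (by linarith) (hlt.le.trans he₀l)) (not_lt.2 hle)
  have v1 : d * a ≤ mu A x → mu A x ≤ d * b →
      h x ∈ D.U (T A) ∧ D.ρ (T A) (h (Φ x)) = mu A x / d := fun h1 h2 => by
    obtain ⟨hxU, hlt⟩ := hnear h2
    refine ⟨hxU, ?_⟩
    have := hfar hxU h1
    rw [hval hxU, βmid _ ⟨h1, h2⟩, le_antisymm (αle _ hlt.le) (αge _ this)]
    ring
  have v2 : mu A x < d * a → h x ∈ D.U (T A) ∧ D.ρ (T A) (h (Φ x)) < a := fun h1 => by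
    obtain ⟨hxU, hlt⟩ := hnear (h1.trans hdab).le
    refine ⟨hxU, ?_⟩
    rw [hval hxU]
    linarith [αle _ hlt.le, βlt _ h1]
  have v3 : d * b < mu A x → h x ∈ D.U (T A) → b < D.ρ (T A) (h (Φ x)) := fun h1 hxU => by
    rw [hval hxU]
    linarith [αge _ (hfar hxU (hdab.trans h1).le), βgt _ h1]
  rw [hUiff]
  refine ⟨fun t ht => ⟨fun hxt => ?_, fun he => ?_⟩, fun hxt => ?_, fun hlt => v2 hlt⟩
  · rcases lt_or_ge (mu A x) (d * a) with h1 | h1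
    · have := (v2 h1).2
      linarith [ht.1, hxt.2]
    rcases lt_or_ge (d * b) (mu A x) with h2 | h2
    · have := v3 h2 hxt.1
      linarith [ht.2, hxt.2]
    · rw [← hxt.2, (v1 h1 h2).2, mul_div_cancel₀ _ hd.ne']
  · have h1 : d * a ≤ mu A x := he ▸ mul_le_mul_of_nonneg_left ht.1 hd.le
    have h2 : mu A x ≤ d * b := he ▸ mul_le_mul_of_nonneg_left ht.2 hd.le
    refine ⟨(v1 h1 h2).1, ?_⟩
    rw [(v1 h1 h2).2, he, mul_div_cancel_left₀ _ hd.ne']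
  · by_contra hcon
    rw [not_lt] at hcon
    rcases lt_or_ge (d * b) (mu A x) with h2 | h2
    · have := v3 h2 hxt.1
      linarith [hxt.2]
    · have := (v1 hcon h2).2
      rw [this, div_lt_iff₀ hd] at hxt
      linarith [hxt.2]

end Step

/-! ### Induction over the faces -/

section Induction

variable {E : Type*} [NormedAddCommGroup E] [NormedSpace ℝ E]
  {H : Type*} [TopologicalSpace H] {I : ModelWithCorners ℝ E H}
  {X : Type*} [TopologicalSpace X] [ChartedSpace H X]
  {ι : Type*} {Z : StratifiedSubset I X ι} {S : ι} {n : ℕ}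
  {h F : (Fin (n + 1) → ℝ) → X} {T : Finset (Fin (n + 1)) → ι}
  {W : Set (Fin (n + 1) → ℝ)} {δ δ' σ σ' η η₁ τ τ' b : Finset (Fin (n + 1)) → ℝ}
  {A C : Finset (Fin (n + 1))} {x y : Fin (n + 1) → ℝ}

theorem mu_lt_iff_of_faceInv (e : faceInv A b x = faceInv A b y) (hC : C.Nonempty) (hCA : C ⊂ A)
    {s : ℝ} (hs : s ≤ b C) : mu C x < s ↔ mu C y < s := by
  have h1 : ∀ u : ℝ, u < s ↔ min u (b C) < s := fun u => by
    rw [min_lt_iff, or_iff_left (not_lt.2 hs)]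
  rw [h1, h1 (mu C y), faceInv_min e hC hCA]

theorem mu_eq_iff_of_faceInv (e : faceInv A b x = faceInv A b y) (hC : C.Nonempty) (hCA : C ⊂ A)
    {s : ℝ} (hs : s < b C) : mu C x = s ↔ mu C y = s := by
  have h1 : ∀ u : ℝ, u = s ↔ min u (b C) = s := fun u => by
    constructor
    · rintro rfl
      exact min_eq_left hs.le
    · intro hu
      rcases min_choice u (b C) with h | h
      · rw [← h, hu]
      · exact absurd (h.symm.trans hu) hs.ne'
  rw [h1, h1 (mu C y), faceInv_min e hC hCA]

theorem truncated_congr (h : ∀ C, C.Nonempty → C ⊂ A → δ' C * σ' C = δ C * σ C) :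
    truncated δ' σ' A = truncated δ σ A := by
  ext x
  refine and_congr_right fun _ => forall_congr' fun C => forall_congr' fun hC =>
    forall_congr' fun hCA => ?_
  rw [h C hC hCA]

theorem IsFaceParam.comp_faceInv {O : Set (Fin (n + 1) → ℝ)}
    {Φ : (Fin (n + 1) → ℝ) ≃ (Fin (n + 1) → ℝ)} (hp : IsFaceParam Z S h T)
    (hΦ : IsInvDiffeo (faceInv A b) O Φ) : IsFaceParam Z S (h ∘ Φ) T :=
  hp.comp hΦ.smooth hΦ.smooth_symm
    (fun x => ⟨mem_stdSimplex_of_faceInv (hΦ.inv_eq x),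
      mem_stdSimplex_of_faceInv (hΦ.inv_eq x).symm⟩)
    fun _ x => ⟨mem_openFace_of_faceInv (hΦ.inv_eq x), mem_openFace_of_faceInv (hΦ.inv_eq x).symm⟩

variable {D : TubularData Z}

/-- The diffeomorphism preserves `μ_C` capped at `δ C * η₁ C`, and all levels of `μ_C` occurring in
the statement lie below the cap. -/
theorem IsStraight.comp_of_ssubset {O : Set (Fin (n + 1) → ℝ)}
    {Φ : (Fin (n + 1) → ℝ) ≃ (Fin (n + 1) → ℝ)} (hst : IsStraight D h T δ σ η C)
    (hδ : ∀ C, 0 < δ C) (hΦ : IsInvDiffeo (faceInv A fun C => δ C * η₁ C) O Φ)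
    (hC : C.Nonempty) (hCA : C ⊂ A) (hσ : ∀ C, σ C ≤ η₁ C) (hη : ∀ C, η C < η₁ C) :
    IsStraight D (h ∘ Φ) T δ σ η C := by
  intro x hx
  have hle : ∀ C, δ C * σ C ≤ δ C * η₁ C := fun C => mul_le_mul_of_nonneg_left (hσ C) (hδ C).le
  have hy : Φ x ∈ truncated δ σ C :=
    ⟨mem_stdSimplex_of_faceInv (hΦ.inv_eq x).symm hx.1, fun B hB hBC => by
      rw [← not_lt, mu_lt_iff_of_faceInv (hΦ.inv_eq x) hB (hBC.trans hCA) (hle B), not_lt]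
      exact hx.2 B hB hBC⟩
  obtain ⟨h1, h2⟩ := hst _ hy
  refine ⟨fun t ht => (h1 t ht).trans (mu_eq_iff_of_faceInv (hΦ.inv_eq x) hC hCA ?_),
    h2.trans (mu_lt_iff_of_faceInv (hΦ.inv_eq x) hC hCA (hle C))⟩
  exact mul_lt_mul_of_pos_left (ht.2.trans_lt (hη C)) (hδ C)

variable [T2Space X]

/-- The diffeomorphism moves only points in the tube of `T A`, which is disjoint from that of `T C`.
For a moved point both descriptions by `ρ` are false before and after, so the statement at `x`
carries over. -/
theorem IsStraight.comp_of_incomparable {Y : Type*} {inv : (Fin (n + 1) → ℝ) → Y}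
    {Φ : (Fin (n + 1) → ℝ) ≃ (Fin (n + 1) → ℝ)} (hp : IsFaceParam Z S h T)
    (hF : IsSmoothExtension I h F W) (hst : IsStraight D h T δ σ η C)
    (hΦ : IsInvDiffeo inv (pullbackDomain F W (D.U (T A))) Φ)
    (hΔ : ∀ x ∈ stdSimplex ℝ (Fin (n + 1)), Φ x ∈ stdSimplex ℝ (Fin (n + 1)))
    (hA : A.Nonempty) (hC : C.Nonempty) (hAC : ¬A ⊆ C) (hCA : ¬C ⊆ A) :
    IsStraight D (h ∘ Φ) T δ σ η C := by
  intro x hx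
  by_cases hxO : x ∈ pullbackDomain F W (D.U (T A))
  · have hno : ∀ z, z ∈ D.U (T A) → z ∉ D.U (T C) := fun z hzA hzC => by
      rcases hp.comparable D hA hC hzA hzC with h | h | h
      exacts [hAC h.subset, hCA h.subset, hAC h.subset]
    have h1 := hno _ ((hF.mem_pullbackDomain hx.1).1 hxO)
    have h2 := hno _ ((hF.mem_pullbackDomain (hΔ x hx.1)).1 (hΦ.mem hxO))
    have h3 := hst x hx
    simp only [h1, false_and, false_iff] at h3
    simpa only [Function.comp_apply, h2, false_and, false_iff] using h3
  · simpa only [Function.comp_apply, hΦ.fix x hxO] using hst x hx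

/-- Straightening the distance function of one more face. -/
theorem exists_straight_insert {𝒜 : Finset (Finset (Fin (n + 1)))} (hp : IsFaceParam Z S h T)
    (h𝒜 : ∀ C ∈ 𝒜, C.Nonempty) (hA : A.Nonempty) (hlow : ∀ C, C.Nonempty → C ⊂ A → C ∈ 𝒜)
    (hup : ∀ C ∈ 𝒜, ¬A ⊆ C) (hδ : ∀ C, 0 < δ C) (hσ : ∀ C, 0 < σ C) (hστ : ∀ C, σ C < τ' C)
    (hτ : ∀ C, τ' C < τ C) (hη : ∀ C, τ C < η C) (hst : ∀ C ∈ 𝒜, IsStraight D h T δ σ η C)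
    (hγ : ∀ z ∈ Z.stratum (T A), (∀ C, C.Nonempty → C ⊂ A →
      ¬(z ∈ D.U (T C) ∧ D.ρ (T C) z < τ' C)) → τ A < D.γ (T A) z) :
    ∃ (g : (Fin (n + 1) → ℝ) → X) (δ' σ' η' : Finset (Fin (n + 1)) → ℝ), IsFaceParam Z S g T ∧
      (∀ C, 0 < δ' C) ∧ (∀ C, 0 < σ' C) ∧ (∀ C, σ' C < τ' C) ∧ (∀ C, τ C < η' C) ∧
      ∀ C, C = A ∨ C ∈ 𝒜 → IsStraight D g T δ' σ' η' C := by
  classical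
  have hstA : ∀ C, C.Nonempty → C ⊂ A → IsStraight D h T δ σ η C := fun C hC hCA =>
    hst C (hlow C hC hCA)
  obtain ⟨σ₁, θ, h01, h1τ, hrθ, hγθ⟩ := exists_threshold hp hA hstA hδ hσ hστ
    (fun C => ((hτ C).trans (hη C)).le) hγ
  obtain ⟨F, W, hF⟩ := hp.exists_extension
  -- Room is inserted between all thresholds: `σ < σ₁ < σ₂ < τ'` below and `τ < η₂ < η₁ < η` above.
  -- The new data use `σ₂` and `η₂`, while `η₁` gives the cap in the invariant.
  choose σ₂ h12 h2τ using fun C => exists_between (h1τ C)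
  choose η₁ hτ1 h1η using fun C => exists_between (hη C)
  choose η₂ hτ2 h21 using fun C => exists_between (hτ1 C)
  obtain ⟨c, hτc, hcθ⟩ := exists_between hrθ
  have hσ₂ : ∀ C, 0 < σ₂ C := fun C => ((hσ C).trans (h01 C)).trans (h12 C)
  have hσ₂τ : ∀ C, σ₂ C < τ C := fun C => (h2τ C).trans (hτ C)
  obtain ⟨Φ, d, hd, hΦ, hΦA⟩ := exists_straightening hp hF hA hstA hδ hσ h01 h12
    (fun C => (hσ₂τ C).trans (hτ1 C)) h1η hγθ (hσ₂ A) ((hσ₂τ A).trans hτc) hcθ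
  have hst₂ : ∀ C ∈ 𝒜, IsStraight D h T δ σ₂ η₂ C := fun C hC =>
    (hst C hC).mono hδ (fun C => ((h01 C).trans (h12 C)).le)
      (fun C => ((h21 C).trans (h1η C)).le) ((hσ₂τ C).trans (hη C)).le
  refine ⟨h ∘ Φ, Function.update δ A d, σ₂, Function.update η₂ A c, hp.comp_faceInv hΦ,
    fun C => ?_, hσ₂, h2τ, fun C => ?_, fun C hC => ?_⟩
  · rcases eq_or_ne C A with rfl | hCA
    · simpa using hd
    · simpa [hCA] using hδ C
  · rcases eq_or_ne C A with rfl | hCA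
    · simpa using hτc
    · simpa [hCA] using hτ2 C
  -- Changing `δ` at `A` affects only truncations for faces strictly containing `A`, and none of
  -- these has been straightened yet.
  have htr : ¬A ⊂ C → truncated (Function.update δ A d) σ₂ C = truncated δ σ₂ C := fun hAC =>
    truncated_congr fun B _ hBC => by
      rw [Function.update_of_ne]
      rintro rfl
      exact hAC hBC
  rcases eq_or_ne C A with rfl | hCA
  · intro x hx
    rw [htr (ssubset_irrefl C)] at hx
    simpa only [Function.update_self, Function.comp_apply] using hΦA x hx
  · have hC𝒜 := hC.resolve_left hCA
    have hCne := h𝒜 C hC𝒜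
    have key : IsStraight D (h ∘ Φ) T δ σ₂ η₂ C := by
      by_cases hsub : C ⊆ A
      · exact (hst₂ C hC𝒜).comp_of_ssubset hδ hΦ hCne (hsub.ssubset_of_ne hCA)
          (fun C => ((hσ₂τ C).trans (hτ1 C)).le) h21
      · exact (hst₂ C hC𝒜).comp_of_incomparable hp hF hΦ
          (fun x hx => mem_stdSimplex_of_faceInv (hΦ.inv_eq x).symm hx) hA hCne (hup C hC𝒜) hsub
    intro x hx
    rw [htr fun hAC => hup C hC𝒜 hAC.subset] at hx
    simpa only [Function.update_of_ne hCA] using key x hx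

/-- Induction on a family closed under passing to smaller faces. A member of maximal cardinality is
removed and straightened last: all its proper subfaces are then done, and no other member contains
it. -/
theorem exists_straight_family (hp : IsFaceParam Z S h T) (hτ' : ∀ C, 0 < τ' C)
    (hτ : ∀ C, τ' C < τ C)
    (hγ : ∀ A : Finset (Fin (n + 1)), A.Nonempty → A ≠ Finset.univ → ∀ z ∈ Z.stratum (T A),
      (∀ C, C.Nonempty → C ⊂ A → ¬(z ∈ D.U (T C) ∧ D.ρ (T C) z < τ' C)) → τ A < D.γ (T A) z)
    (𝒜 : Finset (Finset (Fin (n + 1)))) (h𝒜 : ∀ A ∈ 𝒜, A.Nonempty ∧ A ≠ Finset.univ)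
    (hlow : ∀ A ∈ 𝒜, ∀ C : Finset (Fin (n + 1)), C.Nonempty → C ⊂ A → C ∈ 𝒜) :
    ∃ (g : (Fin (n + 1) → ℝ) → X) (δ σ η : Finset (Fin (n + 1)) → ℝ), IsFaceParam Z S g T ∧
      (∀ C, 0 < δ C) ∧ (∀ C, 0 < σ C) ∧ (∀ C, σ C < τ' C) ∧ (∀ C, τ C < η C) ∧
      ∀ C ∈ 𝒜, IsStraight D g T δ σ η C := by
  classical
  induction 𝒜 using Finset.strongInduction with
  | H 𝒜 ih =>
    rcases 𝒜.eq_empty_or_nonempty with rfl | hne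
    · exact ⟨h, fun _ => 1, fun C => τ' C / 2, fun C => τ C + 1, hp, fun _ => one_pos,
        fun C => half_pos (hτ' C), fun C => half_lt_self (hτ' C), fun C => lt_add_one _,
        fun C hC => absurd hC (Finset.notMem_empty C)⟩
    · obtain ⟨A, hA, hmax⟩ := 𝒜.exists_max_image Finset.card hne
      obtain ⟨g, δ, σ, η, hg, hδ, hσ, hστ, hη, hst⟩ := ih (𝒜.erase A) (Finset.erase_ssubset hA)
        (fun B hB => h𝒜 B (Finset.mem_of_mem_erase hB)) fun B hB C hC hCB =>
          Finset.mem_erase.2 ⟨by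
            rintro rfl
            exact absurd (Finset.card_lt_card hCB)
              (not_lt.2 (hmax B (Finset.mem_of_mem_erase hB))),
            hlow B (Finset.mem_of_mem_erase hB) C hC hCB⟩
      obtain ⟨g', δ', σ', η', hg', hδ', hσ', hστ', hη', hst'⟩ := exists_straight_insert
        (𝒜 := 𝒜.erase A) hg (fun C hC => (h𝒜 C (Finset.mem_of_mem_erase hC)).1) (h𝒜 A hA).1
        (fun C hC hCA => Finset.mem_erase.2 ⟨hCA.ne, hlow A hA C hC hCA⟩)
        (fun C hC hAC => (Finset.mem_erase.1 hC).1 (Finset.eq_of_subset_of_card_le hAC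
          (hmax C (Finset.mem_of_mem_erase hC))).symm)
        hδ hσ hστ hτ hη hst (hγ A (h𝒜 A hA).1 (h𝒜 A hA).2)
      refine ⟨g', δ', σ', η', hg', hδ', hσ', hστ', hη', fun C hC => hst' C ?_⟩
      by_cases hCA : C = A
      · exact Or.inl hCA
      · exact Or.inr (Finset.mem_erase.2 ⟨hCA, hC⟩)

end Induction

/-! ### Consequences of admissibility of the parameters -/

section Parameters

variable {E : Type*} [NormedAddCommGroup E] [NormedSpace ℝ E] [FiniteDimensional ℝ E]
  {H : Type*} [TopologicalSpace H] {I : ModelWithCorners ℝ E H}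
  {X : Type*} [TopologicalSpace X] [ChartedSpace H X]
  {ι : Type*} {Z : StratifiedSubset I X ι} {S : ι} {D : TubularData Z} {n : ℕ}
  {h : (Fin (n + 1) → ℝ) → X} {T : Finset (Fin (n + 1)) → ι} {τ : ι → ℝ} {τ' : ι → ℕ → ℝ}

theorem StratifiedSubset.dim_le_finrank {R : ι} (hne : (Z.stratum R).Nonempty) :
    Z.dim R ≤ Module.finrank ℝ E := by
  obtain ⟨z, hz⟩ := hne
  obtain ⟨-, -, -, -, L, hL, -⟩ := Z.isSubmanifold R z hz
  exact hL ▸ L.finrank_le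

/-- The uniform bound by the dimension of the model space matters: a supremum of an unbounded set of
natural numbers would be `0`. -/
theorem StratifiedSubset.dim_le_dimZ (hne : ∀ R, (Z.stratum R).Nonempty) (R : ι) :
    Z.dim R ≤ Z.dimZ :=
  le_csSup ⟨Module.finrank ℝ E, by rintro _ ⟨Q, rfl⟩; exact Z.dim_le_finrank (hne Q)⟩ ⟨R, rfl⟩

theorem TubularData.Admissible.dim_lt (hτ : D.Admissible τ τ')
    (hne : ∀ R, (Z.stratum R).Nonempty) (R : ι) : τ' R (Z.dim R) < τ R := by
  refine lt_of_le_of_lt ?_ (hτ.lt R)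
  have : ∀ i, Z.dim R ≤ i → i ≤ Z.dimZ → τ' R (Z.dim R) ≤ τ' R i := fun i hi => by
    induction i, hi using Nat.le_induction with
    | base => exact fun _ => le_rfl
    | succ i hi ih => exact fun hle => (ih (by omega)).trans (hτ.lt_succ R i hi (by omega)).le
  exact this _ (Z.dim_le_dimZ hne R) le_rfl

-- Since `R` lies below another stratum, its normal fibre is nonzero and contains a vector of
-- squared norm exactly `τ R`. The disc condition places it in the image of `ν_R`, where squared
-- norms are less than `γ_R`.
omit [FiniteDimensional ℝ E] in
theorem TubularData.Admissible.lt_γ (hτ : D.Admissible τ τ') {Q R : ι} (hQR : Z.Prec R Q)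
    (hpos : 0 ≤ τ R) {z : X} (hz : z ∈ D.core τ' R) : τ R < D.γ R z := by
  have := D.nontrivial_fibre hQR ⟨z, hz.1⟩
  obtain ⟨y, hy⟩ := exists_norm_eq
    (EuclideanSpace ℝ (Fin (Module.finrank ℝ E - Z.dim R))) (Real.sqrt_nonneg (τ R))
  have hy2 : ‖y‖ ^ 2 = τ R := by rw [hy, Real.sq_sqrt hpos]
  obtain ⟨w, hw, e⟩ := hτ.disc R z hz y hy2.le
  have := ((D.ν_diffeo R).1.mapsTo hw).2
  rwa [e, hy2] at this

omit [FiniteDimensional ℝ E] in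
theorem TubularData.mem_core {R : ι} {z : X} :
    z ∈ D.core τ' R ↔ z ∈ Z.stratum R ∧
      ∀ Q, Z.Prec Q R → ¬(z ∈ D.U Q ∧ D.ρ Q z < τ' Q (Z.dim Q)) := by
  simp only [TubularData.core, mem_sdiff, mem_iUnion, mem_ofPred_eq, not_exists, mem_Ico]
  refine and_congr_right fun _ => forall_congr' fun Q => forall_congr' fun _ => not_congr ?_
  exact and_congr_right fun hU => and_iff_right (D.ρ_nonneg hU)

variable [T2Space X]

omit [FiniteDimensional ℝ E] in
theorem IsFaceParam.mem_core_iff (hp : IsFaceParam Z S h T) (hne : ∀ R, (Z.stratum R).Nonempty)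
    {A : Finset (Fin (n + 1))} (hA : A.Nonempty) (hSA : Z.stratum (T A) ⊆ closure (Z.stratum S))
    {z : X} : z ∈ D.core τ' (T A) ↔ z ∈ Z.stratum (T A) ∧ ∀ C, C.Nonempty → C ⊂ A →
      ¬(z ∈ D.U (T C) ∧ D.ρ (T C) z < τ' (T C) (Z.dim (T C))) := by
  rw [TubularData.mem_core]
  refine and_congr_right fun _ => ⟨fun hall C hC hCA => hall _ ((hp.prec_iff hC hA).2 hCA),
    fun hall Q hQ => ?_⟩
  obtain ⟨C, hC, rfl⟩ := hp.exists_eq_T (hne Q)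
    (hQ.2.trans (closure_minimal hSA isClosed_closure))
  exact hall C hC ((hp.prec_iff hC hA).1 hQ)

end Parameters

end SimplicialStrat

end

/-! ### Proof of the lemma -/

theorem mainTheorem9
    {E : Type*} [NormedAddCommGroup E] [NormedSpace ℝ E] [FiniteDimensional ℝ E]
    {H : Type*} [TopologicalSpace H] {I : ModelWithCorners ℝ E H}
    {X : Type*} [TopologicalSpace X] [T2Space X] [SecondCountableTopology X]
    [ChartedSpace H X] [IsManifold I ∞ X]
    {ι : Type*} (Z : SimplicialStrat.StratifiedSubset I X ι) (hZ : Z.IsSimplicial)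
    (D : SimplicialStrat.TubularData Z)
    (τ : ι → ℝ) (τ' : ι → ℕ → ℝ) (hτ : D.Admissible τ τ') (S : ι) :
    ∃ h : (Fin (Z.dim S + 1) → ℝ) → X, Z.IsParameterization S h ∧
      -- level sets of `ρ_T` pull back into level sets of `μ_{A_{T,h}}`
      (∀ T, Z.Prec T S → ∀ t ∈ Icc (τ' T (Z.dim T)) (τ T), ∃ s : ℝ,
        {x | x ∈ stdSimplex ℝ (Fin (Z.dim S + 1)) ∧
          h x ∈ D.core τ' S ∧ h x ∈ D.U T ∧ D.ρ T (h x) = t} ⊆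
        {x | x ∈ stdSimplex ℝ (Fin (Z.dim S + 1)) ∧
          SimplicialStrat.mu (Z.faceVertices T h) x = s}) ∧
      ∃ δ : ι → ℝ, (∀ T, Z.Prec T S → 0 < δ T) ∧
        ∃ Δ' : Set (Fin (Z.dim S + 1) → ℝ),
          Δ' = stdSimplex ℝ (Fin (Z.dim S + 1)) \ ⋃ T ∈ {T | Z.Prec T S},
            {x | SimplicialStrat.mu (Z.faceVertices T h) x ∈ Ico 0 (δ T * τ' T (Z.dim T))} ∧
          {x | x ∈ stdSimplex ℝ (Fin (Z.dim S + 1)) ∧ h x ∈ D.core τ' S} = Δ' ∧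
          (∀ T, Z.Prec T S → ∀ t ∈ Icc (τ' T (Z.dim T)) (τ T),
            {x | x ∈ stdSimplex ℝ (Fin (Z.dim S + 1)) ∧
              h x ∈ D.core τ' S ∧ h x ∈ D.U T ∧ D.ρ T (h x) = t} =
            {x | x ∈ Δ' ∧ SimplicialStrat.mu (Z.faceVertices T h) x = t * δ T}) ∧
          -- in particular `Δ'` is a polyhedron cut out by finitely many half-spaces
          {T | Z.Prec T S}.Finite ∧
          Δ' = {x | x ∈ stdSimplex ℝ (Fin (Z.dim S + 1)) ∧ ∀ T, Z.Prec T S →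
            δ T * τ' T (Z.dim T) ≤ SimplicialStrat.mu (Z.faceVertices T h) x} := by
  have hne := hZ.stratum_nonempty
  have hpos : ∀ R, 0 < τ' R (Z.dim R) := hτ.pos
  have hlt := hτ.dim_lt hne
  obtain ⟨h₀, hh₀⟩ := hZ S
  obtain ⟨T, hp₀⟩ := hh₀.exists_isFaceParam
  have hsub : ∀ {A : Finset (Fin (Z.dim S + 1))}, A.Nonempty →
      Z.stratum (T A) ⊆ closure (Z.stratum S) := fun hA => by
    rw [← hp₀.image _ hA, ← hp₀.diffeo.1.image_eq]
    exact image_mono SimplicialStrat.openFace_subset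
  obtain ⟨h, δ, σ, η, hp, hδ, hσ, hστ, hη, hst⟩ :=
    SimplicialStrat.exists_straight_family (D := D) (τ := fun A => τ (T A))
      (τ' := fun A => τ' (T A) (Z.dim (T A))) hp₀ (fun _ => hpos _) (fun _ => hlt _)
      (fun A hA hAu z hz hall => hτ.lt_γ ((hp₀.prec_S_iff hne).2 ⟨A, hA, hAu, rfl⟩)
        ((hpos _).trans (hlt _)).le ((hp₀.mem_core_iff hne hA (hsub hA)).2 ⟨hz, hall⟩))
      (Finset.univ.filter fun A => A.Nonempty ∧ A ≠ Finset.univ)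
      (fun A hA => (Finset.mem_filter.1 hA).2)
      fun A hA C hC hCA => Finset.mem_filter.2 ⟨Finset.mem_univ _, hC, by
        rintro rfl
        exact hCA.2 (Finset.subset_univ A)⟩
  -- The construction gives linearity on a strictly larger range of values; it is restricted here to
  -- the prescribed interval.
  have hst' : ∀ A : Finset (Fin (Z.dim S + 1)), A.Nonempty → A ⊂ Finset.univ →
      SimplicialStrat.IsStraight D h T δ (fun A => τ' (T A) (Z.dim (T A)))
        (fun A => τ (T A)) A := fun A hA hAu =>
    (hst A (Finset.mem_filter.2 ⟨Finset.mem_univ _, hA, hAu.ne⟩)).mono hδ (fun C => (hστ C).le)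
      (fun C => (hη C).le) ((hlt _).trans (hη A)).le
  let δ' : ι → ℝ := fun R => δ (Z.faceVertices R h)
  have hprec : ∀ {R}, Z.Prec R S ↔ ∃ A : Finset (Fin (Z.dim S + 1)), A.Nonempty ∧
      A ⊂ Finset.univ ∧ R = T A := by
    intro R
    simp only [Finset.ssubset_univ_iff]
    exact hp.prec_S_iff hne
  have hpoly : ∀ x, x ∈ SimplicialStrat.truncated δ (fun A => τ' (T A) (Z.dim (T A))) Finset.univ ↔
      x ∈ stdSimplex ℝ (Fin (Z.dim S + 1)) ∧ ∀ R, Z.Prec R S →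
        δ' R * τ' R (Z.dim R) ≤ SimplicialStrat.mu (Z.faceVertices R h) x := by
    refine fun x => and_congr_right fun _ => ⟨fun hx R hR => ?_, fun hx A hA hAu => ?_⟩
    · obtain ⟨A, hA, hAu, rfl⟩ := hprec.1 hR
      simp only [δ', hp.faceVertices_eq hA]
      exact hx A hA hAu
    · simpa only [δ', hp.faceVertices_eq hA] using hx (T A) (hprec.2 ⟨A, hA, hAu, rfl⟩)
  have hcore : ∀ x ∈ stdSimplex ℝ (Fin (Z.dim S + 1)), h x ∈ D.core τ' S ↔
      x ∈ SimplicialStrat.truncated δ (fun A => τ' (T A) (Z.dim (T A))) Finset.univ := by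
    intro x hx
    have hS := hp.T_univ (hne S)
    have e := hp.mem_core_iff (D := D) (τ' := τ') (z := h x) hne Finset.univ_nonempty
      (hsub Finset.univ_nonempty)
    rw [hS, ← SimplicialStrat.mem_truncated_iff hst' hx] at e
    rw [e, and_iff_right_iff_imp]
    intro hxt
    -- The stratum `S` belongs to the full face, for which `μ` is an empty sum. Truncation at all
    -- proper faces therefore puts `x` in the open simplex.
    have hxu : SimplicialStrat.mu Finset.univ x = 0 := by simp [SimplicialStrat.mu]
    rw [← hS]
    exact (hp.mem_iff Finset.univ_nonempty hx).2
      (SimplicialStrat.mem_openFace_of_truncated hδ (fun _ => hpos _) hxt hxu)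
  have hlevel : ∀ R, Z.Prec R S → ∀ t ∈ Icc (τ' R (Z.dim R)) (τ R),
      {x | x ∈ stdSimplex ℝ (Fin (Z.dim S + 1)) ∧
        h x ∈ D.core τ' S ∧ h x ∈ D.U R ∧ D.ρ R (h x) = t} =
      {x | (x ∈ stdSimplex ℝ (Fin (Z.dim S + 1)) ∧ h x ∈ D.core τ' S) ∧
        SimplicialStrat.mu (Z.faceVertices R h) x = t * δ' R} := by
    intro R hR t ht
    obtain ⟨A, hA, hAu, rfl⟩ := hprec.1 hR
    ext x
    simp only [mem_ofPred_eq, and_assoc]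
    refine and_congr_right fun hx => and_congr_right fun hxc => ?_
    simp only [δ', hp.faceVertices_eq hA, mul_comm t]
    exact (hst' A hA hAu x
      (SimplicialStrat.truncated_mono hAu.subset ((hcore x hx).1 hxc))).1 t ht
  have hΔ : {x | x ∈ stdSimplex ℝ (Fin (Z.dim S + 1)) ∧ h x ∈ D.core τ' S} =
      {x | x ∈ stdSimplex ℝ (Fin (Z.dim S + 1)) ∧ ∀ R, Z.Prec R S →
        δ' R * τ' R (Z.dim R) ≤ SimplicialStrat.mu (Z.faceVertices R h) x} := by
    ext x
    refine and_congr_right fun hx => ?_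
    rw [hcore x hx, hpoly, and_iff_right hx]
  refine ⟨h, ⟨hp.diffeo, fun A hA => ⟨T A, hp.image A hA⟩⟩, fun R hR t ht =>
    ⟨t * δ' R, ?_⟩, δ', fun R _ => hδ _, _, ?_, rfl, hlevel, ?_, hΔ⟩
  · rw [hlevel R hR t ht]
    exact fun x hx => ⟨hx.1.1, hx.2⟩
  · rw [hΔ]
    ext x
    simp only [mem_ofPred_eq, mem_sdiff, mem_iUnion, not_exists, mem_Ico]
    refine and_congr_right fun hx => forall_congr' fun R => forall_congr' fun _ => ?_
    rw [and_iff_right (SimplicialStrat.mu_nonneg hx), not_lt]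
  · refine (Set.finite_range T).subset fun R hR => ?_
    obtain ⟨A, -, -, rfl⟩ := hprec.1 hR
    exact mem_range_self A
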